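/- **Theorem 3.14.** Let $1<p,s<\infty$. There are constants $C=C(p,s,n)>0$, which for $p\le s$ do not depend on $n$ (that is, $C=C(p,s)$), such that the following holds for every integer $n\ge 2$. *Setting.* Let $\Omega\subseteq\mathbb R^n$ be a domain (nonempty, connected, open); $\omega\Subset\Omega$ means that $\overline\omega$ is a compact subset of $\Omega$. Let $a=(a_1,\dots,a_n)$ be Lebesgue measurable functions on $\Omega$ such that for every domain $\omega\Subset\Omega$ there are positive constants $c_\omega,C_\omega$ with $c_\omega\le a_i\le C_\omega$ a.e. in $\omega$ for all $i$, and put $|\xi|_{s,a}=\big(\sum_{i=1}^n a_i(x)|\xi_i|^s\big)^{1/s}$. Let $A$ be a measurable function on $\Omega$ with values in the real $n\times n$ matrices such that (1) $A(x)$ is symmetric for almost all $x\in\Omega$; (2) for every domain $\omega\Subset\Omega$ there are positive constants $\theta_{1,\omega},\theta_{2,\omega}$ with $\theta_{1,\omega}|\xi|\le|\xi|_A:=\sqrt{A(x)\xi\cdot\xi}\le\theta_{2,\omega}|\xi|$ for almost all $x\in\omega$ and all $\xi\in\mathbb R^n$. Put $$H(x,\xi)=\big(|\xi|_{s,a}^p+|\xi|_A^p\big)^{1/p},\qquad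 \mathcal A(x,\xi)=\nabla_\xi\Big(\tfrac1p H(x,\xi)^p\Big).$$ Let $V\in M^q_{\rm loc}(p;\Omega)$, the local Morrey space: for every domain $\omega\Subset\Omega$, $V\in L^1_{\rm loc}(\omega)$ and, with the suprema taken over $y\in\omega$ and $0<r<\operatorname{diam}\omega$, * if $p<n$: $q>n/p$ and $\sup r^{-n/q'}\int_{\omega\cap B_r(y)}|V|\,dx<\infty$, where $q'=q/(q-1)$; * if $p=n$: $q>n$ and $\sup\big(\log(\operatorname{diam}(\omega)/r)\big)^{q/n'}\int_{\omega\cap B_r(y)}|V|\,dx<\infty$, where $n'=n/(n-1)$; * if $p>n$: $q=1$ and $V\in L^1(\omega)$. Let $Q[\phi]=\int_\Omega\big(H(x,\nabla\phi)^p+V|\phi|^p\big)\,dx$, and let $u\in W^{1,p}_{\rm loc}(\Omega)\cap C(\Omega)$ be a positive weak solution of $-\operatorname{div}\mathcal A(x,\nabla v)+V|v|^{p-2}v=0$ in $\Omega$, that is, $\int_\Omega\mathcal A(x,\nabla u)\cdot\nabla\phi\,dx+\int_\Omega V|u|^{p-2}u\,\phi\,dx=0$ for all $\phi\in C_c^\infty(\Omega)$.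 (The existence of such a $u$ implies $Q\ge0$ on $W^{1,p}(\Omega)\cap C_c(\Omega)$.) Let $\mathcal H(\Omega)$ be the set of all Hardy-weights of $Q$: all $g\in L^1_{\rm loc}(\Omega)$ for which there is a $c>0$ with $Q[\phi]\ge c\int_\Omega|g||\phi|^p\,dx$ for all $\phi\in C_c^\infty(\Omega)$. For $g\in L^1_{\rm loc}(\Omega)$ and compact $K\subseteq\Omega$ put, with values in $[0,\infty]$ (and $\inf\emptyset=\infty$, $\infty^{-1}=0$, $0^{-1}=\infty$), $$\|g\|_{\mathcal H}=\Big(\inf\Big\{\tfrac{Q[\phi]}{\int_\Omega|g||\phi|^p dx}\ \Big|\ \phi\in W^{1,p}(\Omega)\cap C_c(\Omega),\ \int_\Omega|g||\phi|^p dx>0\Big\}\Big)^{-1},$$ $$\operatorname{cap}(K,u)=\inf\{Q[\phi]\mid\phi\in W^{1,p}(\Omega)\cap C_c(\Omega),\ \phi\ge u\text{ on }K\},$$ $$\|g\|_u=\inf\Big\{L\in[0,\infty)\ \Big|\ \int_K|g||u|^p dx\le L\operatorname{cap}(K,u)\text{ for all compact }K\subseteq\Omega\Big\}.$$ *Conclusion.*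 1. For all $g\in L^1_{\rm loc}(\Omega)$: $g\in\mathcal H(\Omega)$ if and only if $\|g\|_u<\infty$. 2. For all $g\in\mathcal H(\Omega)$: $\|g\|_u\le\|g\|_{\mathcal H}\le C\,\|g\|_u$. 3. $(\mathcal H(\Omega),\|\cdot\|_u)$, with functions equal a.e. in $\Omega$ identified, is a Banach space. -/

import Mathlib

open MeasureTheory Set Filter Topology
open scoped ENNReal NNReal

noncomputable section

namespace FinslerHardy

/-- Euclidean space `ℝⁿ`. Functions on an open set `Ω` are represented by functions on `ℝⁿ`
of which only the restriction to `Ω` matters; functions with compact support in `Ω` are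
extended by zero. -/
abbrev E (n : ℕ) : Type := EuclideanSpace ℝ (Fin n)

variable {n : ℕ}

/-- A domain: a nonempty, connected, open set. -/
def IsDom (Ω : Set (E n)) : Prop := IsOpen Ω ∧ IsConnected Ω

/-- `ω ⋐ Ω`: `ω` is a domain whose closure is a compact subset of `Ω`. -/
def IsSubdom (ω Ω : Set (E n)) : Prop := IsDom ω ∧ IsCompact (closure ω) ∧ closure ω ⊆ Ω

/-! ### Function spaces -/

/-- `φ ∈ C_c^∞(Ω)`. -/
def IsTest (Ω : Set (E n)) (φ : E n → ℝ) : Prop :=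
  ContDiff ℝ (⊤ : ℕ∞) φ ∧ HasCompactSupport φ ∧ tsupport φ ⊆ Ω

/-- `G` is a weak gradient of `f` in `Ω`. -/
def HasWeakGrad (Ω : Set (E n)) (f : E n → ℝ) (G : E n → E n) : Prop :=
  LocallyIntegrableOn f Ω ∧ LocallyIntegrableOn G Ω ∧
    ∀ φ : E n → ℝ, IsTest Ω φ → ∀ i : Fin n,
      ∫ x in Ω, f x * fderiv ℝ φ x (EuclideanSpace.single i 1) = -∫ x in Ω, G x i * φ x

open Classical in
/-- The weak gradient `∇f` in `Ω` (unique up to a null subset of `Ω`; zero if there is none). -/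
def weakGrad (Ω : Set (E n)) (f : E n → ℝ) : E n → E n :=
  if h : ∃ G, HasWeakGrad Ω f G then h.choose else 0

/-- `f ∈ W^{1,p}(Ω)`. -/
def MemW1p (p : ℝ) (Ω : Set (E n)) (f : E n → ℝ) : Prop :=
  MemLp f (ENNReal.ofReal p) (volume.restrict Ω) ∧
    ∃ G, HasWeakGrad Ω f G ∧ MemLp G (ENNReal.ofReal p) (volume.restrict Ω)

/-- `f ∈ W^{1,p}_loc(Ω)`: `f` and its weak gradient are in `L^p(K)` for all compact `K ⊆ Ω`. -/
def MemW1pLoc (p : ℝ) (Ω : Set (E n)) (f : E n → ℝ) : Prop :=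
  (∀ K ⊆ Ω, IsCompact K → MemLp f (ENNReal.ofReal p) (volume.restrict K)) ∧
    ∃ G, HasWeakGrad Ω f G ∧
      ∀ K ⊆ Ω, IsCompact K → MemLp G (ENNReal.ofReal p) (volume.restrict K)

/-- `f ∈ W^{1,p}(Ω) ∩ C_c(Ω)`. -/
def MemW1pCc (p : ℝ) (Ω : Set (E n)) (f : E n → ℝ) : Prop :=
  MemW1p p Ω f ∧ Continuous f ∧ HasCompactSupport f ∧ tsupport f ⊆ Ω

/-- The Morrey norm of `M^q(p; ω)` for `p < n`, where `q' = q / (q - 1)`. -/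
def morreyNorm (q : ℝ) (ω : Set (E n)) (f : E n → ℝ) : ℝ≥0∞ :=
  ⨆ y ∈ ω, ⨆ r ∈ Ioo 0 (Metric.diam ω),
    ENNReal.ofReal (1 / r ^ ((n : ℝ) / (q / (q - 1)))) * ∫⁻ x in ω ∩ Metric.ball y r, ‖f x‖ₑ

/-- The Morrey norm of `M^q(n; ω)`, with weight `(log (diam ω / r))^{q / n'}`,
`n' = n / (n - 1)`. -/
def morreyNormCritical (q : ℝ) (ω : Set (E n)) (f : E n → ℝ) : ℝ≥0∞ :=
  ⨆ y ∈ ω, ⨆ r ∈ Ioo 0 (Metric.diam ω),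
    ENNReal.ofReal (Real.log (Metric.diam ω / r) ^ (q / ((n : ℝ) / ((n : ℝ) - 1)))) *
      ∫⁻ x in ω ∩ Metric.ball y r, ‖f x‖ₑ

/-- `f ∈ M^q(p; ω)`; the exponent `q` has to satisfy `q > n / p` if `p < n`, `q > n` if `p = n`,
and `q = 1` if `p > n`. -/
def MemMorrey (p q : ℝ) (ω : Set (E n)) (f : E n → ℝ) : Prop :=
  LocallyIntegrableOn f ω ∧
    ((p < n ∧ n / p < q ∧ morreyNorm q ω f < ⊤) ∨
      (p = n ∧ n < q ∧ morreyNormCritical q ω f < ⊤) ∨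
      (n < p ∧ q = 1 ∧ IntegrableOn f ω))

/-- `f ∈ M^q_loc(p; Ω)`. -/
def MemMorreyLoc (p q : ℝ) (Ω : Set (E n)) (f : E n → ℝ) : Prop :=
  ∀ ω, IsSubdom ω Ω → MemMorrey p q ω f

/-! ### The norms -/

/-- The weighted `s`-norm `|ξ|_{s,a}` at a point where the weight has the value `a`. -/
def sNorm (s : ℝ) (a : Fin n → ℝ) (ξ : E n) : ℝ := (∑ i, a i * |ξ i| ^ s) ^ (1 / s)

/-- `|ξ|_A = √(Aξ·ξ)`. -/
def matNorm (A : Matrix (Fin n) (Fin n) ℝ) (ξ : E n) : ℝ :=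
  Real.sqrt ((A.mulVec (fun i => ξ i)) ⬝ᵥ (fun i => ξ i))

/-- `H(x, ξ) = (|ξ|_{s,a(x)}^p + |ξ|_{A(x)}^p)^{1/p}`. -/
def mixedNorm (p s : ℝ) (a : E n → Fin n → ℝ) (A : E n → Matrix (Fin n) (Fin n) ℝ)
    (x ξ : E n) : ℝ :=
  (sNorm s (a x) ξ ^ p + matNorm (A x) ξ ^ p) ^ (1 / p)

/-- The weights `a₁, …, aₙ` are measurable in `Ω` and locally equivalent to `1`. -/
def IsWeight (Ω : Set (E n)) (a : E n → Fin n → ℝ) : Prop :=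
  (∀ i, AEMeasurable (fun x => a x i) (volume.restrict Ω)) ∧
    ∀ ω, IsSubdom ω Ω → ∃ c C : ℝ, 0 < c ∧ 0 < C ∧
      ∀ᵐ x ∂(volume.restrict ω), ∀ i, c ≤ a x i ∧ a x i ≤ C

/-- `A` is measurable and a.e. symmetric in `Ω`, locally uniformly elliptic and bounded. -/
def IsEllipticMatrix (Ω : Set (E n)) (A : E n → Matrix (Fin n) (Fin n) ℝ) : Prop :=
  (∀ i j, AEMeasurable (fun x => A x i j) (volume.restrict Ω)) ∧
    (∀ᵐ x ∂(volume.restrict Ω), (A x).IsSymm) ∧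
    ∀ ω, IsSubdom ω Ω → ∃ θ₁ θ₂ : ℝ, 0 < θ₁ ∧ 0 < θ₂ ∧
      ∀ᵐ x ∂(volume.restrict ω), ∀ ξ : E n,
        θ₁ * ‖ξ‖ ≤ matNorm (A x) ξ ∧ matNorm (A x) ξ ≤ θ₂ * ‖ξ‖

/-! ### The functional and the equation, for a family of norms `H` and a potential `V` -/

/-- `𝒜(x, ξ) = ∇_ξ F(x, ξ)`, where `F(x, ξ) = H(x, ξ)^p / p`. -/
def flux (p : ℝ) (H : E n → E n → ℝ) (x ξ : E n) : E n :=
  gradient (fun ζ => 1 / p * H x ζ ^ p) ξ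

/-- `Q[φ] = ∫_Ω (H(x, ∇φ)^p + V |φ|^p) dx`. -/
def energy (p : ℝ) (Ω : Set (E n)) (H : E n → E n → ℝ) (V φ : E n → ℝ) : ℝ :=
  ∫ x in Ω, (H x (weakGrad Ω φ x) ^ p + V x * |φ x| ^ p)

/-- `v ∈ W^{1,p}_loc(Ω)` is a weak solution of `Q'[v] = -div 𝒜(x, ∇v) + V |v|^{p-2} v = 0`
in `Ω`. -/
def IsSolution (p : ℝ) (Ω : Set (E n)) (H : E n → E n → ℝ) (V v : E n → ℝ) : Prop :=
  MemW1pLoc p Ω v ∧ ∀ φ, IsTest Ω φ →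
    (∫ x in Ω, inner ℝ (flux p H x (weakGrad Ω v x)) (gradient φ x)) +
      ∫ x in Ω, V x * |v x| ^ (p - 2) * v x * φ x = 0

/-- `g` is a Hardy-weight of `Q` in `Ω`, i.e. `g ∈ ℋ(Ω)`. -/
def IsHardyWeight (p : ℝ) (Ω : Set (E n)) (H : E n → E n → ℝ) (V g : E n → ℝ) : Prop :=
  LocallyIntegrableOn g Ω ∧ ∃ C : ℝ, 0 < C ∧ ∀ φ, IsTest Ω φ →
    C * ∫ x in Ω, |g x| * |φ x| ^ p ≤ energy p Ω H V φ

/-- The weighted integral `∫_S |g| |φ|^p dx ∈ [0, ∞]`. -/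
def wInt (p : ℝ) (S : Set (E n)) (g φ : E n → ℝ) : ℝ≥0∞ :=
  ∫⁻ x in S, ENNReal.ofReal (|g x| * |φ x| ^ p)

/-- The Hardy constant `S_g ∈ [0, ∞]`, the infimum of `Q[φ] / ∫_Ω |g| |φ|^p dx` over all
`φ ∈ W^{1,p}(Ω) ∩ C_c(Ω)` with positive denominator. It is meant for nonnegative `Q`, for which
`ENNReal.ofReal` truncates nothing. -/
def hardyConst (p : ℝ) (Ω : Set (E n)) (H : E n → E n → ℝ) (V g : E n → ℝ) : ℝ≥0∞ :=
  ⨅ (φ : E n → ℝ) (_ : MemW1pCc p Ω φ) (_ : 0 < wInt p Ω g φ),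
    ENNReal.ofReal (energy p Ω H V φ) / wInt p Ω g φ

/-- `‖g‖_ℋ = S_g⁻¹ ∈ [0, ∞]`. -/
def hardyNorm (p : ℝ) (Ω : Set (E n)) (H : E n → E n → ℝ) (V g : E n → ℝ) : ℝ≥0∞ :=
  (hardyConst p Ω H V g)⁻¹

/-- The `Q`-capacity of `K` with respect to `(u, Ω)`, the infimum of `Q[φ]` over all
`φ ∈ W^{1,p}(Ω) ∩ C_c(Ω)` with `φ ≥ u` on `K` (again for nonnegative `Q`). -/
def capacity (p : ℝ) (Ω : Set (E n)) (H : E n → E n → ℝ) (V u : E n → ℝ) (K : Set (E n)) :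
    ℝ≥0∞ :=
  ⨅ (φ : E n → ℝ) (_ : MemW1pCc p Ω φ) (_ : ∀ x ∈ K, u x ≤ φ x),
    ENNReal.ofReal (energy p Ω H V φ)

/-- `‖g‖_u ∈ [0, ∞]`, the infimum of all `L ∈ [0, ∞)` with `∫_K |g| |u|^p dx ≤ L cap(K, u)` for
all compact `K ⊆ Ω`. -/
def capNorm (p : ℝ) (Ω : Set (E n)) (H : E n → E n → ℝ) (V u g : E n → ℝ) : ℝ≥0∞ :=
  ⨅ (L : ℝ≥0) (_ : ∀ K ⊆ Ω, IsCompact K → wInt p K g u ≤ L * capacity p Ω H V u K), (L : ℝ≥0∞)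

/-- The set `S` is a linear subspace of `X` on which `N` is a (finite) norm, and `(S, N)` is
complete, i.e. it is a Banach space. -/
structure IsBanachSpace {X : Type} [AddCommGroup X] [Module ℝ X] (S : Set X) (N : X → ℝ≥0∞) :
    Prop where
  zero_mem : 0 ∈ S
  add_mem : ∀ f ∈ S, ∀ g ∈ S, f + g ∈ S
  smul_mem : ∀ (c : ℝ), ∀ f ∈ S, c • f ∈ S
  finite : ∀ f ∈ S, N f < ⊤
  eq_zero_iff : ∀ f ∈ S, N f = 0 ↔ f = 0
  smul : ∀ (c : ℝ), ∀ f ∈ S, N (c • f) = ENNReal.ofReal |c| * N f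
  triangle : ∀ f ∈ S, ∀ g ∈ S, N (f + g) ≤ N f + N g
  complete : ∀ F : ℕ → X, (∀ k, F k ∈ S) →
    (∀ ε : ℝ≥0∞, 0 < ε → ∃ k₀, ∀ j ≥ k₀, ∀ k ≥ k₀, N (F j - F k) < ε) →
    ∃ f ∈ S, Tendsto (fun k => N (F k - f)) atTop (𝓝 0)

end FinslerHardy

end

open FinslerHardy

open MeasureTheory Set Filter Topology
open scoped ENNReal NNReal

noncomputable section

namespace FinslerHardy

/-! Let F(x, ξ) = H(x, ξ)^p / p, and let D(X, Z) = F(Z) - F(X) - F'(X)(Z - X) be the Bregman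
distance of F(x, ·). Testing the equation for u with |φ|^p u^(1-p) gives a Picone identity, Q[φ] = p
∫ D((φ/u) ∇u, ∇φ) dx (`IsSolution.energy_eq`). So Q is the integral of a nonnegative density,
whatever the sign of V, and this density vanishes where φ/u is locally constant.

This permits Maz'ya's truncation argument at the level of φ/u. For a cutoff ρ that is 0 on [-1, 1]
and 1 outside (-2, 2), the function φ' = u ρ(φ/(cu)) equals u where φ ≥ 2cu (and where φ ≤ -2cu), so
it competes for the capacity of that set, and its energy lives on the layer cu < |φ| < 2cu. For c =
2^j the layers are disjoint, and summation bounds ∫ |g| |φ|^p by a constant times ‖g‖_u Q[φ]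
(`exists_wInt_le_energy`).

The point is to compare the densities of φ' and φ inside a layer. This rests on quasi-symmetry, D(Z,
X) ≤ C D(X, Z). The radial derivative of t ↦ D(X, X + tY) is (D(X, X + tY) + D(X + tY, X)) / t, so
this function is nondecreasing for t ≥ 0 and, by quasi-symmetry, grows at most like t^(1+C) for t ≥
1 (`IsQuasiSymm.bregman_ray_le`). A cutoff vanishing to high order absorbs this polynomial loss
(`exists_cutoff`, `IsQuasiSymm.bregman_cutoff_le`).

Quasi-symmetry survives linear substitutions and sums, so it is enough to prove it for powers of
ℓ^s-norms (`exists_isQuasiSymm_lpPow`). Legendre duality reduces this to s ≤ p, a chain rule splits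
it into an outer power and a sum of scalar powers, and the scalar case is elementary. No constant
sees the dimension.

The bound ‖g‖_u ≤ ‖g‖_ℋ follows by inserting competitors for the capacity into the Hardy inequality,
which extends from test functions by mollification. Completeness is a Riesz–Fischer argument:
summable increments give an a.e. limit, and Fatou's lemma turns it into a limit in norm. -/

/-! ### Bregman distances -/

section Bregman

variable {W W' : Type*} [NormedAddCommGroup W] [NormedSpace ℝ W]
  [NormedAddCommGroup W'] [NormedSpace ℝ W']

/-- The Bregman distance of a differentiable function. -/
def bregman (F : W → ℝ) (X Z : W) : ℝ := F Z - F X - fderiv ℝ F X (Z - X)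

/-- `F` is differentiable and convex, and its Bregman distance is symmetric up to the
factor `C`. -/
structure IsQuasiSymm (C : ℝ) (F : W → ℝ) : Prop where
  diff : Differentiable ℝ F
  nonneg : ∀ X Z, 0 ≤ bregman F X Z
  le : ∀ X Z, bregman F Z X ≤ C * bregman F X Z

theorem bregman_self (F : W → ℝ) (X : W) : bregman F X X = 0 := by simp [bregman]

theorem bregman_comp {F : W' → ℝ} (hF : Differentiable ℝ F) (T : W →L[ℝ] W') (X Z : W) :
    bregman (fun x => F (T x)) X Z = bregman F (T X) (T Z) := by
  have h : HasFDerivAt (fun x => F (T x)) ((fderiv ℝ F (T X)).comp T) X :=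
    (hF (T X)).hasFDerivAt.comp X T.hasFDerivAt
  simp [bregman, h.fderiv]

theorem bregman_add {F G : W → ℝ} (hF : Differentiable ℝ F) (hG : Differentiable ℝ G) (X Z : W) :
    bregman (fun x => F x + G x) X Z = bregman F X Z + bregman G X Z := by
  simp only [bregman, fderiv_fun_add (hF X) (hG X), _root_.add_apply]
  ring

theorem bregman_const_mul {F : W → ℝ} (hF : Differentiable ℝ F) (c : ℝ) (X Z : W) :
    bregman (fun x => c * F x) X Z = c * bregman F X Z := by
  simp only [bregman, fderiv_const_mul (hF X) c, _root_.smul_apply, smul_eq_mul]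
  ring

theorem bregman_sum {ι : Type*} {s : Finset ι} {F : ι → W → ℝ}
    (hF : ∀ i, Differentiable ℝ (F i)) (X Z : W) :
    bregman (fun x => ∑ i ∈ s, F i x) X Z = ∑ i ∈ s, bregman (F i) X Z := by
  simp only [bregman, fderiv_fun_sum (fun i _ => hF i X), _root_.sum_apply,
    Finset.sum_sub_distrib]

namespace IsQuasiSymm

variable {C : ℝ} {F G : W → ℝ}

theorem mono {C' : ℝ} (h : IsQuasiSymm C F) (hC : C ≤ C') : IsQuasiSymm C' F :=
  ⟨h.diff, h.nonneg, fun X Z => (h.le X Z).trans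
    (mul_le_mul_of_nonneg_right hC (h.nonneg X Z))⟩

theorem comp {F : W' → ℝ} (h : IsQuasiSymm C F) (T : W →L[ℝ] W') :
    IsQuasiSymm C (fun x => F (T x)) where
  diff := h.diff.comp T.differentiable
  nonneg X Z := by rw [bregman_comp h.diff]; exact h.nonneg _ _
  le X Z := by rw [bregman_comp h.diff, bregman_comp h.diff]; exact h.le _ _

theorem add (hF : IsQuasiSymm C F) (hG : IsQuasiSymm C G) :
    IsQuasiSymm C (fun x => F x + G x) where
  diff := hF.diff.add hG.diff
  nonneg X Z := by
    rw [bregman_add hF.diff hG.diff]; exact add_nonneg (hF.nonneg _ _) (hG.nonneg _ _)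
  le X Z := by
    rw [bregman_add hF.diff hG.diff, bregman_add hF.diff hG.diff, mul_add]
    exact add_le_add (hF.le _ _) (hG.le _ _)

theorem const_mul (hF : IsQuasiSymm C F) {c : ℝ} (hc : 0 ≤ c) :
    IsQuasiSymm C (fun x => c * F x) where
  diff := hF.diff.const_mul c
  nonneg X Z := by rw [bregman_const_mul hF.diff]; exact mul_nonneg hc (hF.nonneg _ _)
  le X Z := by
    rw [bregman_const_mul hF.diff, bregman_const_mul hF.diff, mul_left_comm]
    exact mul_le_mul_of_nonneg_left (hF.le _ _) hc

theorem sum {ι : Type*} {s : Finset ι} {F : ι → W → ℝ} (hF : ∀ i, IsQuasiSymm C (F i)) :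
    IsQuasiSymm C (fun x => ∑ i ∈ s, F i x) where
  diff := Differentiable.fun_sum fun i _ => (hF i).diff
  nonneg X Z := by
    rw [bregman_sum fun i => (hF i).diff]; exact Finset.sum_nonneg fun i _ => (hF i).nonneg _ _
  le X Z := by
    rw [bregman_sum fun i => (hF i).diff, bregman_sum fun i => (hF i).diff, Finset.mul_sum]
    exact Finset.sum_le_sum fun i _ => (hF i).le _ _

end IsQuasiSymm

/-! The scalar case -/

theorem bregman_abs_rpow {r : ℝ} (hr : 1 < r) (x z : ℝ) :
    bregman (fun t : ℝ => |t| ^ r) x z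
      = |z| ^ r + (r - 1) * |x| ^ r - r * (|x| ^ (r - 2) * x * z) := by
  have hx : |x| ^ r = |x| ^ (r - 2) * x * x := by
    rcases eq_or_ne x 0 with rfl | hx
    · simp [Real.zero_rpow (by linarith : r ≠ 0)]
    · have : |x| ^ r = |x| ^ (r - 2) * |x| ^ (2 : ℝ) := by
        rw [← Real.rpow_add (abs_pos.2 hx)]; ring_nf
      rw [this, Real.rpow_two, sq_abs]; ring
  rw [bregman, (hasDerivAt_abs_rpow x hr).hasFDerivAt.fderiv]
  simp only [ContinuousLinearMap.toSpanSingleton_apply, smul_eq_mul]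
  rw [hx]; ring

theorem bregman_abs_rpow_nonneg {r : ℝ} (hr : 1 < r) (x z : ℝ) :
    0 ≤ bregman (fun t : ℝ => |t| ^ r) x z := by
  have hc : ConvexOn ℝ univ (fun t : ℝ => |t| ^ r) := by
    have h1 : ConvexOn ℝ univ (fun t : ℝ => ‖t‖) := convexOn_norm convex_univ
    refine ConvexOn.comp (g := fun t : ℝ => t ^ r) (f := fun t : ℝ => |t|) ?_ h1 ?_
    · refine (convexOn_rpow hr.le).subset ?_ ?_
      · rintro _ ⟨t, -, rfl⟩; exact abs_nonneg t
      · have : (fun t : ℝ => |t|) '' univ = Ici 0 := by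
          ext y; constructor
          · rintro ⟨t, -, rfl⟩; exact abs_nonneg t
          · intro hy; exact ⟨y, trivial, abs_of_nonneg hy⟩
        rw [this]; exact convex_Ici 0
    · rintro _ ⟨t, -, rfl⟩ _ ⟨t', -, rfl⟩ h
      exact Real.rpow_le_rpow (abs_nonneg _) h (by linarith)
  have hd := hasDerivAt_abs_rpow x hr
  rw [bregman, hd.hasFDerivAt.fderiv]
  simp only [ContinuousLinearMap.toSpanSingleton_apply, smul_eq_mul]
  rcases lt_trichotomy x z with h | h | h
  · have := hc.le_slope_of_hasDerivAt (mem_univ x) (mem_univ z) h hd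
    rw [slope_def_field, le_div_iff₀ (by linarith)] at this
    linarith
  · simp [h]
  · have := hc.slope_le_of_hasDerivAt (mem_univ z) (mem_univ x) h hd
    rw [slope_def_field, div_le_iff₀ (by linarith)] at this
    linarith

/-- The two sides compare the Bregman distances of |·|^r from t to 1 and from 1 to t; homogeneity
reduces every pair with nonzero base point to this one. For t < 0 all terms of both distances are
nonnegative, so only their sizes matter; for t > 0 Bernoulli's inequality gives the factor r - 1. -/
theorem bregman_one_le {r : ℝ} (hr : 2 ≤ r) (t : ℝ) :
    1 + (r - 1) * |t| ^ r - r * (|t| ^ (r - 2) * t)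
      ≤ 2 * r * (|t| ^ r + (r - 1) - r * t) := by
  have hb : 0 ≤ |t| ^ r + (r - 1) - r * t := by
    have := bregman_abs_rpow_nonneg (r := r) (by linarith) 1 t
    rw [bregman_abs_rpow (by linarith)] at this
    simpa using this
  rcases lt_trichotomy t 0 with h | h | h
  · have ht : |t| = -t := abs_of_neg h
    have h1 : |t| ^ (r - 2) * t = -(|t| ^ (r - 1)) := by
      have : |t| ^ (r - 1) = |t| ^ (r - 2) * |t| := by
        rw [← Real.rpow_add_one (abs_pos.2 h.ne).ne']; ring_nf
      rw [this, ht]; ring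
    have h2 : |t| ^ (r - 1) ≤ |t| ^ r + |t| := by
      rcases le_total |t| 1 with h' | h'
      · have : |t| ^ (r - 1) ≤ |t| ^ (1 : ℝ) :=
          Real.rpow_le_rpow_of_exponent_ge (abs_pos.2 h.ne) h' (by linarith)
        rw [Real.rpow_one] at this
        have := Real.rpow_nonneg (abs_nonneg t) r
        linarith
      · have : |t| ^ (r - 1) ≤ |t| ^ r :=
          Real.rpow_le_rpow_of_exponent_le h' (by linarith)
        linarith [abs_nonneg t]
    rw [h1]
    have h3 := Real.rpow_nonneg (abs_nonneg t) r
    rw [ht] at h2 h3 ⊢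
    have h4 := mul_le_mul_of_nonneg_left h2 (by linarith : (0 : ℝ) ≤ r)
    have h5 : 0 ≤ r * ((r - 1) * (-t)) := by
      have : 0 ≤ r - 1 := by linarith
      have : 0 ≤ -t := by linarith
      positivity
    nlinarith
  · subst h
    simp [Real.zero_rpow (by linarith : r ≠ 0)]
    nlinarith
  · have ht : |t| = t := abs_of_pos h
    have h1 : |t| ^ (r - 2) * t = t ^ (r - 1) := by
      rw [ht, ← Real.rpow_add_one h.ne']; ring_nf
    -- Bernoulli for the exponent r - 1, which is at least 1 because 2 ≤ r.
    have hB := one_add_mul_self_le_rpow_one_add (s := t - 1) (by linarith) (p := r - 1)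
      (by linarith)
    rw [show 1 + (t - 1) = t by ring] at hB
    rw [h1]
    have : 1 + (r - 1) * |t| ^ r - r * t ^ (r - 1) ≤ (r - 1) * (|t| ^ r + (r - 1) - r * t) := by
      nlinarith
    nlinarith

theorem isQuasiSymm_abs_rpow_of_two_le {r : ℝ} (hr : 2 ≤ r) :
    IsQuasiSymm (2 * r) (fun t : ℝ => |t| ^ r) where
  diff x := (hasDerivAt_abs_rpow x (by linarith)).differentiableAt
  nonneg := bregman_abs_rpow_nonneg (by linarith)
  le x z := by
    rw [bregman_abs_rpow (by linarith), bregman_abs_rpow (by linarith)]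
    rcases eq_or_ne x 0 with rfl | hx
    · have := Real.rpow_nonneg (abs_nonneg z) r
      simp [Real.zero_rpow (by linarith : r ≠ 0)]
      nlinarith
    · obtain ⟨t, rfl⟩ : ∃ t, z = t * x := ⟨z / x, by field_simp⟩
      have hx2 : |x| ^ (r - 2) * (x * x) = |x| ^ r := by
        have : |x| ^ r = |x| ^ (r - 2) * |x| ^ (2 : ℝ) := by
          rw [← Real.rpow_add (abs_pos.2 hx)]; ring_nf
        rw [this, Real.rpow_two, sq_abs]; ring
      have key := mul_le_mul_of_nonneg_left (bregman_one_le hr t)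
        (Real.rpow_nonneg (abs_nonneg x) r)
      rw [abs_mul, Real.mul_rpow (abs_nonneg _) (abs_nonneg _),
        Real.mul_rpow (abs_nonneg _) (abs_nonneg _)]
      calc _ = |x| ^ r * (1 + (r - 1) * |t| ^ r - r * (|t| ^ (r - 2) * t)) := by
              rw [show |t| ^ (r - 2) * |x| ^ (r - 2) * (t * x) * x
                = |t| ^ (r - 2) * t * (|x| ^ (r - 2) * (x * x)) by ring, hx2]; ring
        _ ≤ _ := key
        _ = _ := by
              rw [show |x| ^ (r - 2) * x * (t * x) = t * (|x| ^ (r - 2) * (x * x)) by ring, hx2]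
              ring

end Bregman

/-! ### Powers of the `ℓ^s`-norm -/

section LpPow

variable {ι : Type*} [Fintype ι]

/-- `∑ |X i| ^ s`. -/
def powSum (s : ℝ) (X : ι → ℝ) : ℝ := ∑ i, |X i| ^ s

/-- The `p`-th power of the `ℓ^s`-norm, divided by `p`. -/
def lpPow (p s : ℝ) (X : ι → ℝ) : ℝ := 1 / p * powSum s X ^ (p / s)

/-- The gradient of `lpPow`. -/
def lpDual (p s : ℝ) (X : ι → ℝ) (i : ι) : ℝ :=
  powSum s X ^ (p / s - 1) * (|X i| ^ (s - 2) * X i)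

theorem powSum_nonneg (s : ℝ) (X : ι → ℝ) : 0 ≤ powSum s X :=
  Finset.sum_nonneg fun _ _ => Real.rpow_nonneg (abs_nonneg _) _

theorem powSum_zero {s : ℝ} (hs : s ≠ 0) : powSum s (0 : ι → ℝ) = 0 := by
  simp [powSum, Real.zero_rpow hs]

theorem powSum_eq_zero {s : ℝ} (hs : s ≠ 0) {X : ι → ℝ} (h : powSum s X = 0) : X = 0 := by
  ext i
  have := (Finset.sum_eq_zero_iff_of_nonneg
    fun i _ => Real.rpow_nonneg (abs_nonneg (X i)) s).1 h i (Finset.mem_univ i)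
  rw [Real.rpow_eq_zero (abs_nonneg _) hs] at this
  simpa using this

theorem abs_rpow_eq_mul {s : ℝ} (hs : s ≠ 0) (x : ℝ) : |x| ^ (s - 2) * x * x = |x| ^ s := by
  rcases eq_or_ne x 0 with rfl | hx
  · simp [Real.zero_rpow hs]
  · have : |x| ^ s = |x| ^ (s - 2) * |x| ^ (2 : ℝ) := by
      rw [← Real.rpow_add (abs_pos.2 hx)]; ring_nf
    rw [this, Real.rpow_two, sq_abs]; ring

theorem abs_rpow_sub_two_mul {s : ℝ} (hs : 1 < s) (x : ℝ) :
    |(|x| ^ (s - 2) * x)| = |x| ^ (s - 1) := by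
  rcases eq_or_ne x 0 with rfl | hx
  · simp [Real.zero_rpow (by linarith : s - 1 ≠ 0)]
  · rw [abs_mul, abs_of_nonneg (Real.rpow_nonneg (abs_nonneg _) _),
      ← Real.rpow_add_one (abs_pos.2 hx).ne']
    ring_nf

theorem hasFDerivAt_powSum {s : ℝ} (hs : 1 < s) (X : ι → ℝ) :
    HasFDerivAt (powSum s) (∑ i, (s * (|X i| ^ (s - 2) * X i)) •
      (ContinuousLinearMap.proj i : (ι → ℝ) →L[ℝ] ℝ)) X := by
  have : ∀ i ∈ (Finset.univ : Finset ι), HasFDerivAt (fun Y : ι → ℝ => |Y i| ^ s)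
      ((s * (|X i| ^ (s - 2) * X i)) • (ContinuousLinearMap.proj i : (ι → ℝ) →L[ℝ] ℝ)) X := by
    intro i _
    have h := (hasDerivAt_abs_rpow (X i) hs).comp_hasFDerivAt X
      (ContinuousLinearMap.proj i : (ι → ℝ) →L[ℝ] ℝ).hasFDerivAt
    rw [mul_assoc] at h
    exact h
  exact HasFDerivAt.fun_sum this

theorem powSum_le {s : ℝ} (hs : 0 ≤ s) (X : ι → ℝ) :
    powSum s X ≤ Fintype.card ι * ‖X‖ ^ s := by
  calc powSum s X ≤ ∑ _i : ι, ‖X‖ ^ s := Finset.sum_le_sum fun i _ =>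
        Real.rpow_le_rpow (abs_nonneg _) (norm_le_pi_norm X i) hs
    _ = _ := by simp

theorem hasFDerivAt_lpPow {p s : ℝ} (hp : 1 < p) (hs : 1 < s) (X : ι → ℝ) :
    HasFDerivAt (lpPow p s) (∑ i, lpDual p s X i •
      (ContinuousLinearMap.proj i : (ι → ℝ) →L[ℝ] ℝ)) X := by
  rcases eq_or_ne X 0 with rfl | hX
  -- At the origin the outer power p / s may be less than 1 and fail to be differentiable. There the
  -- growth of order ‖X‖^p with p > 1 makes the derivative zero.
  · have h0 : (∑ i, lpDual p s (0 : ι → ℝ) i •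
        (ContinuousLinearMap.proj i : (ι → ℝ) →L[ℝ] ℝ)) = 0 := by simp [lpDual]
    rw [h0, hasFDerivAt_iff_isLittleO_nhds_zero]
    have hz : lpPow p s (0 : ι → ℝ) = 0 := by
      rw [lpPow, powSum_zero (by linarith), Real.zero_rpow (by positivity)]; simp
    simp only [zero_add, hz, _root_.zero_apply, sub_zero]
    have hO : (lpPow p s : (ι → ℝ) → ℝ) =O[𝓝 0] fun X => ‖X‖ ^ p := by
      refine Asymptotics.IsBigO.of_bound (1 / p * (Fintype.card ι : ℝ) ^ (p / s)) ?_
      refine Eventually.of_forall fun X => ?_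
      rw [lpPow, Real.norm_of_nonneg (mul_nonneg (by positivity)
        (Real.rpow_nonneg (powSum_nonneg _ _) _)),
        Real.norm_of_nonneg (Real.rpow_nonneg (norm_nonneg _) _), mul_assoc]
      refine mul_le_mul_of_nonneg_left ?_ (by positivity)
      refine (Real.rpow_le_rpow (powSum_nonneg _ _) (powSum_le (by linarith) X)
        (by positivity)).trans_eq ?_
      rw [Real.mul_rpow (by positivity) (by positivity), ← Real.rpow_mul (norm_nonneg _)]
      congr 2; field_simp
    refine hO.trans_isLittleO ?_
    have h1 : (fun X : ι → ℝ => ‖X‖ ^ p) =o[𝓝 0] fun X => ‖X‖ := by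
      rw [Asymptotics.isLittleO_iff_tendsto' (by
        filter_upwards with X hX; rw [hX, Real.zero_rpow (by linarith)])]
      have : Tendsto (fun X : ι → ℝ => ‖X‖ ^ (p - 1)) (𝓝 0) (𝓝 0) := by
        have hc : Continuous fun X : ι → ℝ => ‖X‖ ^ (p - 1) :=
          continuous_norm.rpow_const fun _ => Or.inr (by linarith)
        have := hc.tendsto 0
        rwa [norm_zero, Real.zero_rpow (by linarith)] at this
      refine this.congr fun X => ?_
      rcases eq_or_ne X 0 with rfl | hX
      · simp [Real.zero_rpow (by linarith : p - 1 ≠ 0)]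
      · rw [Real.rpow_sub_one (norm_ne_zero_iff.2 hX)]
    exact h1.norm_right.congr_right (by simp) |>.of_norm_right
  · have hG : 0 < powSum s X := lt_of_le_of_ne (powSum_nonneg _ _)
      fun h => hX (powSum_eq_zero (by linarith) h.symm)
    have h := ((Real.hasDerivAt_rpow_const (p := p / s) (Or.inl hG.ne')).comp_hasFDerivAt X
      (hasFDerivAt_powSum hs X)).const_mul (1 / p)
    refine h.congr_fderiv ?_
    rw [Finset.smul_sum, Finset.smul_sum]
    refine Finset.sum_congr rfl fun i _ => ?_
    rw [smul_smul, smul_smul, lpDual]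
    congr 1
    field_simp

theorem differentiable_lpPow {p s : ℝ} (hp : 1 < p) (hs : 1 < s) :
    Differentiable ℝ (lpPow p s : (ι → ℝ) → ℝ) :=
  fun X => (hasFDerivAt_lpPow hp hs X).differentiableAt

theorem sum_lpDual_mul_self {p s : ℝ} (hp : 1 < p) (hs : 1 < s) (X : ι → ℝ) :
    ∑ i, lpDual p s X i * X i = powSum s X ^ (p / s) := by
  simp only [lpDual, mul_assoc, ← Finset.mul_sum]
  have : ∑ i, |X i| ^ (s - 2) * (X i * X i) = powSum s X :=
    Finset.sum_congr rfl fun i _ => by rw [← mul_assoc, abs_rpow_eq_mul (by linarith)]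
  rw [this]
  rcases (powSum_nonneg s X).eq_or_lt with h | h
  · rw [← h, Real.zero_rpow (by positivity : p / s ≠ 0), mul_zero]
  · rw [← Real.rpow_add_one h.ne']; ring_nf

theorem bregman_lpPow {p s : ℝ} (hp : 1 < p) (hs : 1 < s) (X Z : ι → ℝ) :
    bregman (lpPow p s) X Z = 1 / p * powSum s Z ^ (p / s)
      + (1 - 1 / p) * powSum s X ^ (p / s) - ∑ i, lpDual p s X i * Z i := by
  rw [bregman, (hasFDerivAt_lpPow hp hs X).fderiv]
  simp only [_root_.sum_apply, _root_.smul_apply, ContinuousLinearMap.proj_apply, Pi.sub_apply,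
    smul_eq_mul, mul_sub, Finset.sum_sub_distrib, sum_lpDual_mul_self hp hs, lpPow]
  ring

/-- Since (s - 1) s' = s, the dual norm of the gradient collapses to a power of the original norm:
‖∇F(X)‖_{s'} = ‖X‖_s^(p-1). -/
theorem powSum_lpDual {p s s' : ℝ} (hp : 1 < p) (hs : 1 < s) (hs' : s' = s / (s - 1))
    (X : ι → ℝ) :
    powSum s' (lpDual p s X) = powSum s X ^ ((p - 1) * s' / s) := by
  have hs1 : 0 < s - 1 := by linarith
  have hs0 : s' ≠ 0 := by rw [hs']; positivity
  rcases eq_or_ne X 0 with rfl | hX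
  · have : lpDual p s (0 : ι → ℝ) = 0 := by ext; simp [lpDual]
    rw [this, powSum_zero hs0, powSum_zero (by linarith), Real.zero_rpow]
    rw [hs']; have : p - 1 ≠ 0 := by linarith
    positivity
  have hG : 0 < powSum s X := lt_of_le_of_ne (powSum_nonneg _ _)
      fun h => hX (powSum_eq_zero (by linarith) h.symm)
  have h1 : ∀ i, |lpDual p s X i| ^ s' = powSum s X ^ ((p / s - 1) * s') * |X i| ^ s := by
    intro i
    rw [lpDual, abs_mul, abs_rpow_sub_two_mul hs, abs_of_nonneg (Real.rpow_nonneg hG.le _),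
      Real.mul_rpow (Real.rpow_nonneg hG.le _) (Real.rpow_nonneg (abs_nonneg _) _),
      ← Real.rpow_mul hG.le, ← Real.rpow_mul (abs_nonneg _)]
    congr 2
    rw [hs']; field_simp
  calc powSum s' (lpDual p s X) = ∑ i, powSum s X ^ ((p / s - 1) * s') * |X i| ^ s :=
        Finset.sum_congr rfl fun i _ => h1 i
    _ = powSum s X ^ ((p / s - 1) * s') * powSum s X := by rw [← Finset.mul_sum]; rfl
    _ = _ := by
        rw [← Real.rpow_add_one hG.ne']; congr 1; rw [hs']; field_simp; ring

/-- Legendre duality: for conjugate exponents the two functions `lpPow` are convex conjugates of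
each other, so their gradients are mutually inverse. The verification is a count of exponents. -/
theorem lpDual_lpDual {p s p' s' : ℝ} (hp : 1 < p) (hs : 1 < s) (hs' : s' = s / (s - 1))
    (hp' : p' = p / (p - 1)) (X : ι → ℝ) : lpDual p' s' (lpDual p s X) = X := by
  have hs1 : 0 < s - 1 := by linarith
  have hp1 : 0 < p - 1 := by linarith
  have hs'1 : 1 < s' := by rw [hs', lt_div_iff₀ hs1]; linarith
  rcases eq_or_ne X 0 with rfl | hX
  · ext; simp [lpDual]
  have hG : 0 < powSum s X := lt_of_le_of_ne (powSum_nonneg _ _)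
      fun h => hX (powSum_eq_zero (by linarith) h.symm)
  ext i
  rw [lpDual, powSum_lpDual hp hs hs']
  rcases eq_or_ne (X i) 0 with hi | hi
  · simp [lpDual, hi]
  have e : |lpDual p s X i| = powSum s X ^ (p / s - 1) * |X i| ^ (s - 1) := by
    rw [lpDual, abs_mul, abs_rpow_sub_two_mul hs, abs_of_nonneg (Real.rpow_nonneg hG.le _)]
  rw [e, Real.mul_rpow (Real.rpow_nonneg hG.le _) (Real.rpow_nonneg (abs_nonneg _) _),
      ← Real.rpow_mul hG.le, ← Real.rpow_mul (abs_nonneg _), ← Real.rpow_mul hG.le, lpDual]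
  have hi' := abs_pos.2 hi
  calc _ = (powSum s X ^ ((p - 1) * s' / s * (p' / s' - 1)) * powSum s X ^ ((p / s - 1) * (s' - 2))
        * powSum s X ^ (p / s - 1)) * (|X i| ^ ((s - 1) * (s' - 2)) * |X i| ^ (s - 2)) * X i := by
          ring
    _ = X i := by
      rw [← Real.rpow_add hG, ← Real.rpow_add hG, ← Real.rpow_add hi']
      have e1 : (p - 1) * s' / s * (p' / s' - 1) + (p / s - 1) * (s' - 2) + (p / s - 1) = 0 := by
        rw [hs', hp']; field_simp; ring
      have e2 : (s - 1) * (s' - 2) + (s - 2) = 0 := by rw [hs']; field_simp; ring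
      rw [e1, e2]; simp

/-- With F* the conjugate of F, both sides equal F(Z) + F*(∇F(X)) - ∇F(X)·Z. Conjugation thus
exchanges the two arguments of the Bregman distance. -/
theorem bregman_lpPow_dual {p s p' s' : ℝ} (hp : 1 < p) (hs : 1 < s) (hs' : s' = s / (s - 1))
    (hp' : p' = p / (p - 1)) (X Z : ι → ℝ) :
    bregman (lpPow p s) X Z = bregman (lpPow p' s') (lpDual p s Z) (lpDual p s X) := by
  have hs1 : 0 < s - 1 := by linarith
  have hp1 : 0 < p - 1 := by linarith
  have hs'1 : 1 < s' := by rw [hs', lt_div_iff₀ hs1]; linarith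
  have hp'1 : 1 < p' := by rw [hp', lt_div_iff₀ hp1]; linarith
  rw [bregman_lpPow hp hs, bregman_lpPow hp'1 hs'1, lpDual_lpDual hp hs hs' hp',
    powSum_lpDual hp hs hs', powSum_lpDual hp hs hs',
    ← Real.rpow_mul (powSum_nonneg _ _), ← Real.rpow_mul (powSum_nonneg _ _)]
  have e1 : (p - 1) * s' / s * (p' / s') = p / s := by rw [hs', hp']; field_simp
  have e2 : 1 - 1 / p' = 1 / p := by rw [hp']; field_simp; ring
  have e3 : 1 / p' = 1 - 1 / p := by rw [← e2]; ring
  rw [e1, e2, e3]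
  simp only [mul_comm (Z _)]
  ring

/-- A bound that holds for all pairs is insensitive to exchanging the arguments, so the constant
does not change. This reduces scalar exponents below 2 to exponents above 2, and p < s to s ≤ p. -/
theorem IsQuasiSymm.lpPow_dual {C p s p' s' : ℝ} (hp : 1 < p) (hs : 1 < s)
    (hs' : s' = s / (s - 1)) (hp' : p' = p / (p - 1))
    (h : IsQuasiSymm C (lpPow p' s' : (ι → ℝ) → ℝ)) :
    IsQuasiSymm C (lpPow p s : (ι → ℝ) → ℝ) where
  diff := differentiable_lpPow hp hs
  nonneg X Z := by rw [bregman_lpPow_dual hp hs hs' hp']; exact h.nonneg _ _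
  le X Z := by
    rw [bregman_lpPow_dual hp hs hs' hp', bregman_lpPow_dual hp hs hs' hp']; exact h.le _ _

theorem lpPow_self {s : ℝ} (hs : 1 < s) : (lpPow s s : (ι → ℝ) → ℝ) = fun X => 1 / s * powSum s X := by
  ext X; rw [lpPow, div_self (by linarith), Real.rpow_one]

theorem isQuasiSymm_powSum_of_abs {C s : ℝ} (h : IsQuasiSymm C (fun t : ℝ => |t| ^ s)) :
    IsQuasiSymm C (powSum s : (ι → ℝ) → ℝ) :=
  IsQuasiSymm.sum (s := Finset.univ) (F := fun i (X : ι → ℝ) => |X i| ^ s) fun i =>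
    h.comp (ContinuousLinearMap.proj i : (ι → ℝ) →L[ℝ] ℝ)

theorem exists_isQuasiSymm_abs_rpow {r : ℝ} (hr : 1 < r) :
    ∃ C, 0 ≤ C ∧ IsQuasiSymm C (fun t : ℝ => |t| ^ r) := by
  rcases le_total 2 r with h | h
  · exact ⟨2 * r, by linarith, isQuasiSymm_abs_rpow_of_two_le h⟩
  · have hr1 : 0 < r - 1 := by linarith
    have hr2 : 2 ≤ r / (r - 1) := by rw [le_div_iff₀ hr1]; linarith
    refine ⟨2 * (r / (r - 1)), by positivity, ?_⟩
    -- Over a one-point index set `lpPow r r` is |t|^r / r, so the duality of `lpPow` applies to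
    -- scalar powers.
    have h1 : IsQuasiSymm (2 * (r / (r - 1))) (lpPow (r / (r - 1)) (r / (r - 1)) :
        (Unit → ℝ) → ℝ) := by
      rw [lpPow_self (by linarith)]
      exact (isQuasiSymm_powSum_of_abs (isQuasiSymm_abs_rpow_of_two_le hr2)).const_mul
        (by positivity)
    have h2 := ((h1.lpPow_dual hr hr rfl rfl).const_mul (by linarith : 0 ≤ r)).comp
      (ContinuousLinearMap.pi fun _ : Unit => ContinuousLinearMap.id ℝ ℝ)
    convert h2 using 2 with t
    rw [lpPow_self hr]
    simp [powSum]
    field_simp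

/-- In each coordinate the distances from x to z and to -z are nonnegative and add up to 2(|z|^s +
(s-1)|x|^s). -/
theorem bregman_powSum_le {s : ℝ} (hs : 1 < s) (X Z : ι → ℝ) :
    bregman (powSum s) X Z ≤ 2 * (powSum s Z + (s - 1) * powSum s X) := by
  have hd : ∀ i, Differentiable ℝ (fun X : ι → ℝ => |X i| ^ s) := fun i =>
    Differentiable.comp (g := fun t : ℝ => |t| ^ s)
      (fun x => (hasDerivAt_abs_rpow x hs).differentiableAt)
      (ContinuousLinearMap.proj i : (ι → ℝ) →L[ℝ] ℝ).differentiable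
  have h1 : bregman (powSum s) X Z
      = ∑ i, bregman (fun t : ℝ => |t| ^ s) (X i) (Z i) := by
    refine (bregman_sum (s := Finset.univ) hd X Z).trans (Finset.sum_congr rfl fun i _ => ?_)
    exact bregman_comp (F := fun t : ℝ => |t| ^ s)
      (fun x => (hasDerivAt_abs_rpow x hs).differentiableAt)
      (ContinuousLinearMap.proj i : (ι → ℝ) →L[ℝ] ℝ) X Z
  rw [h1, powSum, powSum, Finset.mul_sum, ← Finset.sum_add_distrib, Finset.mul_sum]
  refine Finset.sum_le_sum fun i _ => ?_
  have h2 := bregman_abs_rpow_nonneg hs (X i) (-(Z i))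
  rw [bregman_abs_rpow hs, abs_neg] at h2
  rw [bregman_abs_rpow hs]
  linarith

/-- Chain rule for Bregman distances: the distance of a composition is the outer distance at the
inner values plus the outer derivative times the inner distance. Both terms are nonnegative here. -/
theorem bregman_lpPow_eq {p s : ℝ} (hs : 1 < s) (hps : s < p) (X Z : ι → ℝ) :
    p * bregman (lpPow p s) X Z = bregman (fun t : ℝ => |t| ^ (p / s)) (powSum s X) (powSum s Z)
      + p / s * powSum s X ^ (p / s - 1) * bregman (powSum s) X Z := by
  have hp0 : 0 < p := by linarith
  have hr : 1 < p / s := by rw [lt_div_iff₀ (by linarith)]; linarith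
  have hG := hasFDerivAt_powSum hs X
  have h : HasFDerivAt (lpPow p s) ((1 / p) • ((p / s * powSum s X ^ (p / s - 1)) •
      fderiv ℝ (powSum s) X)) X := by
    rw [hG.fderiv]
    exact ((Real.hasDerivAt_rpow_const (p := p / s) (Or.inr hr.le)).comp_hasFDerivAt X
      hG).const_mul (1 / p)
  have hx0 := powSum_nonneg s X
  have hm : powSum s X ^ (p / s - 2) * powSum s X = powSum s X ^ (p / s - 1) := by
    have := abs_rpow_sub_two_mul hr (powSum s X)
    rwa [abs_mul, abs_of_nonneg (Real.rpow_nonneg (abs_nonneg _) _), abs_of_nonneg hx0] at this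
  have hm' : powSum s X ^ (p / s - 1) * powSum s X = powSum s X ^ (p / s) := by
    have := abs_rpow_eq_mul (by linarith : p / s ≠ 0) (powSum s X)
    rwa [abs_of_nonneg hx0, hm] at this
  rw [bregman_abs_rpow hr, abs_of_nonneg hx0, abs_of_nonneg (powSum_nonneg s Z), hm,
    bregman, h.fderiv, bregman, ← hm']
  simp only [_root_.smul_apply, smul_eq_mul, lpPow]
  rw [← hm']
  field_simp
  ring

/-- Exchanging X and Z in `bregman_lpPow_eq` replaces the weight G(X)^(r-1) by G(Z)^(r-1), where G =
`powSum s` and r = p / s. If G(Z) is at most a multiple of G(X), the weights are comparable; if it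
is much larger, the outer distance alone has the order G(Z)^r and dominates. -/
theorem rpow_mul_bregman_powSum_le {p s : ℝ} (hs : 1 < s) (hps : s < p) (X Z : ι → ℝ)
    (hD : 0 ≤ bregman (powSum s) X Z) :
    powSum s Z ^ (p / s - 1) * bregman (powSum s) X Z ≤ (2 * (p / s) + 4 * s) *
      (bregman (fun t : ℝ => |t| ^ (p / s)) (powSum s X) (powSum s Z)
      + powSum s X ^ (p / s - 1) * bregman (powSum s) X Z) := by
  have hr : 1 < p / s := by rw [lt_div_iff₀ (by linarith)]; linarith
  have hb := bregman_abs_rpow_nonneg hr (powSum s X) (powSum s Z)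
  have hle := bregman_powSum_le hs X Z
  have hx := powSum_nonneg s X
  have hz := powSum_nonneg s Z
  rw [bregman_abs_rpow hr, abs_of_nonneg hx, abs_of_nonneg hz] at hb ⊢
  set r := p / s
  set g := powSum s X
  set z := powSum s Z
  set D := bregman (powSum s) X Z
  have hm : g ^ (r - 2) * g = g ^ (r - 1) := by
    have := abs_rpow_sub_two_mul hr g
    rwa [abs_mul, abs_of_nonneg (Real.rpow_nonneg (abs_nonneg _) _), abs_of_nonneg hx] at this
  rw [hm] at hb ⊢
  -- The threshold satisfies M^(r-1) = 2r, so that for z > M g the mixed term r g^(r-1) z is at most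
  -- z^r / 2.
  set M := (2 * r) ^ (1 / (r - 1)) with hM
  have hM1 : 1 ≤ M := Real.one_le_rpow (by linarith) (by
    have : 0 < r - 1 := by linarith
    positivity)
  have hMr : M ^ (r - 1) = 2 * r := by
    rw [hM, ← Real.rpow_mul (by linarith), one_div, inv_mul_cancel₀ (by linarith), Real.rpow_one]
  have hgr : 0 ≤ g ^ (r - 1) := Real.rpow_nonneg hx _
  have hgD : 0 ≤ g ^ (r - 1) * D := mul_nonneg hgr hD
  rcases le_or_gt z (M * g) with h | h
  · have h1 : z ^ (r - 1) ≤ 2 * r * g ^ (r - 1) := by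
      rw [← hMr, ← Real.mul_rpow (by linarith) hx]
      exact Real.rpow_le_rpow hz h (by linarith)
    have h2 := mul_le_mul_of_nonneg_right h1 hD
    nlinarith
  · have hz0 : 0 < z := lt_of_le_of_lt (by positivity) h
    have h1 : 2 * r * g ^ (r - 1) ≤ z ^ (r - 1) := by
      rw [← hMr, ← Real.mul_rpow (by linarith) hx]
      exact Real.rpow_le_rpow (by positivity) h.le (by linarith)
    have hzz : z ^ (r - 1) * z = z ^ r := by
      rw [← Real.rpow_add_one hz0.ne']; ring_nf
    have hzr : 0 ≤ z ^ r := Real.rpow_nonneg hz _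
    have h2 : z ^ r / 2 ≤ z ^ r + (r - 1) * g ^ r - r * (g ^ (r - 1) * z) := by
      have := mul_le_mul_of_nonneg_right h1 hz
      have h3 : 0 ≤ (r - 1) * g ^ r := mul_nonneg (by linarith) (Real.rpow_nonneg hx _)
      rw [hzz] at this
      nlinarith
    have h4 : D ≤ 2 * s * z := by
      have : g ≤ z := by nlinarith
      nlinarith
    have h5 : z ^ (r - 1) * D ≤ 2 * s * z ^ r := by
      have := mul_le_mul_of_nonneg_left h4 (Real.rpow_nonneg hz (r - 1))
      calc _ ≤ _ := this
        _ = _ := by rw [← hzz]; ring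
    set b := z ^ r + (r - 1) * g ^ r - r * (g ^ (r - 1) * z)
    have h6 : 2 * s * z ^ r ≤ 4 * s * b := by nlinarith
    have h7 : 0 ≤ 2 * r * b := by positivity
    have h8 : 0 ≤ (2 * r + 4 * s) * (g ^ (r - 1) * D) := by positivity
    nlinarith

/-- The powers of the `ℓ^s`-norms have quasi-symmetric Bregman distances, uniformly in the
dimension. -/
theorem exists_isQuasiSymm_lpPow {p s : ℝ} (hp : 1 < p) (hs : 1 < s) :
    ∃ C, 0 ≤ C ∧ ∀ n : ℕ, IsQuasiSymm C (lpPow p s : (Fin n → ℝ) → ℝ) := by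
  -- For s ≤ p the outer power p / s is convex. Conjugation reverses the order of the exponents, so
  -- this case implies the other one.
  have main : ∀ p s : ℝ, 1 < s → s ≤ p →
      ∃ C, 0 ≤ C ∧ ∀ n : ℕ, IsQuasiSymm C (lpPow p s : (Fin n → ℝ) → ℝ) := by
    intro p s hs hps
    obtain ⟨C₂, hC₂, h₂⟩ := exists_isQuasiSymm_abs_rpow hs
    rcases hps.eq_or_lt with rfl | hps
    · refine ⟨C₂, hC₂, fun n => ?_⟩
      rw [lpPow_self hs]
      exact (isQuasiSymm_powSum_of_abs h₂).const_mul (by positivity)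
    have hp0 : 0 < p := by linarith
    have hr : 1 < p / s := by rw [lt_div_iff₀ (by linarith)]; linarith
    obtain ⟨C₁, hC₁, h₁⟩ := exists_isQuasiSymm_abs_rpow hr
    have hC₃ : 0 ≤ 2 * (p / s) + 4 * s := by positivity
    refine ⟨C₁ + C₂ * (p / s) * (2 * (p / s) + 4 * s), by positivity, fun n => ?_⟩
    have hG : IsQuasiSymm C₂ (powSum s : (Fin n → ℝ) → ℝ) := isQuasiSymm_powSum_of_abs h₂
    refine ⟨differentiable_lpPow (by linarith) hs, fun X Z => ?_, fun X Z => ?_⟩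
    · have := bregman_lpPow_eq hs hps X Z
      have h3 : 0 ≤ p * bregman (lpPow p s) X Z := by
        rw [this]
        exact add_nonneg (h₁.nonneg _ _) (mul_nonneg (mul_nonneg (by positivity)
          (Real.rpow_nonneg (powSum_nonneg _ _) _)) (hG.nonneg _ _))
      exact (mul_nonneg_iff_of_pos_left hp0).1 h3
    · refine le_of_mul_le_mul_left ?_ hp0
      rw [mul_left_comm, bregman_lpPow_eq hs hps, bregman_lpPow_eq hs hps]
      have k1 := h₁.le (powSum s X) (powSum s Z)
      have k2 := hG.le X Z
      have k3 := rpow_mul_bregman_powSum_le hs hps X Z (hG.nonneg X Z)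
      have k4 := h₁.nonneg (powSum s X) (powSum s Z)
      have k5 := hG.nonneg X Z
      have k6 := Real.rpow_nonneg (powSum_nonneg s X) (p / s - 1)
      have k7 := Real.rpow_nonneg (powSum_nonneg s Z) (p / s - 1)
      set r := p / s
      set D := bregman (powSum s) X Z
      set b := bregman (fun t : ℝ => |t| ^ r) (powSum s X) (powSum s Z)
      set c := 2 * r + 4 * s
      have k8 : r * powSum s Z ^ (r - 1) * bregman (powSum s) Z X
          ≤ C₂ * r * c * (b + powSum s X ^ (r - 1) * D) := by
        calc _ ≤ r * powSum s Z ^ (r - 1) * (C₂ * D) :=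
              mul_le_mul_of_nonneg_left k2 (by positivity)
          _ = C₂ * r * (powSum s Z ^ (r - 1) * D) := by ring
          _ ≤ C₂ * r * (c * (b + powSum s X ^ (r - 1) * D)) :=
              mul_le_mul_of_nonneg_left k3 (by positivity)
          _ = _ := by ring
      have k9 : powSum s X ^ (r - 1) * D ≤ r * powSum s X ^ (r - 1) * D := by
        rw [mul_assoc]; exact le_mul_of_one_le_left (by positivity) hr.le
      have k10 : 0 ≤ C₁ * (r * powSum s X ^ (r - 1) * D) := by positivity
      have k11 := mul_le_mul_of_nonneg_left k9 (by positivity : 0 ≤ C₂ * r * c)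
      linarith
  rcases le_total s p with h | h
  · exact main p s hs h
  · have hs1 : 0 < s - 1 := by linarith
    have hp1 : 0 < p - 1 := by linarith
    obtain ⟨C, hC, h'⟩ := main (p / (p - 1)) (s / (s - 1))
      (by rw [lt_div_iff₀ hs1]; linarith)
      (by rw [div_le_div_iff₀ hs1 hp1]; linarith)
    exact ⟨C, hC, fun n => (h' n).lpPow_dual hp hs rfl rfl⟩

end LpPow

/-! ### Growth of Bregman distances and homogeneity -/

section Growth

variable {W : Type*} [NormedAddCommGroup W] [NormedSpace ℝ W] {F : W → ℝ} {C p : ℝ}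

theorem hasDerivAt_bregman_ray (hF : Differentiable ℝ F) (X Y : W) (t : ℝ) :
    HasDerivAt (fun t : ℝ => bregman F X (X + t • Y))
      (fderiv ℝ F (X + t • Y) Y - fderiv ℝ F X Y) t := by
  have h1 : HasDerivAt (fun t : ℝ => X + t • Y) Y t := by
    simpa using ((hasDerivAt_id t).smul_const Y).const_add X
  have h2 : HasDerivAt (fun t : ℝ => F (X + t • Y)) (fderiv ℝ F (X + t • Y) Y) t :=
    (hF _).hasFDerivAt.comp_hasDerivAt t h1
  have h3 : HasDerivAt (fun t : ℝ => fderiv ℝ F X (t • Y)) (fderiv ℝ F X Y) t := by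
    simpa using (hasDerivAt_id t).mul_const (fderiv ℝ F X Y)
  have := (h2.sub_const (F X)).sub h3
  refine this.congr_of_eventuallyEq (Eventually.of_forall fun t => ?_)
  simp [bregman]

/-- Along a ray, t times the derivative of the Bregman distance is the symmetrized distance. Its
sign gives monotonicity, and quasi-symmetry bounds it by 1 + C times the distance itself. -/
theorem mul_deriv_bregman_ray (X Y : W) (t : ℝ) :
    t * (fderiv ℝ F (X + t • Y) Y - fderiv ℝ F X Y)
      = bregman F X (X + t • Y) + bregman F (X + t • Y) X := by
  simp only [bregman, add_sub_cancel_left, sub_add_cancel_left, map_neg, map_smul, smul_eq_mul]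
  ring

theorem IsQuasiSymm.bregman_ray_mono (hF : IsQuasiSymm C F) (X Y : W) {a b : ℝ} (ha : 0 ≤ a)
    (hab : a ≤ b) : bregman F X (X + a • Y) ≤ bregman F X (X + b • Y) := by
  have hd := hasDerivAt_bregman_ray hF.diff X Y
  have : MonotoneOn (fun t : ℝ => bregman F X (X + t • Y)) (Ici 0) := by
    refine monotoneOn_of_deriv_nonneg (convex_Ici 0)
      (fun t _ => (hd t).continuousAt.continuousWithinAt)
      (fun t _ => (hd t).differentiableAt.differentiableWithinAt) fun t ht => ?_
    rw [interior_Ici, mem_Ioi] at ht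
    rw [(hd t).deriv]
    have := mul_deriv_bregman_ray (F := F) X Y t
    have h2 := hF.nonneg X (X + t • Y)
    have h3 := hF.nonneg (X + t • Y) X
    exact (mul_nonneg_iff_of_pos_left ht).1 (by rw [this]; exact add_nonneg h2 h3)
  exact this ha (ha.trans hab) hab

/-- For f(t) = D(X, X + tY), `mul_deriv_bregman_ray` and quasi-symmetry give t f'(t) ≤ (1 + C) f(t).
Hence t^(-(1+C)) f(t) is nonincreasing. -/
theorem IsQuasiSymm.bregman_ray_le (hF : IsQuasiSymm C F) (X Y : W) {l : ℝ} (hl : 1 ≤ l) :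
    bregman F X (X + l • Y) ≤ l ^ (1 + C) * bregman F X (X + Y) := by
  have hd := hasDerivAt_bregman_ray hF.diff X Y
  have hd' : ∀ t : ℝ, 0 < t → HasDerivAt
      (fun t : ℝ => t ^ (-(1 + C)) * bregman F X (X + t • Y))
      (-(1 + C) * t ^ (-(1 + C) - 1) * bregman F X (X + t • Y) + t ^ (-(1 + C)) *
        (fderiv ℝ F (X + t • Y) Y - fderiv ℝ F X Y)) t := fun t ht =>
    (Real.hasDerivAt_rpow_const (Or.inl ht.ne')).mul (hd t)
  have : AntitoneOn (fun t : ℝ => t ^ (-(1 + C)) * bregman F X (X + t • Y)) (Ici 1) := by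
    refine antitoneOn_of_deriv_nonpos (convex_Ici 1)
      (fun t ht => (hd' t (lt_of_lt_of_le one_pos ht)).continuousAt.continuousWithinAt)
      (fun t ht => ?_) fun t ht => ?_
    · rw [interior_Ici, mem_Ioi] at ht
      exact (hd' t (by linarith)).differentiableAt.differentiableWithinAt
    · rw [interior_Ici, mem_Ioi] at ht
      have ht0 : 0 < t := by linarith
      rw [(hd' t ht0).deriv]
      have e : t ^ (-(1 + C)) = t ^ (-(1 + C) - 1) * t := by
        rw [← Real.rpow_add_one ht0.ne']; ring_nf
      have h1 := mul_deriv_bregman_ray (F := F) X Y t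
      have h2 := hF.le X (X + t • Y)
      have h3 : 0 ≤ t ^ (-(1 + C) - 1) := Real.rpow_nonneg ht0.le _
      calc _ = t ^ (-(1 + C) - 1) * (t * (fderiv ℝ F (X + t • Y) Y - fderiv ℝ F X Y)
            - (1 + C) * bregman F X (X + t • Y)) := by rw [e]; ring
        _ ≤ 0 := mul_nonpos_of_nonneg_of_nonpos h3 (by rw [h1]; linarith)
  have h := this (mem_Ici.2 le_rfl) (mem_Ici.2 hl) hl
  simp only [Real.one_rpow, one_mul, one_smul] at h
  have hl0 : 0 < l := by linarith
  rw [Real.rpow_neg hl0.le, inv_mul_le_iff₀ (Real.rpow_pos_of_pos hl0 _)] at h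
  exact h

/-! ### Homogeneous functions and cutoffs. -/

theorem fderiv_self_of_homogeneous (hF : Differentiable ℝ F) (hp : 1 < p)
    (hom : ∀ (c : ℝ) X, F (c • X) = |c| ^ p * F X) (X : W) : fderiv ℝ F X X = p * F X := by
  have h1 : HasDerivAt (fun t : ℝ => F (t • X)) (fderiv ℝ F X X) 1 := by
    have := (hF ((1 : ℝ) • X)).hasFDerivAt.comp_hasDerivAt (1 : ℝ)
      ((hasDerivAt_id (1 : ℝ)).smul_const X)
    simpa [Function.comp_def] using this
  have h2 : HasDerivAt (fun t : ℝ => F (t • X)) (p * F X) 1 := by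
    have := (hasDerivAt_abs_rpow 1 hp).mul_const (F X)
    simp only [abs_one, Real.one_rpow, mul_one] at this
    simpa only [hom] using this
  exact h1.unique h2

theorem fderiv_smul_of_homogeneous (hF : Differentiable ℝ F) (hp : 1 < p)
    (hom : ∀ (c : ℝ) X, F (c • X) = |c| ^ p * F X) (c : ℝ) (X Y : W) :
    fderiv ℝ F (c • X) Y = |c| ^ (p - 2) * c * fderiv ℝ F X Y := by
  rcases eq_or_ne c 0 with rfl | hc
  · have h1 : HasDerivAt (fun t : ℝ => F (t • Y)) (fderiv ℝ F 0 Y) 0 := by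
      have := (hF ((0 : ℝ) • Y)).hasFDerivAt.comp_hasDerivAt (0 : ℝ)
        ((hasDerivAt_id (0 : ℝ)).smul_const Y)
      simpa [Function.comp_def] using this
    have h2 : HasDerivAt (fun t : ℝ => F (t • Y)) 0 0 := by
      have := (hasDerivAt_abs_rpow 0 hp).mul_const (F Y)
      simp only [mul_zero, zero_mul] at this
      simpa only [hom] using this
    simp [h1.unique h2]
  · have h1 : HasDerivAt (fun t : ℝ => F (c • X + t • Y)) (fderiv ℝ F (c • X) Y) 0 := by
      have h0 : HasDerivAt (fun t : ℝ => c • X + t • Y) Y 0 := by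
        simpa using ((hasDerivAt_id (0 : ℝ)).smul_const Y).const_add (c • X)
      have h0' : HasFDerivAt F (fderiv ℝ F (c • X)) (c • X + (0 : ℝ) • Y) := by
        simpa using (hF (c • X)).hasFDerivAt
      exact h0'.comp_hasDerivAt (0 : ℝ) h0
    have h2 : HasDerivAt (fun t : ℝ => F (c • X + t • Y)) (|c| ^ p * (c⁻¹ * fderiv ℝ F X Y)) 0 := by
      have h0 : HasDerivAt (fun t : ℝ => X + (c⁻¹ * t) • Y) (c⁻¹ • Y) 0 := by
        simpa using (((hasDerivAt_id (0 : ℝ)).const_mul c⁻¹).smul_const Y).const_add X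
      have h0' : HasFDerivAt F (fderiv ℝ F X) (X + (c⁻¹ * (0 : ℝ)) • Y) := by
        simpa using (hF X).hasFDerivAt
      have h3 := (h0'.comp_hasDerivAt (0 : ℝ) h0).const_mul (|c| ^ p)
      rw [map_smul, smul_eq_mul] at h3
      refine h3.congr_of_eventuallyEq (Eventually.of_forall fun t => ?_)
      simp only [Function.comp]
      rw [← hom, smul_add, smul_smul, ← mul_assoc, mul_inv_cancel₀ hc, one_mul]
    rw [h1.unique h2]
    have : |c| ^ p = |c| ^ (p - 2) * c * c := (abs_rpow_eq_mul (by linarith) c).symm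
    rw [this]; field_simp

theorem bregman_smul_smul (hF : Differentiable ℝ F) (hp : 1 < p)
    (hom : ∀ (c : ℝ) X, F (c • X) = |c| ^ p * F X) (c : ℝ) (X Z : W) :
    bregman F (c • X) (c • Z) = |c| ^ p * bregman F X Z := by
  rw [bregman, bregman, hom, hom, ← smul_sub, fderiv_smul_of_homogeneous hF hp hom, map_smul,
    smul_eq_mul, ← abs_rpow_eq_mul (by linarith : p ≠ 0) c]
  ring

/-- A cutoff function on `[1, 2]` that is flat enough at its zeros for exponents `p`, `b`. -/
theorem exists_cutoff {p b : ℝ} (hp : 0 < p) : ∃ (ρ : ℝ → ℝ) (M : ℝ), ContDiff ℝ 1 ρ ∧ 1 ≤ M ∧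
    (∀ t, |t| ≤ 1 → ρ t = 0) ∧ (∀ t, 2 ≤ |t| → ρ t = 1) ∧
    (∀ t, |t| ≤ 1 → deriv ρ t = 0) ∧ (∀ t, 2 ≤ |t| → deriv ρ t = 0) ∧
    ∀ t, 1 < |t| → 0 < ρ t ∧ 0 ≤ t * deriv ρ t ∧
      ∃ κ, 0 < κ ∧ κ ≤ 1 ∧ t * deriv ρ t ≤ M / κ * ρ t ∧ ρ t ^ p ≤ κ ^ b := by
  -- The cutoff is σ^k with k = m + 1, where σ is an even smooth transition from |t| = 1 to |t| = 2,
  -- and κ = σ(t). Differentiation costs only one factor σ relative to σ^k, while (σ^k)^p ≤ σ^b as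
  -- soon as b ≤ kp.
  obtain ⟨m, hm⟩ := exists_nat_ge (b / p + 1)
  set σ : ℝ → ℝ := fun t => Real.smoothTransition ((t ^ 2 - 1) / 3) with hσ
  have hσs : ContDiff ℝ 1 σ :=
    (Real.smoothTransition.contDiff (n := 1)).comp (by fun_prop)
  have hσd : ∀ t, HasDerivAt σ (deriv σ t) t := fun t =>
    ((hσs.differentiable (by norm_num)) t).hasDerivAt
  have hdv : ∀ t, deriv σ t = deriv Real.smoothTransition ((t ^ 2 - 1) / 3) * (2 * t / 3) := by
    intro t
    have h1 : HasDerivAt (fun t : ℝ => (t ^ 2 - 1) / 3) (2 * t / 3) t := by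
      simpa using (((hasDerivAt_id t).pow 2).sub_const 1).div_const 3
    have h2 := ((Real.smoothTransition.contDiff (n := 1)).differentiable (by norm_num)
      ((t ^ 2 - 1) / 3)).hasDerivAt.comp t h1
    exact h2.deriv
  have hσ0 : ∀ t, |t| ≤ 1 → σ t = 0 := fun t ht => by
    refine Real.smoothTransition.zero_of_nonpos ?_
    have : t ^ 2 ≤ 1 := by rw [← sq_abs]; nlinarith [abs_nonneg t]
    linarith
  have hσ1 : ∀ t, 2 ≤ |t| → σ t = 1 := fun t ht => by
    refine Real.smoothTransition.one_of_one_le ?_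
    have : 4 ≤ t ^ 2 := by rw [← sq_abs]; nlinarith [abs_nonneg t]
    linarith
  have hd0 : ∀ t, |t| ≤ 1 → deriv σ t = 0 := fun t ht => by
    refine IsLocalMin.deriv_eq_zero (Eventually.of_forall fun y => ?_)
    rw [hσ0 t ht]; exact Real.smoothTransition.nonneg _
  have hd1 : ∀ t, 2 ≤ |t| → deriv σ t = 0 := fun t ht => by
    refine IsLocalMax.deriv_eq_zero (Eventually.of_forall fun y => ?_)
    rw [hσ1 t ht]; exact Real.smoothTransition.le_one _
  have hcont : Continuous fun t => t * deriv σ t :=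
    continuous_id.mul (hσs.continuous_deriv le_rfl)
  obtain ⟨B, hB⟩ := (isCompact_Icc (a := (-2 : ℝ)) (b := 2)).exists_bound_of_continuousOn
    hcont.continuousOn
  have hB' : ∀ t, t * deriv σ t ≤ max B 1 := by
    intro t
    rcases le_total 2 |t| with h | h
    · rw [hd1 t h, mul_zero]; exact le_trans zero_le_one (le_max_right _ _)
    · exact ((le_abs_self _).trans (hB t (abs_le.1 h))).trans (le_max_left _ _)
  set k := m + 1 with hk
  have hρd : ∀ t, deriv (fun t => σ t ^ k) t = k * σ t ^ m * deriv σ t := fun t => by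
    have := ((hσd t).fun_pow k).deriv
    simpa [hk] using this
  have hk0 : (1 : ℝ) ≤ k := by rw [hk]; push_cast; linarith [(Nat.cast_nonneg m : (0:ℝ) ≤ m)]
  have hmb : b ≤ k * p := by
    have : b / p ≤ k := by rw [hk]; push_cast; linarith
    rwa [div_le_iff₀ hp] at this
  refine ⟨fun t => σ t ^ k, k * max B 1, hσs.pow k, ?_, ?_, ?_, ?_, ?_, ?_⟩
  · have := le_max_right B 1; nlinarith
  · intro t ht; simp [hσ0 t ht, hk]
  · intro t ht; simp [hσ1 t ht]
  · intro t ht; rw [hρd, hd0 t ht, mul_zero]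
  · intro t ht; rw [hρd, hd1 t ht, mul_zero]
  · intro t ht
    have hpos : 0 < σ t := by
      refine Real.smoothTransition.pos_of_pos ?_
      have : 1 < t ^ 2 := by rw [← sq_abs]; nlinarith [abs_nonneg t]
      linarith
    have hnn : 0 ≤ t * deriv σ t := by
      have := Real.smoothTransition.monotone.deriv_nonneg (x := (t ^ 2 - 1) / 3)
      rw [hdv]; nlinarith [mul_nonneg this (sq_nonneg t)]
    refine ⟨pow_pos hpos k, ?_, σ t, hpos, Real.smoothTransition.le_one _, ?_, ?_⟩
    · rw [hρd, show t * (k * σ t ^ m * deriv σ t) = k * σ t ^ m * (t * deriv σ t) by ring]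
      positivity
    · rw [hρd, show t * (k * σ t ^ m * deriv σ t) = k * σ t ^ m * (t * deriv σ t) by ring]
      have := mul_le_mul_of_nonneg_left (hB' t) (by positivity : 0 ≤ (k : ℝ) * σ t ^ m)
      refine this.trans_eq ?_
      simp only [hk, pow_succ]
      field_simp
    · simp only []
      rw [← Real.rpow_natCast, ← Real.rpow_mul hpos.le]
      exact Real.rpow_le_rpow_of_exponent_ge hpos (Real.smoothTransition.le_one _) hmb

/-- Truncation of `t X + Y` along a cutoff function does not increase the Bregman distance
by more than a constant factor. -/
theorem IsQuasiSymm.bregman_cutoff_le (hF : IsQuasiSymm C F) (hp : 1 < p)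
    (hom : ∀ (c : ℝ) X, F (c • X) = |c| ^ p * F X) {M t r r' κ : ℝ} (hM : 1 ≤ M) (ht : 1 < |t|)
    (hr : 0 < r) (hr' : 0 ≤ t * r') (hκ : 0 < κ) (hκ1 : κ ≤ 1) (hle : t * r' ≤ M / κ * r)
    (hrκ : r ^ p ≤ κ ^ (1 + C)) (X Y : W) :
    bregman F (r • X) (r • X + r' • Y) ≤ M ^ (1 + C) * bregman F (t • X) (t • X + Y) := by
  have ht0 : t ≠ 0 := by rintro rfl; simp at ht; linarith
  -- Homogeneity moves both distances to the base point X. The directions are then (t r' / r) Y' and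
  -- Y', with t r' / r ≤ M / κ. The growth estimate costs (M / κ)^(1+C), of which r^p ≤ κ^(1+C)
  -- leaves M^(1+C), and |t|^p ≥ 1 may be inserted.
  set Y' := t⁻¹ • Y with hY'
  have e1 : r • X + r' • Y = r • (X + (t * r' / r) • Y') := by
    rw [smul_add, smul_smul, hY', smul_smul]; congr 2; field_simp
  have e2 : t • X + Y = t • (X + Y') := by
    rw [smul_add, hY', smul_smul, mul_inv_cancel₀ ht0, one_smul]
  rw [e1, e2, bregman_smul_smul hF.diff hp hom, bregman_smul_smul hF.diff hp hom,
    abs_of_pos hr]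
  have hMκ : 1 ≤ M / κ := by rw [le_div_iff₀ hκ]; linarith
  have h1 : bregman F X (X + (t * r' / r) • Y') ≤ (M / κ) ^ (1 + C) * bregman F X (X + Y') :=
    (hF.bregman_ray_mono X Y' (by positivity) (by rwa [div_le_iff₀ hr])).trans
      (hF.bregman_ray_le X Y' hMκ)
  have hb := hF.nonneg X (X + Y')
  have hM0 : 0 ≤ M ^ (1 + C) := Real.rpow_nonneg (by linarith) _
  have hκp : 0 < κ ^ (1 + C) := Real.rpow_pos_of_pos hκ _
  calc r ^ p * bregman F X (X + (t * r' / r) • Y')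
      ≤ κ ^ (1 + C) * ((M / κ) ^ (1 + C) * bregman F X (X + Y')) :=
        mul_le_mul hrκ h1 (hF.nonneg _ _) hκp.le
    _ = M ^ (1 + C) * (1 * bregman F X (X + Y')) := by
        rw [Real.div_rpow (by linarith) hκ.le]; field_simp
    _ ≤ M ^ (1 + C) * (|t| ^ p * bregman F X (X + Y')) := by
        gcongr
        exact Real.one_le_rpow ht.le (by linarith)

end Growth

/-! ### The norms `H(x, ·)` -/

section MixedNorm

variable {n : ℕ}

theorem sNorm_eq_lpPow {p s : ℝ} (hs : 1 < s) {a : Fin n → ℝ} (ha : ∀ i, 0 < a i)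
    (ξ : E n) : 1 / p * sNorm s a ξ ^ p = lpPow p s (fun i => a i ^ (1 / s) * ξ i) := by
  have h : ∀ i, |a i ^ (1 / s) * ξ i| ^ s = a i * |ξ i| ^ s := fun i => by
    rw [abs_mul, abs_of_pos (Real.rpow_pos_of_pos (ha i) _), Real.mul_rpow
      (Real.rpow_nonneg (ha i).le _) (abs_nonneg _), ← Real.rpow_mul (ha i).le,
      one_div_mul_cancel (by linarith), Real.rpow_one]
  have h0 : 0 ≤ ∑ i, a i * |ξ i| ^ s := Finset.sum_nonneg fun i _ =>
    mul_nonneg (ha i).le (Real.rpow_nonneg (abs_nonneg _) _)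
  rw [sNorm, lpPow, powSum, ← Real.rpow_mul h0]
  simp only [h]
  congr 2; ring

/-- A positive semidefinite matrix factors as BᵀB, so |ξ|_A is the Euclidean length of Bξ. Like the
weighted s-norm, it is then a plain ℓ-norm after a linear map. -/
theorem exists_matNorm_eq_lpPow {p : ℝ} {A : Matrix (Fin n) (Fin n) ℝ}
    (hA : A.PosSemidef) : ∃ B : Matrix (Fin n) (Fin n) ℝ, ∀ ξ : E n,
      1 / p * matNorm A ξ ^ p = lpPow p 2 (B.mulVec (fun i => ξ i)) := by
  open scoped MatrixOrder in
  obtain ⟨B, rfl⟩ := CStarAlgebra.nonneg_iff_eq_star_mul_self.mp hA.nonneg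
  refine ⟨B, fun ξ => ?_⟩
  have h : ((star B * B).mulVec (fun i => ξ i)) ⬝ᵥ (fun i => ξ i)
      = powSum 2 (B.mulVec (fun i => ξ i)) := by
    rw [← Matrix.mulVec_mulVec, dotProduct_comm, Matrix.dotProduct_mulVec]
    simp only [powSum, Real.rpow_two, sq_abs, dotProduct, Matrix.vecMul, Matrix.star_apply,
      star_trivial, Matrix.mulVec]
    refine Finset.sum_congr rfl fun i _ => ?_
    rw [sq]
    congr 1
    exact Finset.sum_congr rfl fun j _ => mul_comm _ _
  rw [matNorm, h, lpPow, Real.sqrt_eq_rpow, ← Real.rpow_mul (powSum_nonneg _ _)]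
  congr 2; ring

theorem mixedNorm_rpow {p s : ℝ} (hp : 1 < p) (a : E n → Fin n → ℝ)
    (A : E n → Matrix (Fin n) (Fin n) ℝ) {x : E n} (ha : ∀ i, 0 < a x i) (ξ : E n) :
    mixedNorm p s a A x ξ ^ p = sNorm s (a x) ξ ^ p + matNorm (A x) ξ ^ p := by
  have h1 : 0 ≤ sNorm s (a x) ξ := Real.rpow_nonneg (Finset.sum_nonneg fun i _ =>
    mul_nonneg (ha i).le (Real.rpow_nonneg (abs_nonneg _) _)) _
  have h2 : 0 ≤ matNorm (A x) ξ := Real.sqrt_nonneg _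
  rw [mixedNorm, ← Real.rpow_mul (by positivity), one_div_mul_cancel (by linarith), Real.rpow_one]

/-- The `p`-th powers of the norms `H(x, ·)` have quasi-symmetric Bregman distances. -/
theorem exists_isQuasiSymm_mixedNorm {p s : ℝ} (hp : 1 < p) (hs : 1 < s) :
    ∃ C, 0 ≤ C ∧ ∀ (n : ℕ) (a : E n → Fin n → ℝ) (A : E n → Matrix (Fin n) (Fin n) ℝ) (x : E n),
      (∀ i, 0 < a x i) → (A x).PosSemidef →
        IsQuasiSymm C (fun ξ => 1 / p * mixedNorm p s a A x ξ ^ p) := by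
  obtain ⟨C₁, hC₁, h₁⟩ := exists_isQuasiSymm_lpPow hp hs
  obtain ⟨C₂, -, h₂⟩ := exists_isQuasiSymm_lpPow hp one_lt_two
  refine ⟨max C₁ C₂, hC₁.trans (le_max_left _ _), fun n a A x ha hA => ?_⟩
  obtain ⟨B, hB⟩ := exists_matNorm_eq_lpPow (p := p) hA
  -- Linear maps and sums do not change the quasi-symmetry constant, so it is independent of the
  -- dimension, the weights and the matrix.
  have e : (fun ξ => 1 / p * mixedNorm p s a A x ξ ^ p) = fun ξ =>
      lpPow p s (fun i => a x i ^ (1 / s) * ξ i) + lpPow p 2 (B.mulVec (fun i => ξ i)) := by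
    ext ξ
    rw [mixedNorm_rpow hp a A ha, mul_add, sNorm_eq_lpPow hs ha, hB]
  rw [e]
  have k₁ := ((h₁ n).mono (le_max_left C₁ C₂)).comp (ContinuousLinearMap.pi fun i =>
    (a x i ^ (1 / s)) • (EuclideanSpace.proj i : E n →L[ℝ] ℝ))
  have k₂ := ((h₂ n).mono (le_max_right C₁ C₂)).comp
    ((Matrix.mulVecLin B).toContinuousLinearMap.comp
      (ContinuousLinearMap.pi fun i => (EuclideanSpace.proj i : E n →L[ℝ] ℝ)))
  exact k₁.add k₂

theorem mixedNorm_smul {p s : ℝ} (hp : 1 < p) (hs : 1 < s) (a : E n → Fin n → ℝ)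
    (A : E n → Matrix (Fin n) (Fin n) ℝ) {x : E n} (ha : ∀ i, 0 < a x i) (c : ℝ) (ξ : E n) :
    mixedNorm p s a A x (c • ξ) ^ p = |c| ^ p * mixedNorm p s a A x ξ ^ p := by
  have h1 : 0 ≤ ∑ i, a x i * |ξ i| ^ s := Finset.sum_nonneg fun i _ =>
    mul_nonneg (ha i).le (Real.rpow_nonneg (abs_nonneg _) _)
  have h2 : sNorm s (a x) (c • ξ) = |c| * sNorm s (a x) ξ := by
    have : ∑ i, a x i * |(c • ξ) i| ^ s = |c| ^ s * ∑ i, a x i * |ξ i| ^ s := by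
      rw [Finset.mul_sum]
      refine Finset.sum_congr rfl fun i _ => ?_
      simp only [PiLp.smul_apply, smul_eq_mul, abs_mul]
      rw [Real.mul_rpow (abs_nonneg _) (abs_nonneg _)]; ring
    rw [sNorm, sNorm, this, Real.mul_rpow (Real.rpow_nonneg (abs_nonneg _) _) h1,
      ← Real.rpow_mul (abs_nonneg _), mul_one_div_cancel (by linarith), Real.rpow_one]
  have h3 : matNorm (A x) (c • ξ) = |c| * matNorm (A x) ξ := by
    have : ((A x).mulVec fun i => (c • ξ) i) ⬝ᵥ (fun i => (c • ξ) i)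
        = c ^ 2 * (((A x).mulVec fun i => ξ i) ⬝ᵥ fun i => ξ i) := by
      have e : (fun i => (c • ξ) i) = c • fun i => ξ i := by ext; simp
      rw [e, Matrix.mulVec_smul, smul_dotProduct, dotProduct_smul, smul_eq_mul, smul_eq_mul]; ring
    rw [matNorm, matNorm, this, Real.sqrt_mul (sq_nonneg c), Real.sqrt_sq_eq_abs]
  have h4 : 0 ≤ sNorm s (a x) ξ := Real.rpow_nonneg h1 _
  have h5 : 0 ≤ matNorm (A x) ξ := Real.sqrt_nonneg _
  rw [mixedNorm_rpow hp a A ha, mixedNorm_rpow hp a A ha, h2, h3,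
    Real.mul_rpow (abs_nonneg _) h4, Real.mul_rpow (abs_nonneg _) h5]
  ring

end MixedNorm

/-! ### Weak gradients -/

section WeakGrad

variable {n : ℕ} {p : ℝ} {Ω K : Set (E n)}

theorem gradient_apply (f : E n → ℝ) (x : E n) (i : Fin n) :
    gradient f x i = fderiv ℝ f x (EuclideanSpace.single i 1) := by
  rw [← inner_gradient_left, EuclideanSpace.inner_single_right]; simp

theorem continuous_gradient {f : E n → ℝ} (hf : ContDiff ℝ 1 f) : Continuous (gradient f) :=
  (InnerProductSpace.toDual ℝ (E n)).symm.continuous.comp (hf.continuous_fderiv (by norm_num))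

theorem gradient_eq_zero_of_notMem_tsupport {f : E n → ℝ} {x : E n} (hx : x ∉ tsupport f) :
    gradient f x = 0 := by
  have : fderiv ℝ f x = 0 := by
    by_contra h
    exact hx (support_fderiv_subset ℝ h)
  rw [gradient, this, map_zero]

theorem integrable_mul_of_locallyIntegrableOn {c g : E n → ℝ} (hc : Continuous c)
    (hcs : HasCompactSupport c) (hcΩ : tsupport c ⊆ Ω)
    (hg : LocallyIntegrableOn g Ω) : Integrable (fun x => c x * g x) := by
  have h1 : IntegrableOn g (tsupport c) := hg.integrableOn_compact_subset hcΩ hcs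
  have h2 : IntegrableOn (fun x => c x * g x) (tsupport c) :=
    h1.continuousOn_mul hc.continuousOn hcs
  refine (integrableOn_iff_integrable_of_support_subset ?_).1 h2
  intro x hx
  exact subset_tsupport c (left_ne_zero_of_mul hx)

theorem continuous_mul_of_tsupport_subset (hΩ : IsOpen Ω) {c f : E n → ℝ} (hc : Continuous c)
    (hcΩ : tsupport c ⊆ Ω) (hf : ContinuousOn f Ω) : Continuous (fun x => c x * f x) := by
  refine continuous_iff_continuousAt.2 fun x => ?_
  by_cases hx : x ∈ tsupport c
  · exact hc.continuousAt.mul (hf.continuousAt (hΩ.mem_nhds (hcΩ hx)))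
  · have : (fun x => c x * f x) =ᶠ[𝓝 x] fun _ => 0 := by
      filter_upwards [notMem_tsupport_iff_eventuallyEq.1 hx] with y hy
      simp [hy]
    exact continuousAt_const.congr this.symm

/-- The fundamental lemma of the calculus of variations, applied to each component of G - G'. -/
theorem HasWeakGrad.ae_eq (hΩ : IsOpen Ω) {f : E n → ℝ} {G G' : E n → E n}
    (h : HasWeakGrad Ω f G) (h' : HasWeakGrad Ω f G') : G =ᵐ[volume.restrict Ω] G' := by
  have key : ∀ i : Fin n, ∀ᵐ x, x ∈ Ω → G x i - G' x i = 0 := by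
    intro i
    have hl : ∀ {G : E n → E n}, LocallyIntegrableOn G Ω →
        LocallyIntegrableOn (fun x => G x i) Ω := fun {G} hG =>
      fun x hx => by
        obtain ⟨t, ht, h⟩ := hG x hx
        exact ⟨t, ht, (EuclideanSpace.proj i : E n →L[ℝ] ℝ).integrable_comp h⟩
    refine hΩ.ae_eq_zero_of_integral_contDiff_smul_eq_zero ((hl h.2.1).sub (hl h'.2.1)) ?_
    intro g hg hgs hgΩ
    have e1 := h.2.2 g ⟨hg, hgs, hgΩ⟩ i
    have e2 := h'.2.2 g ⟨hg, hgs, hgΩ⟩ i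
    have z : ∀ (G : E n → E n), ∫ x in Ω, G x i * g x = ∫ x, g x * G x i := fun G => by
      rw [setIntegral_eq_integral_of_forall_compl_eq_zero]
      · simp only [mul_comm]
      · intro x hx
        rw [image_eq_zero_of_notMem_tsupport (fun hx' => hx (hgΩ hx')), mul_zero]
    have i1 := integrable_mul_of_locallyIntegrableOn hg.continuous hgs hgΩ (hl h.2.1)
    have i2 := integrable_mul_of_locallyIntegrableOn hg.continuous hgs hgΩ (hl h'.2.1)
    rw [z] at e1 e2
    simp only [smul_eq_mul, mul_sub]
    rw [integral_sub i1 i2]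
    linarith
  rw [Filter.EventuallyEq, ae_restrict_iff' hΩ.measurableSet]
  filter_upwards [ae_all_iff.2 key] with x hx hxΩ
  ext i
  exact sub_eq_zero.1 (hx i hxΩ)

theorem HasWeakGrad.weakGrad_ae_eq (hΩ : IsOpen Ω) {f : E n → ℝ} {G : E n → E n}
    (h : HasWeakGrad Ω f G) : weakGrad Ω f =ᵐ[volume.restrict Ω] G := by
  have hex : ∃ G, HasWeakGrad Ω f G := ⟨G, h⟩
  rw [weakGrad, dif_pos hex]
  exact hex.choose_spec.ae_eq hΩ h

/-- `f` is continuous and vanishes outside `K`, and `G ∈ L^p` is its weak gradient in the whole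
space, which also vanishes outside `K`. -/
structure IsSob (p : ℝ) (K : Set (E n)) (f : E n → ℝ) (G : E n → E n) : Prop where
  cont : Continuous f
  eq_zero : ∀ x ∉ K, f x = 0
  grad_eq_zero : ∀ x ∉ K, G x = 0
  memLp : MemLp G (ENNReal.ofReal p) volume
  weak : ∀ φ : E n → ℝ, ContDiff ℝ (⊤ : ℕ∞) φ → HasCompactSupport φ → ∀ i : Fin n,
    ∫ x, f x * fderiv ℝ φ x (EuclideanSpace.single i 1) = -∫ x, G x i * φ x

theorem one_le_ofReal (hp : 1 < p) : 1 ≤ ENNReal.ofReal p := by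
  rw [← ENNReal.ofReal_one]; exact ENNReal.ofReal_le_ofReal hp.le

namespace IsSob

variable {f : E n → ℝ} {G : E n → E n}

theorem tsupport_subset (h : IsSob p K f G) (hK : IsCompact K) : tsupport f ⊆ K :=
  closure_minimal (fun x hx => by by_contra hxK; exact hx (h.eq_zero x hxK)) hK.isClosed

theorem hasCompactSupport (h : IsSob p K f G) (hK : IsCompact K) : HasCompactSupport f :=
  HasCompactSupport.intro hK h.eq_zero

theorem hasWeakGrad (h : IsSob p K f G) (hp : 1 < p) (hK : K ⊆ Ω) : HasWeakGrad Ω f G := by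
  refine ⟨h.cont.locallyIntegrable.locallyIntegrableOn _,
    (h.memLp.locallyIntegrable (one_le_ofReal hp)).locallyIntegrableOn _, fun φ hφ i => ?_⟩
  rw [setIntegral_eq_integral_of_forall_compl_eq_zero,
    setIntegral_eq_integral_of_forall_compl_eq_zero, h.weak φ hφ.1 hφ.2.1]
  · intro x hx; rw [h.grad_eq_zero x fun hx' => hx (hK hx')]; simp
  · intro x hx; rw [h.eq_zero x fun hx' => hx (hK hx')]; simp

theorem memW1pCc (h : IsSob p K f G) (hp : 1 < p) (hKc : IsCompact K) (hK : K ⊆ Ω) :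
    MemW1pCc p Ω f := by
  refine ⟨⟨?_, G, h.hasWeakGrad hp hK, h.memLp.restrict _⟩, h.cont, h.hasCompactSupport hKc,
    (h.tsupport_subset hKc).trans hK⟩
  exact (h.cont.memLp_of_hasCompactSupport (h.hasCompactSupport hKc)).restrict _

theorem weakGrad_ae_eq (h : IsSob p K f G) (hp : 1 < p) (hΩ : IsOpen Ω) (hK : K ⊆ Ω) :
    weakGrad Ω f =ᵐ[volume.restrict Ω] G :=
  (h.hasWeakGrad hp hK).weakGrad_ae_eq hΩ

end IsSob

theorem integral_mul_fderiv_of_contDiff {f φ : E n → ℝ} (hf : ContDiff ℝ 1 f)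
    (hφ : ContDiff ℝ 1 φ) (hφs : HasCompactSupport φ) (v : E n) :
    ∫ x, f x * fderiv ℝ φ x v = -∫ x, fderiv ℝ f x v * φ x := by
  have c1 : Continuous fun x => fderiv ℝ φ x v :=
    (hφ.continuous_fderiv (by norm_num)).clm_apply continuous_const
  have c2 : Continuous fun x => fderiv ℝ f x v :=
    (hf.continuous_fderiv (by norm_num)).clm_apply continuous_const
  refine integral_mul_fderiv_eq_neg_fderiv_mul_of_integrable ?_ ?_ ?_
    (fun x _ => hf.differentiable (by norm_num) x)
    (fun x _ => hφ.differentiable (by norm_num) x)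
  · exact (c2.mul hφ.continuous).integrable_of_hasCompactSupport hφs.mul_left
  · refine (hf.continuous.mul c1).integrable_of_hasCompactSupport (HasCompactSupport.mul_left ?_)
    exact hφs.fderiv_apply (𝕜 := ℝ) v
  · exact (hf.continuous.mul hφ.continuous).integrable_of_hasCompactSupport hφs.mul_left

theorem isSob_of_contDiff {f : E n → ℝ} (hf : ContDiff ℝ 1 f) (hfs : HasCompactSupport f) :
    IsSob p (tsupport f) f (gradient f) where
  cont := hf.continuous
  eq_zero x hx := image_eq_zero_of_notMem_tsupport hx
  grad_eq_zero x hx := gradient_eq_zero_of_notMem_tsupport hx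
  memLp := by
    refine (continuous_gradient hf).memLp_of_hasCompactSupport ?_
    exact HasCompactSupport.intro hfs fun x hx => gradient_eq_zero_of_notMem_tsupport hx
  weak φ hφ hφs i := by
    simp only [gradient_apply]
    exact integral_mul_fderiv_of_contDiff hf (hφ.of_le (by exact_mod_cast le_top)) hφs _

/-- Constants have zero weak gradient. The case c = 1 lets u be replaced by 1 + χ(u - 1), which is
positive everywhere although χ(u - 1) has compact support. -/
theorem HasWeakGrad.sub_const {f : E n → ℝ} {G : E n → E n} (h : HasWeakGrad Ω f G) (c : ℝ) :
    HasWeakGrad Ω (fun x => f x - c) G := by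
  refine ⟨h.1.sub (locallyIntegrableOn_const c), h.2.1, fun φ hφ i => ?_⟩
  rw [← h.2.2 φ hφ i]
  have hφ1 : ContDiff ℝ 1 φ := hφ.1.of_le (by exact_mod_cast le_top)
  have c1 : Continuous fun x => fderiv ℝ φ x (EuclideanSpace.single i 1) :=
    (hφ1.continuous_fderiv (by norm_num)).clm_apply continuous_const
  have cs : HasCompactSupport fun x => fderiv ℝ φ x (EuclideanSpace.single i 1) :=
    hφ.2.1.fderiv_apply (𝕜 := ℝ) _
  have hts : tsupport (fun x => fderiv ℝ φ x (EuclideanSpace.single i 1)) ⊆ Ω :=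
    (tsupport_fderiv_apply_subset ℝ _).trans hφ.2.2
  have h0 : ∫ x in Ω, c * fderiv ℝ φ x (EuclideanSpace.single i 1) = 0 := by
    rw [setIntegral_eq_integral_of_forall_compl_eq_zero]
    · have := integral_mul_fderiv_of_contDiff (contDiff_const (c := c)) hφ1 hφ.2.1
        (EuclideanSpace.single i 1)
      rw [this]; simp
    · intro x hx
      rw [image_eq_zero_of_notMem_tsupport
        (f := fun x => fderiv ℝ φ x (EuclideanSpace.single i 1)) fun hx' => hx (hts hx'), mul_zero]
  have i1 := integrable_mul_of_locallyIntegrableOn c1 cs hts h.1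
  simp only [mul_comm] at i1
  have i2 := (c1.integrable_of_hasCompactSupport cs (μ := volume)).const_mul c
  simp only [sub_mul]
  rw [integral_sub i1.integrableOn i2.integrableOn, h0, sub_zero]

/-- Multiplication of a `W^{1,p}_loc` function by a test function. -/
theorem isSob_cutoff_mul (hΩ : IsOpen Ω) {f χ : E n → ℝ} {G : E n → E n} (h : HasWeakGrad Ω f G)
    (hf : ContinuousOn f Ω)
    (hG : ∀ K ⊆ Ω, IsCompact K → MemLp G (ENNReal.ofReal p) (volume.restrict K))
    (hχ : IsTest Ω χ) :
    IsSob p (tsupport χ) (fun x => χ x * f x) (fun x => χ x • G x + f x • gradient χ x) := by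
  have hχ1 : ContDiff ℝ 1 χ := hχ.1.of_le (by exact_mod_cast le_top)
  have cχ := hχ1.continuous
  have hcf := continuous_mul_of_tsupport_subset hΩ cχ hχ.2.2 hf
  have cd : ∀ v, Continuous fun x => fderiv ℝ χ x v := fun v =>
    (hχ1.continuous_fderiv (by norm_num)).clm_apply continuous_const
  have cds : ∀ v, HasCompactSupport fun x => fderiv ℝ χ x v := fun v =>
    hχ.2.1.fderiv_apply (𝕜 := ℝ) v
  have cdt : ∀ v, tsupport (fun x => fderiv ℝ χ x v) ⊆ Ω := fun v =>
    (tsupport_fderiv_apply_subset ℝ v).trans hχ.2.2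
  have hdf : ∀ v, Continuous fun x => fderiv ℝ χ x v * f x := fun v =>
    continuous_mul_of_tsupport_subset hΩ (cd v) (cdt v) hf
  have hgf : Continuous fun x => f x • gradient χ x := by
    rw [← (PiLp.continuousLinearEquiv 2 ℝ fun _ : Fin n => ℝ).toHomeomorph.comp_continuous_iff]
    refine continuous_pi fun i => ?_
    have := hdf (EuclideanSpace.single i 1)
    refine this.congr fun x => ?_
    simp [gradient_apply, mul_comm]
  have hz : ∀ x ∉ tsupport χ, f x • gradient χ x = 0 := fun x hx => by
    rw [gradient_eq_zero_of_notMem_tsupport hx, smul_zero]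
  refine ⟨hcf, fun x hx => ?_, fun x hx => ?_, ?_, fun φ hφ hφs i => ?_⟩
  · rw [image_eq_zero_of_notMem_tsupport hx, zero_mul]
  · rw [hz x hx, image_eq_zero_of_notMem_tsupport hx, zero_smul, add_zero]
  · refine MemLp.add ?_ (hgf.memLp_of_hasCompactSupport (HasCompactSupport.intro hχ.2.1 hz))
    have hm := hG _ hχ.2.2 hχ.2.1
    obtain ⟨B, hB⟩ := hχ.2.1.exists_bound_of_continuous cχ
    have h1 : MemLp (fun x => χ x • G x) (ENNReal.ofReal p) (volume.restrict (tsupport χ)) := by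
      refine hm.of_le_mul (c := B) (cχ.aestronglyMeasurable.smul hm.1)
        (Eventually.of_forall fun x => ?_)
      rw [norm_smul]
      exact mul_le_mul_of_nonneg_right (hB x) (norm_nonneg _)
    have h2 := (memLp_indicator_iff_restrict (isClosed_tsupport χ).measurableSet).2 h1
    rwa [indicator_eq_self.2] at h2
    intro x hx
    by_contra hx'
    exact hx (by simp [image_eq_zero_of_notMem_tsupport hx'])
  · have hφ1 : ContDiff ℝ 1 φ := hφ.of_le (by exact_mod_cast le_top)
    have ht : IsTest Ω (fun x => χ x * φ x) := by
      refine ⟨hχ.1.mul hφ, hφs.mul_left, ?_⟩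
      exact (closure_mono (Function.support_mul_subset_left χ φ)).trans hχ.2.2
    -- The product rule for χf results from testing the weak gradient of f with χφ and moving the
    -- term with ∇χ to the other side.
    have key := h.2.2 _ ht i
    set e : E n := EuclideanSpace.single i 1
    have hd : ∀ x, fderiv ℝ (fun x => χ x * φ x) x e
        = χ x * fderiv ℝ φ x e + φ x * fderiv ℝ χ x e := fun x => by
      rw [fderiv_fun_mul (hχ1.differentiable (by norm_num) x)
        (hφ1.differentiable (by norm_num) x)]
      simp
    have cφ : Continuous fun x => fderiv ℝ φ x e :=
      (hφ1.continuous_fderiv (by norm_num)).clm_apply continuous_const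
    have hGi : LocallyIntegrableOn (fun x => G x i) Ω := fun x hx => by
      obtain ⟨t, ht, h⟩ := h.2.1 x hx
      exact ⟨t, ht, (EuclideanSpace.proj i : E n →L[ℝ] ℝ).integrable_comp h⟩
    have i1 : Integrable (fun x => χ x * f x * fderiv ℝ φ x e) :=
      (hcf.mul cφ).integrable_of_hasCompactSupport
        (HasCompactSupport.mul_left (hφs.fderiv_apply (𝕜 := ℝ) e))
    have i2 : Integrable (fun x => fderiv ℝ χ x e * f x * φ x) :=
      ((hdf e).mul hφ1.continuous).integrable_of_hasCompactSupport hφs.mul_left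
    have i3 : Integrable (fun x => χ x * φ x * G x i) :=
      integrable_mul_of_locallyIntegrableOn (cχ.mul hφ1.continuous) ht.2.1 ht.2.2 hGi
    have χ0 : ∀ x ∉ Ω, χ x = 0 := fun x hx =>
      image_eq_zero_of_notMem_tsupport fun hx' => hx (hχ.2.2 hx')
    have d0 : ∀ x ∉ Ω, fderiv ℝ χ x e = 0 := fun x hx =>
      image_eq_zero_of_notMem_tsupport (f := fun x => fderiv ℝ χ x e)
        fun hx' => hx (cdt e hx')
    rw [setIntegral_eq_integral_of_forall_compl_eq_zero (fun x hx => by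
        rw [hd, χ0 x hx, d0 x hx]; ring),
      setIntegral_eq_integral_of_forall_compl_eq_zero (fun x hx => by rw [χ0 x hx]; ring)] at key
    have e1 : ∫ x, f x * fderiv ℝ (fun x => χ x * φ x) x e
        = (∫ x, χ x * f x * fderiv ℝ φ x e) + ∫ x, fderiv ℝ χ x e * f x * φ x := by
      rw [← integral_add i1 i2]
      refine integral_congr_ae (Eventually.of_forall fun x => ?_)
      simp only [hd]; ring
    have e2 : ∫ x, G x i * (χ x * φ x) = ∫ x, χ x * φ x * G x i :=
      integral_congr_ae (Eventually.of_forall fun x => by simp only []; ring)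
    have e3 : ∫ x, (χ x • G x + f x • gradient χ x) i * φ x
        = (∫ x, χ x * φ x * G x i) + ∫ x, fderiv ℝ χ x e * f x * φ x := by
      rw [← integral_add i3 i2]
      refine integral_congr_ae (Eventually.of_forall fun x => ?_)
      simp only [PiLp.add_apply, PiLp.smul_apply, smul_eq_mul, gradient_apply]; ring
    rw [e1, e2] at key
    rw [e3]
    linarith

theorem exists_isTest_one_nhds (hΩ : IsOpen Ω) (hK : IsCompact K) (hKΩ : K ⊆ Ω) :
    ∃ χ : E n → ℝ, IsTest Ω χ ∧ (∀ x, 0 ≤ χ x ∧ χ x ≤ 1) ∧ ∀ᶠ x in 𝓝ˢ K, χ x = 1 := by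
  obtain ⟨L, hL, hKL, hLΩ⟩ := exists_compact_between hK hΩ hKΩ
  obtain ⟨f, h1, h0, hf⟩ := exists_contMDiffMap_one_nhds_of_subset_interior
    (n := (⊤ : ℕ∞)) (modelWithCornersSelf ℝ (E n)) hK.isClosed hKL
  have hs : tsupport f ⊆ L := closure_minimal (fun x hx => by
    by_contra hxL; exact hx (h0 x hxL)) hL.isClosed
  exact ⟨f, ⟨f.contMDiff.contDiff, HasCompactSupport.intro hL h0, hs.trans hLΩ⟩,
    fun x => ⟨(hf x).1, (hf x).2⟩, h1⟩

/-- Multiplication by a test function equal to 1 near the support leaves φ unchanged, but produces a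
weak gradient that vanishes outside a compact set and is valid on the whole space. -/
theorem MemW1pCc.exists_isSob (hΩ : IsOpen Ω) {φ : E n → ℝ} (h : MemW1pCc p Ω φ) :
    ∃ (K : Set (E n)) (G : E n → E n), IsCompact K ∧ K ⊆ Ω ∧ IsSob p K φ G := by
  obtain ⟨⟨-, G, hG, hGp⟩, hc, hs, hsΩ⟩ := h
  obtain ⟨χ, hχ, -, hχ1⟩ := exists_isTest_one_nhds hΩ hs hsΩ
  have := isSob_cutoff_mul hΩ (p := p) hG hc.continuousOn
    (fun K hK _ => hGp.mono_measure (Measure.restrict_mono hK le_rfl)) hχ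
  have e : (fun x => χ x * φ x) = φ := by
    ext x
    by_cases hx : x ∈ tsupport φ
    · rw [(Eventually.self_of_nhdsSet hχ1) x hx, one_mul]
    · rw [image_eq_zero_of_notMem_tsupport hx, mul_zero]
  rw [e] at this
  exact ⟨_, _, hχ.2.1, hχ.2.2, this⟩

end WeakGrad

/-! ### Mollification -/

section Mollify

variable {n : ℕ} {p : ℝ}

/-- The convolution of `g` with a normalized bump function. -/
def mollify {F : Type*} [NormedAddCommGroup F] [NormedSpace ℝ F]
    (φ : ContDiffBump (0 : E n)) (g : E n → F) : E n → F :=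
  convolution (φ.normed volume) g (ContinuousLinearMap.lsmul ℝ ℝ) volume

theorem mollify_apply {F : Type*} [NormedAddCommGroup F] [NormedSpace ℝ F]
    (φ : ContDiffBump (0 : E n)) (g : E n → F) (x : E n) :
    mollify φ g x = ∫ t, φ.normed volume t • g (x - t) := by
  simp [mollify, convolution_def]

theorem continuous_mollify {F : Type*} [NormedAddCommGroup F] [NormedSpace ℝ F]
    (φ : ContDiffBump (0 : E n)) {g : E n → F} (hg : LocallyIntegrable g) :
    Continuous (mollify φ g) :=
  HasCompactSupport.continuous_convolution_left _ φ.hasCompactSupport_normed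
    φ.continuous_normed hg

theorem integrable_mollify {F : Type*} [NormedAddCommGroup F] [NormedSpace ℝ F]
    (φ : ContDiffBump (0 : E n)) {g : E n → F} (hg : LocallyIntegrable g) (x : E n) :
    Integrable (fun t => φ.normed volume t • g (x - t)) := by
  have := HasCompactSupport.convolutionExists_left (ContinuousLinearMap.lsmul ℝ ℝ)
    (φ.hasCompactSupport_normed (μ := volume)) φ.continuous_normed hg x
  simpa [ConvolutionExistsAt] using this

theorem mollify_add {F : Type*} [NormedAddCommGroup F] [NormedSpace ℝ F]
    (φ : ContDiffBump (0 : E n)) {g h : E n → F} (hg : LocallyIntegrable g)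
    (hh : LocallyIntegrable h) : mollify φ (g + h) = mollify φ g + mollify φ h := by
  ext1 x
  simp only [mollify_apply, Pi.add_apply, smul_add]
  exact integral_add (integrable_mollify φ hg x) (integrable_mollify φ hh x)

theorem support_mollify_subset {F : Type*} [NormedAddCommGroup F] [NormedSpace ℝ F]
    (φ : ContDiffBump (0 : E n)) {g : E n → F} {K : Set (E n)} (hK : ∀ x ∉ K, g x = 0) {δ : ℝ}
    (hδ : φ.rOut ≤ δ) : Function.support (mollify φ g) ⊆ Metric.cthickening δ K := by
  intro x hx
  obtain ⟨a, ha, b, hb, rfl⟩ := Set.mem_add.1 (support_convolution_subset _ hx)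
  rw [φ.support_normed_eq, mem_ball_zero_iff] at ha
  have hbK : b ∈ K := by by_contra h; exact hb (hK b h)
  refine Metric.mem_cthickening_of_dist_le _ b _ _ hbK ?_
  simpa [dist_eq_norm] using ha.le.trans hδ

/-- The kernel is the density of a probability measure ν. Monotonicity of L^p-norms in the exponent
for ν bounds |G * kernel|^p by the ν-average of |G(x - t)|^p; Tonelli and translation invariance
finish. -/
theorem eLpNorm_mollify_le {F : Type*} [NormedAddCommGroup F] [NormedSpace ℝ F]
    [FiniteDimensional ℝ F] (hp : 1 < p) (φ : ContDiffBump (0 : E n))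
    {G : E n → F} (hG : AEStronglyMeasurable G volume) :
    eLpNorm (mollify φ G) (ENNReal.ofReal p) volume ≤ eLpNorm G (ENNReal.ofReal p) volume := by
  -- A strongly measurable representative makes (x, t) ↦ G(x - t) jointly measurable, as Tonelli
  -- requires.
  wlog hGm : StronglyMeasurable G generalizing G
  · have e : mollify φ G = mollify φ (hG.mk G) :=
      convolution_congr _ (ae_eq_refl _) hG.ae_eq_mk
    rw [e, eLpNorm_congr_ae hG.ae_eq_mk]
    exact this hG.stronglyMeasurable_mk.aestronglyMeasurable hG.stronglyMeasurable_mk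
  have hp0 : 0 < p := by linarith
  have hP : ENNReal.ofReal p ≠ 0 := by simpa using hp0
  have hcm : Measurable fun t => ENNReal.ofReal (φ.normed volume t) :=
    (φ.continuous_normed (μ := volume)).measurable.ennreal_ofReal
  set ν : Measure (E n) := volume.withDensity fun t => ENNReal.ofReal (φ.normed volume t)
  have hν : IsProbabilityMeasure ν := ⟨by
    rw [withDensity_apply _ MeasurableSet.univ, Measure.restrict_univ,
      ← ofReal_integral_eq_lintegral_ofReal φ.integrable_normed
        (Eventually.of_forall φ.nonneg_normed), φ.integral_normed, ENNReal.ofReal_one]⟩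
  rw [eLpNorm_eq_lintegral_rpow_enorm_toReal hP ENNReal.ofReal_ne_top,
    eLpNorm_eq_lintegral_rpow_enorm_toReal hP ENNReal.ofReal_ne_top, ENNReal.toReal_ofReal hp0.le]
  refine ENNReal.rpow_le_rpow ?_ (by positivity)
  have hmx : ∀ x, StronglyMeasurable fun t => G (x - t) := fun x =>
    hGm.comp_measurable (measurable_const.sub measurable_id)
  have h1 : ∀ x, ‖mollify φ G x‖ₑ ^ p ≤ ∫⁻ t, ‖G (x - t)‖ₑ ^ p ∂ν := by
    intro x
    have h2 : ‖mollify φ G x‖ₑ ≤ ∫⁻ t, ‖G (x - t)‖ₑ ∂ν := by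
      rw [mollify_apply, lintegral_withDensity_eq_lintegral_mul _ hcm (hmx x).enorm]
      refine (enorm_integral_le_lintegral_enorm _).trans_eq (lintegral_congr fun t => ?_)
      rw [enorm_smul, Pi.mul_apply, Real.enorm_of_nonneg (φ.nonneg_normed t)]
    have h3 := eLpNorm'_le_eLpNorm'_of_exponent_le one_pos hp.le ν (hmx x).aestronglyMeasurable
    simp only [eLpNorm'_eq_lintegral_enorm, ENNReal.rpow_one, one_div, inv_one] at h3
    calc ‖mollify φ G x‖ₑ ^ p ≤ ((∫⁻ t, ‖G (x - t)‖ₑ ^ p ∂ν) ^ p⁻¹) ^ p :=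
          ENNReal.rpow_le_rpow (h2.trans h3) hp0.le
      _ = _ := by rw [← ENNReal.rpow_mul, inv_mul_cancel₀ hp0.ne', ENNReal.rpow_one]
  calc ∫⁻ x, ‖mollify φ G x‖ₑ ^ p ≤ ∫⁻ x, ∫⁻ t, ‖G (x - t)‖ₑ ^ p ∂ν := lintegral_mono h1
    _ = ∫⁻ t, (∫⁻ x, ‖G (x - t)‖ₑ ^ p) ∂ν := by
        refine lintegral_lintegral_swap ?_
        exact ((hGm.comp_measurable (measurable_fst.sub measurable_snd)).enorm.pow_const
          p).aemeasurable
    _ = ∫⁻ _t, (∫⁻ x, ‖G x‖ₑ ^ p) ∂ν := by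
        refine lintegral_congr fun t => ?_
        exact lintegral_sub_right_eq_self (fun x => ‖G x‖ₑ ^ p) t
    _ = _ := by rw [lintegral_const, measure_univ, mul_one]

theorem norm_mollify_sub_le {F : Type*} [NormedAddCommGroup F] [NormedSpace ℝ F]
    [CompleteSpace F] {g : E n → F} (hg : Continuous g) (hgs : HasCompactSupport g) {ε : ℝ}
    (hε : 0 < ε) : ∃ δ > 0, ∀ φ : ContDiffBump (0 : E n), φ.rOut ≤ δ →
      ∀ x, ‖mollify φ g x - g x‖ ≤ ε := by
  obtain ⟨δ, hδ, h⟩ := Metric.uniformContinuous_iff.1 (hgs.uniformContinuous_of_continuous hg) ε hε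
  refine ⟨δ, hδ, fun φ hφ x => ?_⟩
  rw [← dist_eq_norm]
  refine ContDiffBump.dist_normed_convolution_le hg.aestronglyMeasurable fun y hy => ?_
  exact (h (lt_of_lt_of_le hy hφ)).le

/-- Three-ε argument: G is close in L^p to a continuous g of compact support, mollification does not
enlarge G - g, and for g the convergence is uniform. -/
theorem tendsto_eLpNorm_mollify_sub {F : Type*} [NormedAddCommGroup F] [NormedSpace ℝ F]
    [FiniteDimensional ℝ F] (hp : 1 < p) {φ : ℕ → ContDiffBump (0 : E n)}
    (hφ : Tendsto (fun k => (φ k).rOut) atTop (𝓝 0)) {G : E n → F}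
    (hG : MemLp G (ENNReal.ofReal p) volume) :
    Tendsto (fun k => eLpNorm (mollify (φ k) G - G) (ENNReal.ofReal p) volume) atTop (𝓝 0) := by
  have hF : CompleteSpace F := FiniteDimensional.complete ℝ F
  have h1 := one_le_ofReal hp
  have hp0 : 0 < p := by linarith
  rw [ENNReal.tendsto_nhds_zero]
  intro ε hε
  have hε3 : ε / 3 ≠ 0 := (ENNReal.div_pos hε.ne' (by norm_num)).ne'
  obtain ⟨g, hgs, hgle, hgc, hgm⟩ :=
    hG.exists_hasCompactSupport_eLpNorm_sub_le ENNReal.ofReal_ne_top hε3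
  have lg : LocallyIntegrable g := hgc.locallyIntegrable
  have lGg : LocallyIntegrable (G - g) := (hG.sub hgm).locallyIntegrable h1
  -- A uniform error η on the bounded 1-neighbourhood of the support of g contributes at most ε / 3
  -- to the L^p-norm.
  obtain ⟨η, hη, hηle⟩ : ∃ η : ℝ, 0 < η ∧ (volume (Metric.cthickening 1 (tsupport g))) ^ p⁻¹
      * ENNReal.ofReal η ≤ ε / 3 := by
    have hfin : (volume (Metric.cthickening 1 (tsupport g))) ^ p⁻¹ ≠ ⊤ :=
      ENNReal.rpow_ne_top_of_nonneg (by positivity)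
        (IsCompact.cthickening hgs).measure_lt_top.ne
    have ht : Tendsto (fun η : ℝ => (volume (Metric.cthickening 1 (tsupport g))) ^ p⁻¹
        * ENNReal.ofReal η) (𝓝[>] 0) (𝓝 0) := by
      have := ENNReal.Tendsto.const_mul (a := (volume (Metric.cthickening 1 (tsupport g))) ^ p⁻¹)
        ((ENNReal.continuous_ofReal.tendsto 0).mono_left (nhdsWithin_le_nhds (s := Ioi 0)))
        (Or.inr hfin)
      simpa using this
    have := (ENNReal.tendsto_nhds_zero.1 ht (ε / 3) (pos_iff_ne_zero.2 hε3)).and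
      self_mem_nhdsWithin
    obtain ⟨η, h⟩ := this.exists
    exact ⟨η, h.2, h.1⟩
  obtain ⟨δ, hδ, hδle⟩ := norm_mollify_sub_le hgc hgs hη
  filter_upwards [hφ.eventually (ge_mem_nhds hδ), hφ.eventually (ge_mem_nhds one_pos)]
    with k hk hk1
  have e : mollify (φ k) G - G
      = mollify (φ k) (G - g) + (mollify (φ k) g - g) - (G - g) := by
    have : mollify (φ k) G = mollify (φ k) (G - g) + mollify (φ k) g := by
      rw [← mollify_add _ lGg lg, sub_add_cancel]
    rw [this]; abel
  have m1 := (continuous_mollify (φ k) lGg).aestronglyMeasurable (μ := volume)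
  have m2 := ((continuous_mollify (φ k) lg).sub hgc).aestronglyMeasurable (μ := volume)
  have b2 : eLpNorm (mollify (φ k) g - g) (ENNReal.ofReal p) volume ≤ ε / 3 := by
    have hs : Function.support (mollify (φ k) g - g) ⊆ Metric.cthickening 1 (tsupport g) := by
      refine (Function.support_sub _ _).trans (union_subset ?_ ?_)
      · exact support_mollify_subset _ (fun x hx => image_eq_zero_of_notMem_tsupport hx) hk1
      · exact (subset_tsupport g).trans (Metric.self_subset_cthickening _)
    rw [← eLpNorm_restrict_eq_of_support_subset hs]
    refine (eLpNorm_le_of_ae_bound (C := η) (Eventually.of_forall fun x => ?_)).trans ?_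
    · exact hδle (φ k) hk x
    · rwa [Measure.restrict_apply_univ, ENNReal.toReal_ofReal hp0.le]
  have b1 := (eLpNorm_mollify_le hp (φ k) (hG.sub hgm).1).trans hgle
  rw [e]
  calc _ ≤ eLpNorm (mollify (φ k) (G - g) + (mollify (φ k) g - g)) (ENNReal.ofReal p) volume
        + eLpNorm (G - g) (ENNReal.ofReal p) volume :=
        eLpNorm_sub_le (m1.add m2) (hG.sub hgm).1 h1
    _ ≤ (eLpNorm (mollify (φ k) (G - g)) (ENNReal.ofReal p) volume
        + eLpNorm (mollify (φ k) g - g) (ENNReal.ofReal p) volume)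
        + eLpNorm (G - g) (ENNReal.ofReal p) volume := by
        gcongr; exact eLpNorm_add_le m1 m2 h1
    _ ≤ (ε / 3 + ε / 3) + ε / 3 := by gcongr
    _ = ε := ENNReal.add_thirds ε

/-- A sequence converging in `L^p` has a subsequence that converges a.e. and is dominated by an
`L^p` function. -/
theorem exists_subseq_dominated {α F : Type*} [MeasurableSpace α] [NormedAddCommGroup F]
    {μ : Measure α} (hp : 1 < p) {h : ℕ → α → F} {G : α → F}
    (hh : ∀ k, AEStronglyMeasurable (h k) μ) (hG : MemLp G (ENNReal.ofReal p) μ)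
    (hlim : Tendsto (fun k => eLpNorm (h k - G) (ENNReal.ofReal p) μ) atTop (𝓝 0)) :
    ∃ (ns : ℕ → ℕ) (H : α → ℝ), StrictMono ns ∧ MemLp H (ENNReal.ofReal p) μ ∧
      ∀ᵐ x ∂μ, Tendsto (fun k => h (ns k) x) atTop (𝓝 (G x)) ∧ ∀ k, ‖h (ns k) x‖ ≤ H x := by
  have hp0 : 0 < p := by linarith
  have hP : ENNReal.ofReal p ≠ 0 := by simpa using hp0
  have hI : ∀ k, ∫⁻ x, ‖h k x - G x‖ₑ ^ p ∂μ
      = eLpNorm (h k - G) (ENNReal.ofReal p) μ ^ p := fun k => by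
    rw [eLpNorm_eq_lintegral_rpow_enorm_toReal hP ENNReal.ofReal_ne_top,
      ENNReal.toReal_ofReal hp0.le, ← ENNReal.rpow_mul, one_div_mul_cancel hp0.ne',
      ENNReal.rpow_one]
    rfl
  have hlim' : Tendsto (fun k => ∫⁻ x, ‖h k x - G x‖ₑ ^ p ∂μ) atTop (𝓝 0) := by
    simp only [hI]
    have := (ENNReal.continuous_rpow_const (y := p)).tendsto 0 |>.comp hlim
    rwa [ENNReal.zero_rpow_of_pos hp0] at this
  -- The p-th powers of the errors along the subsequence have integrals at most 2^(-k), so their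
  -- pointwise sum D is integrable. Finiteness of D forces a.e. convergence, and D^(1/p) bounds
  -- every error at once.
  obtain ⟨ns, hns, hle⟩ := Filter.extraction_forall_of_eventually
    (P := fun k m => ∫⁻ x, ‖h m x - G x‖ₑ ^ p ∂μ ≤ (2⁻¹ : ℝ≥0∞) ^ k)
    (fun k => ENNReal.tendsto_nhds_zero.1 hlim' _ (ENNReal.pow_pos (ENNReal.inv_pos.2 ENNReal.ofNat_ne_top) k))
  set D : α → ℝ≥0∞ := fun x => ∑' k, ‖h (ns k) x - G x‖ₑ ^ p
  have hm : ∀ k, AEMeasurable (fun x => ‖h (ns k) x - G x‖ₑ ^ p) μ := fun k =>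
    ((hh (ns k)).sub hG.1).enorm.pow_const p
  have hDm : AEMeasurable D μ := AEMeasurable.tsum hm
  have hD : ∫⁻ x, D x ∂μ < ⊤ := by
    rw [lintegral_tsum hm]
    refine (ENNReal.tsum_le_tsum hle).trans_lt ?_
    rw [ENNReal.tsum_geometric]
    simp
  have hDfin := ae_lt_top' hDm hD.ne
  refine ⟨ns, fun x => ‖G x‖ + (D x ^ p⁻¹).toReal, hns, hG.norm.add ⟨?_, ?_⟩, ?_⟩
  · exact (hDm.pow_const _).ennreal_toReal.aestronglyMeasurable
  · rw [eLpNorm_eq_lintegral_rpow_enorm_toReal hP ENNReal.ofReal_ne_top,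
      ENNReal.toReal_ofReal hp0.le]
    refine ENNReal.rpow_lt_top_of_nonneg (by positivity) (ne_of_lt ?_)
    refine lt_of_le_of_lt (lintegral_mono fun x => ?_) hD
    calc _ ≤ (D x ^ p⁻¹) ^ p := by
            refine ENNReal.rpow_le_rpow ?_ hp0.le
            rw [Real.enorm_of_nonneg ENNReal.toReal_nonneg]
            exact ENNReal.ofReal_toReal_le
      _ = D x := by rw [← ENNReal.rpow_mul, inv_mul_cancel₀ hp0.ne', ENNReal.rpow_one]
  · filter_upwards [hDfin] with x hx
    have hk : ∀ k, ‖h (ns k) x - G x‖ₑ ≤ D x ^ p⁻¹ := fun k => by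
      calc ‖h (ns k) x - G x‖ₑ = (‖h (ns k) x - G x‖ₑ ^ p) ^ p⁻¹ := by
            rw [← ENNReal.rpow_mul, mul_inv_cancel₀ hp0.ne', ENNReal.rpow_one]
        _ ≤ _ := ENNReal.rpow_le_rpow (ENNReal.le_tsum k) (by positivity)
    have hDr : D x ^ p⁻¹ ≠ ⊤ := ENNReal.rpow_ne_top_of_nonneg (by positivity) hx.ne
    constructor
    · have h0 := ENNReal.tendsto_atTop_zero_of_tsum_ne_top hx.ne
      have h1 : Tendsto (fun k => ‖h (ns k) x - G x‖ₑ) atTop (𝓝 0) := by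
        have := (ENNReal.continuous_rpow_const (y := p⁻¹)).tendsto 0 |>.comp h0
        rw [ENNReal.zero_rpow_of_pos (by positivity)] at this
        refine this.congr fun k => ?_
        simp only [Function.comp]
        rw [← ENNReal.rpow_mul, mul_inv_cancel₀ hp0.ne', ENNReal.rpow_one]
      rw [tendsto_iff_edist_tendsto_0]
      simpa only [edist_eq_enorm_sub] using h1
    · intro k
      have h2 : ‖h (ns k) x - G x‖ ≤ (D x ^ p⁻¹).toReal := by
        have := ENNReal.toReal_mono hDr (hk k)
        simpa using this
      calc ‖h (ns k) x‖ = ‖G x + (h (ns k) x - G x)‖ := by congr 1; abel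
        _ ≤ _ := (norm_add_le _ _).trans (by gcongr)

/-- The derivative falls on the kernel first; the translated and reflected kernel is then a test
function for the weak gradient of f. -/
theorem gradient_mollify {K : Set (E n)} {f : E n → ℝ} {G : E n → E n} (hp : 1 < p)
    (h : IsSob p K f G) (φ : ContDiffBump (0 : E n)) :
    gradient (mollify φ f) = mollify φ G := by
  have lG := h.memLp.locallyIntegrable (one_le_ofReal hp)
  have lf : LocallyIntegrable f := h.cont.locallyIntegrable
  have hφ1 : ContDiff ℝ 1 (φ.normed volume) := φ.contDiff_normed (n := 1)
  ext x i
  set e : E n := EuclideanSpace.single i 1 with he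
  have hd := (φ.hasCompactSupport_normed (μ := volume)).hasFDerivAt_convolution_left
    (ContinuousLinearMap.lsmul ℝ ℝ) hφ1 lf x
  have hi := HasCompactSupport.convolutionExists_left
    ((ContinuousLinearMap.lsmul ℝ ℝ : ℝ →L[ℝ] ℝ →L[ℝ] ℝ).precompL (E n))
    ((φ.hasCompactSupport_normed (μ := volume)).fderiv (𝕜 := ℝ))
    (hφ1.continuous_fderiv (by norm_num)) lf x
  rw [gradient_apply, show fderiv ℝ (mollify φ f) x = _ from hd.fderiv, convolution_def,
    ContinuousLinearMap.integral_apply hi]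
  have hGi : mollify φ G x i = ∫ t, φ.normed volume t * G (x - t) i := by
    rw [mollify_apply]
    have := (EuclideanSpace.proj i : E n →L[ℝ] ℝ).integral_comp_comm (integrable_mollify φ lG x)
    simpa using this.symm
  rw [hGi]
  simp only [ContinuousLinearMap.precompL_apply, ContinuousLinearMap.lsmul_apply, smul_eq_mul]
  have key := h.weak (fun t => φ.normed volume (x - t))
    ((φ.contDiff_normed (n := ⊤)).comp (contDiff_const.sub contDiff_id))
    ((φ.hasCompactSupport_normed (μ := volume)).comp_homeomorph (Homeomorph.subLeft x)) i
  have hdt : ∀ t, fderiv ℝ (fun t => φ.normed volume (x - t)) t e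
      = -fderiv ℝ (φ.normed volume) (x - t) e := fun t => by
    have h1 : HasFDerivAt (fun t : E n => x - t) (-ContinuousLinearMap.id ℝ (E n)) t := by
      simpa using (hasFDerivAt_id t).const_sub x
    have h2 := ((hφ1.differentiable (by norm_num) (x - t)).hasFDerivAt).comp t h1
    rw [show fderiv ℝ (fun t => φ.normed volume (x - t)) t = _ from h2.fderiv]
    simp
  rw [← integral_sub_left_eq_self (fun t => fderiv ℝ (φ.normed volume) t e * f (x - t)) volume x,
    ← integral_sub_left_eq_self (fun t => φ.normed volume t * G (x - t) i) volume x]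
  simp only [sub_sub_cancel]
  simp only [← he, hdt, mul_neg, integral_neg, neg_inj] at key
  calc _ = ∫ t, f t * fderiv ℝ (φ.normed volume) (x - t) e := by simp only [mul_comm]
    _ = _ := by rw [key]; simp only [mul_comm]

/-- Approximation of compactly supported Sobolev functions by test functions, uniformly, with
gradients converging a.e. and dominated in `L^p`. -/
theorem IsSob.exists_approx {K Ω : Set (E n)} {f : E n → ℝ} {G : E n → E n} (hp : 1 < p)
    (h : IsSob p K f G) (hK : IsCompact K) (hΩ : IsOpen Ω) (hKΩ : K ⊆ Ω) {ε : ℝ} (hε : 0 < ε) :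
    ∃ (L : Set (E n)) (F : ℕ → E n → ℝ) (H : E n → ℝ), IsCompact L ∧ L ⊆ Ω ∧ K ⊆ L ∧
      (∀ k, ContDiff ℝ (⊤ : ℕ∞) (F k)) ∧ (∀ k, tsupport (F k) ⊆ L) ∧
      (∀ k x, |F k x - f x| ≤ ε) ∧ (∀ x, Tendsto (fun k => F k x) atTop (𝓝 (f x))) ∧
      MemLp H (ENNReal.ofReal p) volume ∧
      ∀ᵐ x, Tendsto (fun k => gradient (F k) x) atTop (𝓝 (G x)) ∧
        ∀ k, ‖gradient (F k) x‖ ≤ H x := by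
  obtain ⟨δ, hδ, hδΩ⟩ := hK.exists_cthickening_subset_open hΩ hKΩ
  have hfs := h.hasCompactSupport hK
  obtain ⟨δ', hδ', hδle⟩ := norm_mollify_sub_le h.cont hfs hε
  have hr : ∀ k : ℕ, 0 < min δ δ' / (k + 1) := fun k => by positivity
  set φ : ℕ → ContDiffBump (0 : E n) := fun k =>
    ⟨min δ δ' / (k + 1) / 2, min δ δ' / (k + 1), by have := hr k; positivity,
      half_lt_self (hr k)⟩
  have hφ : Tendsto (fun k => (φ k).rOut) atTop (𝓝 0) := by
    have := (tendsto_one_div_add_atTop_nhds_zero_nat (𝕜 := ℝ)).const_mul (min δ δ')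
    simpa [φ, div_eq_mul_inv] using this
  have hφle : ∀ k, (φ k).rOut ≤ min δ δ' := fun k => by
    refine div_le_self (by positivity) ?_
    have : (0 : ℝ) ≤ k := Nat.cast_nonneg k
    linarith
  have lG := h.memLp.locallyIntegrable (one_le_ofReal hp)
  obtain ⟨ns, H, hns, hH, hae⟩ := exists_subseq_dominated hp
    (fun k => (continuous_mollify (φ k) lG).aestronglyMeasurable) h.memLp
    (tendsto_eLpNorm_mollify_sub hp hφ h.memLp)
  refine ⟨Metric.cthickening δ K, fun k => mollify (φ (ns k)) f, H, hK.cthickening, hδΩ,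
    Metric.self_subset_cthickening K, fun k => ?_, fun k => ?_, fun k x => ?_, fun x => ?_, hH, ?_⟩
  · exact HasCompactSupport.contDiff_convolution_left _ ((φ (ns k)).hasCompactSupport_normed)
      ((φ (ns k)).contDiff_normed) h.cont.locallyIntegrable
  · refine closure_minimal ?_ Metric.isClosed_cthickening
    exact support_mollify_subset _ h.eq_zero ((hφle _).trans (min_le_left _ _))
  · exact hδle _ ((hφle _).trans (min_le_right _ _)) x
  · exact (ContDiffBump.convolution_tendsto_right_of_continuous hφ h.cont x).comp
      hns.tendsto_atTop
  · simpa only [gradient_mollify hp h] using hae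

end Mollify

/-! ### The chain rule -/

section Chain

variable {n : ℕ} {p : ℝ}

theorem gradient_comp_pair {Φ : ℝ × ℝ → ℝ} {v f : E n → ℝ} {x : E n}
    (hΦ : DifferentiableAt ℝ Φ (v x, f x)) (hv : DifferentiableAt ℝ v x)
    (hf : DifferentiableAt ℝ f x) :
    gradient (fun x => Φ (v x, f x)) x = fderiv ℝ Φ (v x, f x) (1, 0) • gradient v x
      + fderiv ℝ Φ (v x, f x) (0, 1) • gradient f x := by
  have h := hΦ.hasFDerivAt.comp x (hv.hasFDerivAt.prodMk hf.hasFDerivAt)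
  ext i
  simp only [PiLp.add_apply, PiLp.smul_apply, gradient_apply, smul_eq_mul]
  rw [show fderiv ℝ (fun x => Φ (v x, f x)) x = _ from h.fderiv]
  set e : E n := EuclideanSpace.single i 1
  have : ((fderiv ℝ v x).prod (fderiv ℝ f x)) e
      = fderiv ℝ v x e • ((1 : ℝ), (0 : ℝ)) + fderiv ℝ f x e • ((0 : ℝ), (1 : ℝ)) := by
    simp
  rw [ContinuousLinearMap.comp_apply, this, map_add, map_smul, map_smul]
  simp [mul_comm]

theorem isCompact_range_of_hasCompactSupport {f : E n → ℝ × ℝ} (hf : Continuous f)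
    (hs : HasCompactSupport f) : IsCompact (range f ∪ {0}) := by
  have : range f ∪ {0} = f '' tsupport f ∪ {0} := by
    refine Subset.antisymm (union_subset ?_ subset_union_right)
      (union_subset_union_left _ (image_subset_range _ _))
    rintro _ ⟨x, rfl⟩
    by_cases hx : x ∈ tsupport f
    · exact Or.inl ⟨x, hx, rfl⟩
    · exact Or.inr (image_eq_zero_of_notMem_tsupport hx)
  rw [this]
  exact (hs.image hf).union isCompact_singleton

/-- The chain rule for a `C^1` function of two Sobolev functions. -/
theorem IsSob.comp_pair {K₁ K₂ : Set (E n)} {v f : E n → ℝ} {Gv Gf : E n → E n} (hp : 1 < p)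
    (hK₁ : IsCompact K₁) (hK₂ : IsCompact K₂) (hv : IsSob p K₁ v Gv) (hf : IsSob p K₂ f Gf)
    {U : Set (ℝ × ℝ)} (hU : IsOpen U) {Φ : ℝ × ℝ → ℝ} (hΦ : ContDiffOn ℝ 1 Φ U)
    (hvf : ∀ x, (v x, f x) ∈ U) (hU0 : (0, 0) ∈ U) (hΦ0 : ∀ t, (t, 0) ∈ U → Φ (t, 0) = 0) :
    IsSob p K₂ (fun x => Φ (v x, f x)) (fun x => fderiv ℝ Φ (v x, f x) (1, 0) • Gv x
      + fderiv ℝ Φ (v x, f x) (0, 1) • Gf x) := by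
  have hcv : Continuous fun x => (v x, f x) := hv.cont.prodMk hf.cont
  have hcs : HasCompactSupport fun x => (v x, f x) := by
    refine HasCompactSupport.intro (hK₁.union hK₂) fun x hx => ?_
    rw [mem_union, not_or] at hx
    rw [hv.eq_zero x hx.1, hf.eq_zero x hx.2]; rfl
  set R : Set (ℝ × ℝ) := range (fun x => (v x, f x)) ∪ {0}
  have hR : IsCompact R := isCompact_range_of_hasCompactSupport hcv hcs
  have hRU : R ⊆ U := by
    rintro _ (⟨x, rfl⟩ | rfl)
    · exact hvf x
    · exact hU0
  -- Mollifications that are uniformly δ-close take values in a compact subset S of U. There Φ and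
  -- its partial derivatives are bounded, which provides the majorants for dominated convergence.
  obtain ⟨δ, hδ, hδU⟩ := hR.exists_cthickening_subset_open hU hRU
  set S : Set (ℝ × ℝ) := Metric.cthickening δ R
  have hS : IsCompact S := hR.cthickening
  have hxS : ∀ x, (v x, f x) ∈ S := fun x =>
    Metric.self_subset_cthickening R (Or.inl ⟨x, rfl⟩)
  have hdc : ContinuousOn (fderiv ℝ Φ) U := hΦ.continuousOn_fderiv_of_isOpen hU le_rfl
  have hΦd : ∀ q ∈ U, DifferentiableAt ℝ Φ q := fun q hq =>
    (hΦ.differentiableOn (by norm_num)).differentiableAt (hU.mem_nhds hq)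
  have hdcw : ∀ w : ℝ × ℝ, ContinuousOn (fun q => fderiv ℝ Φ q w) U := fun w =>
    hdc.clm_apply continuousOn_const
  obtain ⟨B₀, hB₀⟩ := hS.exists_bound_of_continuousOn (hΦ.continuousOn.mono hδU)
  obtain ⟨B₁, hB₁⟩ := hS.exists_bound_of_continuousOn ((hdcw (1, 0)).mono hδU)
  obtain ⟨B₂, hB₂⟩ := hS.exists_bound_of_continuousOn ((hdcw (0, 1)).mono hδU)
  have c1 : ∀ w : ℝ × ℝ, Continuous fun x => fderiv ℝ Φ (v x, f x) w := fun w =>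
    (hdcw w).comp_continuous hcv hvf
  -- Because Φ vanishes on the axis, so does its first partial derivative; hence the proposed
  -- gradient is zero off K₂, even where ∇v is not.
  have hΦ1 : ∀ t, (t, (0 : ℝ)) ∈ U → fderiv ℝ Φ (t, 0) (1, 0) = 0 := by
    intro t ht
    have h1 : HasDerivAt (fun s : ℝ => (s, (0 : ℝ))) (1, 0) t :=
      (hasDerivAt_id t).prodMk (hasDerivAt_const t 0)
    have h2 := (hΦd _ ht).hasFDerivAt.comp_hasDerivAt t h1
    have h3 : (Φ ∘ fun s : ℝ => (s, (0 : ℝ))) =ᶠ[𝓝 t] fun _ => 0 := by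
      have : ∀ᶠ s in 𝓝 t, (s, (0 : ℝ)) ∈ U :=
        h1.continuousAt.eventually_mem (hU.mem_nhds ht)
      filter_upwards [this] with s hs using hΦ0 s hs
    exact h2.unique ((hasDerivAt_const t (0 : ℝ)).congr_of_eventuallyEq h3)
  refine ⟨?_, fun x hx => ?_, fun x hx => ?_, ?_, fun θ hθ hθs i => ?_⟩
  · exact hΦ.continuousOn.comp_continuous hcv hvf
  · have := hvf x
    rw [hf.eq_zero x hx] at this ⊢
    exact hΦ0 _ this
  · have := hvf x
    rw [hf.eq_zero x hx] at this ⊢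
    rw [hΦ1 _ this, hf.grad_eq_zero x hx, zero_smul, smul_zero, add_zero]
  · refine MemLp.add ?_ ?_
    · refine hv.memLp.of_le_mul (c := B₁) ((c1 _).aestronglyMeasurable.smul hv.memLp.1)
        (Eventually.of_forall fun x => ?_)
      rw [norm_smul]
      exact mul_le_mul_of_nonneg_right (hB₁ _ (hxS x)) (norm_nonneg _)
    · refine hf.memLp.of_le_mul (c := B₂) ((c1 _).aestronglyMeasurable.smul hf.memLp.1)
        (Eventually.of_forall fun x => ?_)
      rw [norm_smul]
      exact mul_le_mul_of_nonneg_right (hB₂ _ (hxS x)) (norm_nonneg _)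
  · obtain ⟨-, vk, H₁, -, -, -, hvs, -, hvd, hvl, hH₁, hva⟩ :=
      hv.exists_approx hp hK₁ isOpen_univ (subset_univ _) hδ
    obtain ⟨-, fk, H₂, -, -, -, hfs, -, hfd, hfl, hH₂, hfa⟩ :=
      hf.exists_approx hp hK₂ isOpen_univ (subset_univ _) hδ
    set e : E n := EuclideanSpace.single i 1
    have hθ1 : ContDiff ℝ 1 θ := hθ.of_le (by exact_mod_cast le_top)
    have hkS : ∀ k x, (vk k x, fk k x) ∈ S := fun k x => by
      refine Metric.mem_cthickening_of_dist_le _ (v x, f x) _ _ (Or.inl ⟨x, rfl⟩) ?_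
      rw [Prod.dist_eq]
      exact max_le (hvd k x) (hfd k x)
    have hvs1 : ∀ k, ContDiff ℝ 1 (vk k) := fun k => (hvs k).of_le (by exact_mod_cast le_top)
    have hfs1 : ∀ k, ContDiff ℝ 1 (fk k) := fun k => (hfs k).of_le (by exact_mod_cast le_top)
    have hck : ∀ k, ContDiff ℝ 1 fun x => Φ (vk k x, fk k x) := fun k => by
      refine contDiff_iff_contDiffAt.2 fun x => ?_
      exact (hΦ.contDiffAt (hU.mem_nhds (hδU (hkS k x)))).comp x
        ((hvs1 k).prodMk (hfs1 k)).contDiffAt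
    have hgk : ∀ k x, fderiv ℝ (fun x => Φ (vk k x, fk k x)) x e
        = fderiv ℝ Φ (vk k x, fk k x) (1, 0) * gradient (vk k) x i
          + fderiv ℝ Φ (vk k x, fk k x) (0, 1) * gradient (fk k) x i := fun k x => by
      rw [← gradient_apply, gradient_comp_pair (hΦd _ (hδU (hkS k x)))
        ((hvs1 k).differentiable (by norm_num) x) ((hfs1 k).differentiable (by norm_num) x)]
      simp
    have hparts : ∀ k, ∫ x, Φ (vk k x, fk k x) * fderiv ℝ θ x e
        = -∫ x, fderiv ℝ (fun x => Φ (vk k x, fk k x)) x e * θ x := fun k =>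
      integral_mul_fderiv_of_contDiff (hck k) hθ1 hθs e
    have cθ : Continuous fun x => fderiv ℝ θ x e :=
      (hθ1.continuous_fderiv (by norm_num)).clm_apply continuous_const
    have htend : ∀ x, Tendsto (fun k => (vk k x, fk k x)) atTop (𝓝 (v x, f x)) := fun x =>
      (hvl x).prodMk_nhds (hfl x)
    have lim1 : Tendsto (fun k => ∫ x, Φ (vk k x, fk k x) * fderiv ℝ θ x e) atTop
        (𝓝 (∫ x, Φ (v x, f x) * fderiv ℝ θ x e)) := by
      refine tendsto_integral_of_dominated_convergence (fun x => B₀ * ‖fderiv ℝ θ x e‖)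
        (fun k => ((hck k).continuous.mul cθ).aestronglyMeasurable) ?_ (fun k => ?_) ?_
      · exact (cθ.norm.integrable_of_hasCompactSupport
          (hθs.fderiv_apply (𝕜 := ℝ) e).norm).const_mul B₀
      · refine Eventually.of_forall fun x => ?_
        rw [norm_mul]
        exact mul_le_mul_of_nonneg_right (hB₀ _ (hkS k x)) (norm_nonneg _)
      · refine Eventually.of_forall fun x => Tendsto.mul_const _ ?_
        exact (hΦ.continuousOn.continuousAt (hU.mem_nhds (hvf x))).tendsto.comp (htend x)
    have lim2 : Tendsto (fun k => ∫ x, fderiv ℝ (fun x => Φ (vk k x, fk k x)) x e * θ x) atTop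
        (𝓝 (∫ x, (fderiv ℝ Φ (v x, f x) (1, 0) • Gv x
          + fderiv ℝ Φ (v x, f x) (0, 1) • Gf x) i * θ x)) := by
      refine tendsto_integral_of_dominated_convergence
        (fun x => |θ x| * (B₁ * H₁ x + B₂ * H₂ x)) (fun k => ?_) ?_ (fun k => ?_) ?_
      · exact ((((hck k).continuous_fderiv (by norm_num)).clm_apply continuous_const).mul
          hθ1.continuous).aestronglyMeasurable
      · have l : LocallyIntegrable (fun x => B₁ * H₁ x + B₂ * H₂ x) :=
          ((hH₁.const_mul B₁).add (hH₂.const_mul B₂)).locallyIntegrable (one_le_ofReal hp)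
        exact l.integrable_smul_left_of_hasCompactSupport hθ1.continuous.abs hθs.norm
      · filter_upwards [hva, hfa] with x hx1 hx2
        rw [norm_mul, hgk, mul_comm, Real.norm_eq_abs (θ x)]
        refine mul_le_mul_of_nonneg_left ?_ (abs_nonneg _)
        refine (norm_add_le _ _).trans (add_le_add ?_ ?_)
        · rw [norm_mul]
          exact mul_le_mul (hB₁ _ (hkS k x)) ((PiLp.norm_apply_le _ i).trans (hx1.2 k))
            (norm_nonneg _) ((norm_nonneg _).trans (hB₁ _ (hkS k x)))
        · rw [norm_mul]
          exact mul_le_mul (hB₂ _ (hkS k x)) ((PiLp.norm_apply_le _ i).trans (hx2.2 k))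
            (norm_nonneg _) ((norm_nonneg _).trans (hB₂ _ (hkS k x)))
      · filter_upwards [hva, hfa] with x hx1 hx2
        refine Tendsto.mul_const _ ?_
        simp only [hgk, PiLp.add_apply, PiLp.smul_apply, smul_eq_mul]
        have t1 : ∀ w : ℝ × ℝ, Tendsto (fun k => fderiv ℝ Φ (vk k x, fk k x) w) atTop
            (𝓝 (fderiv ℝ Φ (v x, f x) w)) := fun w =>
          ((hdcw w).continuousAt (hU.mem_nhds (hvf x))).tendsto.comp (htend x)
        have t2 : ∀ {g : ℕ → E n} {y : E n}, Tendsto g atTop (𝓝 y) →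
            Tendsto (fun k => g k i) atTop (𝓝 (y i)) := fun h =>
          ((EuclideanSpace.proj i : E n →L[ℝ] ℝ).continuous.tendsto _).comp h
        exact ((t1 _).mul (t2 hx1.1)).add ((t1 _).mul (t2 hx2.1))
    refine tendsto_nhds_unique lim1 ?_
    simp only [hparts]
    exact lim2.neg

end Chain

/-! ### Densities -/

section Density

variable {n : ℕ} {p C : ℝ} {Ω K : Set (E n)} {H : E n → E n → ℝ}

/-- The properties of the family of norms `H(x, ·)` on which the theory depends. -/
structure IsDensity (p C : ℝ) (Ω : Set (E n)) (H : E n → E n → ℝ) : Prop where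
  quasiSymm : ∀ᵐ x ∂(volume.restrict Ω), IsQuasiSymm C (fun ξ => 1 / p * H x ξ ^ p)
  hom : ∀ᵐ x ∂(volume.restrict Ω), ∀ (c : ℝ) (ξ : E n), H x (c • ξ) ^ p = |c| ^ p * H x ξ ^ p
  nonneg : ∀ᵐ x ∂(volume.restrict Ω), ∀ ξ : E n, 0 ≤ H x ξ ^ p
  aemeasurable : ∀ G : E n → E n, AEMeasurable G (volume.restrict Ω) →
    AEMeasurable (fun x => H x (G x) ^ p) (volume.restrict Ω)
  bound : ∀ K ⊆ Ω, IsCompact K → ∃ c : ℝ, 0 ≤ c ∧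
    ∀ᵐ x ∂(volume.restrict K), ∀ ξ : E n, H x ξ ^ p ≤ c * ‖ξ‖ ^ p

theorem exists_isSubdom_ball (hΩ : IsOpen Ω) {x : E n} (hx : x ∈ Ω) :
    ∃ r > 0, IsSubdom (Metric.ball x r) Ω := by
  obtain ⟨r, hr, h⟩ := Metric.nhds_basis_closedBall.mem_iff.1 (hΩ.mem_nhds hx)
  refine ⟨r, hr, ⟨Metric.isOpen_ball, ⟨x, Metric.mem_ball_self hr⟩,
    (convex_ball x r).isPreconnected⟩, ?_, Metric.closure_ball_subset_closedBall.trans h⟩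
  exact (isCompact_closedBall x r).of_isClosed_subset isClosed_closure
    Metric.closure_ball_subset_closedBall

/-- Small balls around points of Ω are admissible subdomains, and a locally null set is null. -/
theorem ae_of_forall_isSubdom (hΩ : IsOpen Ω) {P : E n → Prop}
    (h : ∀ ω, IsSubdom ω Ω → ∀ᵐ x ∂(volume.restrict ω), P x) :
    ∀ᵐ x ∂(volume.restrict Ω), P x := by
  rw [ae_restrict_iff' hΩ.measurableSet, ae_iff]
  refine measure_null_of_locally_null _ fun x hx => ?_
  have hxΩ : x ∈ Ω := by
    by_contra h'; exact hx fun h => absurd h h'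
  obtain ⟨r, hr, hB⟩ := exists_isSubdom_ball hΩ hxΩ
  have h1 := h _ hB
  rw [ae_restrict_iff' measurableSet_ball, ae_iff] at h1
  refine ⟨_, inter_mem_nhdsWithin _ (Metric.ball_mem_nhds x hr), measure_mono_null ?_ h1⟩
  rintro y ⟨hy, hyB⟩
  simp only [mem_ofPred_eq, Classical.not_imp] at hy ⊢
  exact ⟨hyB, hy.2⟩

theorem MemMorreyLoc.locallyIntegrableOn {q : ℝ} (hΩ : IsOpen Ω) {V : E n → ℝ}
    (h : MemMorreyLoc p q Ω V) : LocallyIntegrableOn V Ω := by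
  intro x hx
  obtain ⟨r, hr, hB⟩ := exists_isSubdom_ball hΩ hx
  have := (h _ hB).1 x (Metric.mem_ball_self hr)
  rw [(Metric.isOpen_ball).nhdsWithin_eq (Metric.mem_ball_self hr)] at this
  exact this.filter_mono nhdsWithin_le_nhds

theorem exists_ae_bound_of_isCompact (hΩ : IsOpen Ω) {f : E n → E n → ℝ}
    (h : ∀ ω, IsSubdom ω Ω → ∃ c : ℝ, ∀ᵐ x ∂(volume.restrict ω), ∀ ξ : E n, f x ξ ≤ c * ‖ξ‖ ^ p)
    (hKΩ : K ⊆ Ω) (hK : IsCompact K) :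
    ∃ c : ℝ, 0 ≤ c ∧ ∀ᵐ x ∂(volume.restrict K), ∀ ξ : E n, f x ξ ≤ c * ‖ξ‖ ^ p := by
  have mono : ∀ {s : Set (E n)} {c c' : ℝ}, c ≤ c' →
      (∀ᵐ x ∂(volume.restrict s), ∀ ξ : E n, f x ξ ≤ c * ‖ξ‖ ^ p) →
      ∀ᵐ x ∂(volume.restrict s), ∀ ξ : E n, f x ξ ≤ c' * ‖ξ‖ ^ p := by
    intro s c c' hcc h
    filter_upwards [h] with x hx ξ
    exact (hx ξ).trans (mul_le_mul_of_nonneg_right hcc (Real.rpow_nonneg (norm_nonneg _) _))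
  refine hK.induction_on (p := fun s => ∃ c : ℝ, 0 ≤ c ∧
    ∀ᵐ x ∂(volume.restrict s), ∀ ξ : E n, f x ξ ≤ c * ‖ξ‖ ^ p) ⟨0, le_rfl, by simp⟩ ?_ ?_ ?_
  · rintro s t hst ⟨c, hc, h⟩
    exact ⟨c, hc, ae_restrict_of_ae_restrict_of_subset hst h⟩
  · rintro s t ⟨c, hc, h⟩ ⟨c', hc', h'⟩
    refine ⟨max c c', hc.trans (le_max_left _ _), ?_⟩
    rw [ae_restrict_union_iff]
    exact ⟨mono (le_max_left _ _) h, mono (le_max_right _ _) h'⟩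
  · intro x hx
    obtain ⟨r, hr, hB⟩ := exists_isSubdom_ball hΩ (hKΩ hx)
    obtain ⟨c, hc⟩ := h _ hB
    exact ⟨_, mem_nhdsWithin_of_mem_nhds (Metric.ball_mem_nhds x hr), max c 0, le_max_right _ _,
      mono (le_max_left _ _) hc⟩

theorem sNorm_le {s c : ℝ} (hs : 1 < s) {a : Fin n → ℝ} (ha : ∀ i, 0 < a i ∧ a i ≤ c)
    (ξ : E n) : sNorm s a ξ ≤ (n * c) ^ (1 / s) * ‖ξ‖ := by
  have h0 : ∀ i, 0 ≤ a i * |ξ i| ^ s := fun i =>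
    mul_nonneg (ha i).1.le (Real.rpow_nonneg (abs_nonneg _) _)
  have h1 : ∑ i, a i * |ξ i| ^ s ≤ n * c * ‖ξ‖ ^ s := by
    calc ∑ i, a i * |ξ i| ^ s ≤ ∑ _i : Fin n, c * ‖ξ‖ ^ s := by
          refine Finset.sum_le_sum fun i _ => ?_
          refine mul_le_mul (ha i).2 ?_ (Real.rpow_nonneg (abs_nonneg _) _)
            ((ha i).1.le.trans (ha i).2)
          exact Real.rpow_le_rpow (abs_nonneg _) (PiLp.norm_apply_le ξ i) (by linarith)
      _ = _ := by simp; ring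
  rcases Nat.eq_zero_or_pos n with hn | hn
  · subst hn
    simp [sNorm, Real.zero_rpow (by positivity : s⁻¹ ≠ 0)]
  have hc : 0 ≤ c := (ha ⟨0, hn⟩).1.le.trans (ha ⟨0, hn⟩).2
  calc sNorm s a ξ ≤ (n * c * ‖ξ‖ ^ s) ^ (1 / s) :=
        Real.rpow_le_rpow (Finset.sum_nonneg fun i _ => h0 i) h1 (by positivity)
    _ = _ := by
        rw [Real.mul_rpow (by positivity) (Real.rpow_nonneg (norm_nonneg _) _),
          ← Real.rpow_mul (norm_nonneg _), mul_one_div_cancel (by linarith), Real.rpow_one]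

theorem exists_isDensity_mixedNorm {p s : ℝ} (hp : 1 < p) (hs : 1 < s) :
    ∃ C, 0 ≤ C ∧ ∀ (n : ℕ) (Ω : Set (E n)) (a : E n → Fin n → ℝ)
      (A : E n → Matrix (Fin n) (Fin n) ℝ), IsOpen Ω → IsWeight Ω a → IsEllipticMatrix Ω A →
        IsDensity p C Ω (mixedNorm p s a A) := by
  obtain ⟨C, hC, hqs⟩ := exists_isQuasiSymm_mixedNorm hp hs
  refine ⟨C, hC, fun n Ω a A hΩ ha hA => ?_⟩
  have hapos : ∀ᵐ x ∂(volume.restrict Ω), ∀ i, 0 < a x i := by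
    refine ae_of_forall_isSubdom hΩ fun ω hω => ?_
    obtain ⟨c, _, hc, -, h⟩ := ha.2 ω hω
    filter_upwards [h] with x hx i using hc.trans_le (hx i).1
  have hApos : ∀ᵐ x ∂(volume.restrict Ω), ∀ ξ : E n,
      0 ≤ ((A x).mulVec (fun i => ξ i)) ⬝ᵥ (fun i => ξ i) := by
    refine ae_of_forall_isSubdom hΩ fun ω hω => ?_
    obtain ⟨θ, _, hθ, -, h⟩ := hA.2.2 ω hω
    filter_upwards [h] with x hx ξ
    rcases eq_or_ne ξ 0 with rfl | hξ
    · simp [dotProduct]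
    -- `Real.sqrt` is 0 at negative numbers, so nonnegativity of the quadratic form is not
    -- automatic. The lower ellipticity bound makes the root strictly positive, which excludes
    -- negative values.
    · have h1 : 0 < matNorm (A x) ξ :=
        lt_of_lt_of_le (mul_pos hθ (norm_pos_iff.2 hξ)) (hx ξ).1
      exact (Real.sqrt_pos.1 h1).le
  have hPSD : ∀ᵐ x ∂(volume.restrict Ω), (A x).PosSemidef := by
    filter_upwards [hApos, hA.2.1] with x hx hsym
    refine Matrix.PosSemidef.of_dotProduct_mulVec_nonneg ?_ fun v => ?_
    · rw [Matrix.IsHermitian, Matrix.conjTranspose_eq_transpose_of_trivial]; exact hsym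
    · have := hx (WithLp.toLp 2 v)
      rw [dotProduct_comm] at this
      simpa using this
  refine ⟨?_, ?_, ?_, fun G hG => ?_, fun K hKΩ hK => ?_⟩
  · filter_upwards [hapos, hPSD] with x h1 h2 using hqs n a A x h1 h2
  · filter_upwards [hapos] with x h1 c ξ using mixedNorm_smul hp hs a A h1 c ξ
  · filter_upwards [hapos] with x h1 ξ
    rw [mixedNorm_rpow hp a A h1]
    have h2 : 0 ≤ sNorm s (a x) ξ := Real.rpow_nonneg (Finset.sum_nonneg fun i _ =>
      mul_nonneg (h1 i).le (Real.rpow_nonneg (abs_nonneg _) _)) _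
    have h3 : 0 ≤ matNorm (A x) ξ := Real.sqrt_nonneg _
    positivity
  · have hGi : ∀ i, AEMeasurable (fun x => G x i) (volume.restrict Ω) := fun i =>
      (EuclideanSpace.proj i : E n →L[ℝ] ℝ).continuous.measurable.comp_aemeasurable hG
    have h1 : AEMeasurable (fun x => sNorm s (a x) (G x)) (volume.restrict Ω) := by
      refine AEMeasurable.pow_const ?_ _
      refine Finset.aemeasurable_fun_sum _ fun i _ => (ha.1 i).mul ?_
      exact (continuous_abs.measurable.comp_aemeasurable (hGi i)).pow_const _
    have h2 : AEMeasurable (fun x => matNorm (A x) (G x)) (volume.restrict Ω) := by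
      refine Real.continuous_sqrt.measurable.comp_aemeasurable ?_
      simp only [dotProduct, Matrix.mulVec]
      refine Finset.aemeasurable_fun_sum _ fun i _ => AEMeasurable.mul ?_ (hGi i)
      exact Finset.aemeasurable_fun_sum _ fun j _ => (hA.1 i j).mul (hGi j)
    exact (((h1.pow_const _).add (h2.pow_const _)).pow_const _).pow_const _
  · refine exists_ae_bound_of_isCompact hΩ (f := fun x ξ => mixedNorm p s a A x ξ ^ p)
      (fun ω hω => ?_) hKΩ hK
    obtain ⟨c, C', hc, -, h1⟩ := ha.2 ω hω
    obtain ⟨_, θ, -, hθ, h2⟩ := hA.2.2 ω hω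
    refine ⟨((n * C') ^ (1 / s)) ^ p + θ ^ p, ?_⟩
    filter_upwards [h1, h2] with x hx1 hx2 ξ
    have hx1' : ∀ i, 0 < a x i ∧ a x i ≤ C' := fun i => ⟨hc.trans_le (hx1 i).1, (hx1 i).2⟩
    have h3 : 0 ≤ sNorm s (a x) ξ := Real.rpow_nonneg (Finset.sum_nonneg fun i _ =>
      mul_nonneg (hx1' i).1.le (Real.rpow_nonneg (abs_nonneg _) _)) _
    have h4 : 0 ≤ matNorm (A x) ξ := Real.sqrt_nonneg _
    rw [mixedNorm_rpow hp a A fun i => (hx1' i).1, add_mul]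
    have hb : 0 ≤ (n * C' : ℝ) ^ (1 / s) := by
      rcases Nat.eq_zero_or_pos n with hn | hn
      · subst hn; simp [Real.zero_rpow (by positivity : s⁻¹ ≠ 0)]
      · have := (hx1' ⟨0, hn⟩).1.le.trans (hx1' ⟨0, hn⟩).2
        positivity
    refine add_le_add ?_ ?_
    · rw [← Real.mul_rpow hb (norm_nonneg _)]
      exact Real.rpow_le_rpow h3 (sNorm_le hs hx1' ξ) (by linarith)
    · rw [← Real.mul_rpow hθ.le (norm_nonneg _)]
      exact Real.rpow_le_rpow h4 (hx2 ξ).2 (by linarith)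

end Density

/-! ### The equation -/

section Equation

variable {n : ℕ} {p C : ℝ} {Ω K : Set (E n)} {H : E n → E n → ℝ}

/-- `F(x, ξ) = H(x, ξ)^p / p`. -/
def dens (p : ℝ) (H : E n → E n → ℝ) (x ξ : E n) : ℝ := 1 / p * H x ξ ^ p

theorem inner_flux (x ξ η : E n) :
    inner ℝ (flux p H x ξ) η = fderiv ℝ (dens p H x) ξ η := inner_gradient_left

theorem IsDensity.aemeasurable_dens (hH : IsDensity p C Ω H) {G : E n → E n}
    (hG : AEMeasurable G (volume.restrict Ω)) :
    AEMeasurable (fun x => dens p H x (G x)) (volume.restrict Ω) :=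
  (hH.aemeasurable G hG).const_mul _

/-- The derivative is the a.e. limit of difference quotients, each of which is measurable since F(x,
·) composed with a measurable field is. -/
theorem IsDensity.aemeasurable_fderiv (hH : IsDensity p C Ω H) {G Y : E n → E n}
    (hG : AEMeasurable G (volume.restrict Ω)) (hY : AEMeasurable Y (volume.restrict Ω)) :
    AEMeasurable (fun x => fderiv ℝ (dens p H x) (G x) (Y x)) (volume.restrict Ω) := by
  refine aemeasurable_of_tendsto_metrizable_ae atTop
    (f := fun (k : ℕ) x => ((k : ℝ) + 1) • (dens p H x (G x + ((k : ℝ) + 1)⁻¹ • Y x)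
      - dens p H x (G x))) (fun k => ?_) ?_
  · exact ((hH.aemeasurable_dens (hG.add (hY.const_smul ((k : ℝ) + 1)⁻¹))).sub
      (hH.aemeasurable_dens hG)).const_smul ((k : ℝ) + 1)
  · filter_upwards [hH.quasiSymm] with x hx
    refine HasFDerivAt.lim (hx.diff (G x)).hasFDerivAt (Y x) ?_
    refine tendsto_norm_atTop_atTop.comp ?_
    exact tendsto_atTop_add_const_right _ _ tendsto_natCast_atTop_atTop

/-- By convexity and F ≥ 0, F'(X)Y ≤ F(X + Y) - F(X) ≤ F(X + Y); replacing Y by -Y bounds the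
absolute value. The majorant (‖X‖ + ‖Y‖)^p is integrable for X and Y in L^p. -/
theorem IsDensity.exists_bound (hH : IsDensity p C Ω H) (hp : 1 < p) (hKΩ : K ⊆ Ω)
    (hK : IsCompact K) : ∃ c : ℝ, 0 ≤ c ∧ ∀ᵐ x, x ∈ K → ∀ X Y : E n,
      0 ≤ dens p H x X ∧ dens p H x X ≤ c * ‖X‖ ^ p ∧
      |fderiv ℝ (dens p H x) X Y| ≤ c * (‖X‖ + ‖Y‖) ^ p := by
  obtain ⟨c, hc, h⟩ := hH.bound K hKΩ hK
  refine ⟨1 / p * c, by positivity, ?_⟩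
  rw [ae_restrict_iff' hK.measurableSet] at h
  have h1 := ae_restrict_of_ae_restrict_of_subset hKΩ (hH.quasiSymm.and hH.nonneg)
  rw [ae_restrict_iff' hK.measurableSet] at h1
  filter_upwards [h, h1] with x hx hx1 hxK X Y
  obtain ⟨hq, hn⟩ := hx1 hxK
  have hb : ∀ X, dens p H x X ≤ 1 / p * c * ‖X‖ ^ p := fun X => by
    rw [dens, mul_assoc]; exact mul_le_mul_of_nonneg_left (hx hxK X) (by positivity)
  have hnn : ∀ X, 0 ≤ dens p H x X := fun X => mul_nonneg (by positivity) (hn X)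
  have key : ∀ Y, fderiv ℝ (dens p H x) X Y ≤ 1 / p * c * (‖X‖ + ‖Y‖) ^ p := fun Y => by
    have h2 : 0 ≤ dens p H x (X + Y) - dens p H x X - fderiv ℝ (dens p H x) X (X + Y - X) :=
      hq.nonneg X (X + Y)
    rw [add_sub_cancel_left] at h2
    have h3 := hb (X + Y)
    have h4 : ‖X + Y‖ ^ p ≤ (‖X‖ + ‖Y‖) ^ p :=
      Real.rpow_le_rpow (norm_nonneg _) (norm_add_le _ _) (by linarith)
    have h5 := mul_le_mul_of_nonneg_left h4 (by positivity : 0 ≤ 1 / p * c)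
    linarith [hnn X]
  refine ⟨hnn X, hb X, abs_le.2 ⟨?_, key Y⟩⟩
  have := key (-Y)
  rw [map_neg, norm_neg] at this
  linarith

theorem MemW1pLoc.hasWeakGrad_weakGrad {u : E n → ℝ} (hΩ : IsOpen Ω) (hu : MemW1pLoc p Ω u) :
    HasWeakGrad Ω u (weakGrad Ω u) ∧
      ∀ K ⊆ Ω, IsCompact K → MemLp (weakGrad Ω u) (ENNReal.ofReal p) (volume.restrict K) := by
  obtain ⟨-, G, hG, hGp⟩ := hu
  have hex : ∃ G, HasWeakGrad Ω u G := ⟨G, hG⟩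
  refine ⟨by rw [weakGrad, dif_pos hex]; exact hex.choose_spec, fun K hK hKc => ?_⟩
  refine (memLp_congr_ae ?_).2 (hGp K hK hKc)
  exact ae_restrict_of_ae_restrict_of_subset hK (hG.weakGrad_ae_eq hΩ)

theorem MemLp.integrableOn_add_rpow {L : Set (E n)} {f : E n → E n} {h : E n → ℝ} (hp : 1 < p)
    (hf : MemLp f (ENNReal.ofReal p) (volume.restrict L))
    (hh : MemLp h (ENNReal.ofReal p) (volume.restrict L)) :
    IntegrableOn (fun x => (‖f x‖ + ‖h x‖) ^ p) L := by
  have hp0 : 0 < p := by linarith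
  have := (hf.norm.add hh.norm).integrable_norm_rpow (by simpa using hp0) ENNReal.ofReal_ne_top
  rw [ENNReal.toReal_ofReal hp0.le] at this
  refine this.congr (Eventually.of_forall fun x => ?_)
  simp only [Pi.add_apply]
  rw [Real.norm_of_nonneg (by positivity)]

theorem aemeasurable_of_locallyIntegrableOn {G : E n → E n}
    (hG : LocallyIntegrableOn G Ω) : AEMeasurable G (volume.restrict Ω) :=
  (hG.aestronglyMeasurable).aemeasurable

theorem continuousOn_rpow_mul {u : E n → ℝ} (hu : ContinuousOn u Ω) (hpos : ∀ x ∈ Ω, 0 < u x)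
    (r : ℝ) : ContinuousOn (fun x => |u x| ^ r * u x) Ω :=
  (hu.abs.rpow_const fun x hx => Or.inl (abs_pos.2 (hpos x hx).ne').ne').mul hu

/-- Compactly supported continuous Sobolev functions are admissible in the weak formulation. -/
theorem IsSolution.integral_isSob_eq_zero (hp : 1 < p) (hΩ : IsOpen Ω) (hH : IsDensity p C Ω H)
    {V u : E n → ℝ} (hV : LocallyIntegrableOn V Ω) (huc : ContinuousOn u Ω)
    (hpos : ∀ x ∈ Ω, 0 < u x) (hu : IsSolution p Ω H V u)
    {w : E n → ℝ} {G : E n → E n} (hK : IsCompact K) (hKΩ : K ⊆ Ω) (hw : IsSob p K w G) :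
    IntegrableOn (fun x => fderiv ℝ (dens p H x) (weakGrad Ω u x) (G x)) Ω ∧
    (∫ x in Ω, fderiv ℝ (dens p H x) (weakGrad Ω u x) (G x)) +
      ∫ x in Ω, V x * |u x| ^ (p - 2) * u x * w x = 0 := by
  -- The equation is tested with the mollifications of w and passes to the limit. Their gradients
  -- have a common L^p majorant D, and they are uniformly bounded, which serves the term with V.
  obtain ⟨L, Fk, D, hL, hLΩ, hKL, hFs, hFt, hFd, hFl, hD, hae⟩ :=
    hw.exists_approx hp hK hΩ hKΩ one_pos
  obtain ⟨hug, hup⟩ := hu.1.hasWeakGrad_weakGrad hΩ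
  obtain ⟨c, hc, hb⟩ := hH.exists_bound hp hLΩ hL
  have mu : AEMeasurable (weakGrad Ω u) (volume.restrict Ω) :=
    aemeasurable_of_locallyIntegrableOn hug.2.1
  have hF1 : ∀ k, ContDiff ℝ 1 (Fk k) := fun k => (hFs k).of_le (by exact_mod_cast le_top)
  have hbound : Integrable (L.indicator fun x => c * (‖weakGrad Ω u x‖ + ‖D x‖) ^ p)
      (volume.restrict Ω) := by
    refine Integrable.integrableOn ?_
    rw [integrable_indicator_iff hL.measurableSet]
    exact (MemLp.integrableOn_add_rpow hp (hup L hLΩ hL) (hD.restrict L)).const_mul c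
  have hdom : ∀ᵐ x, ∀ Y : E n, ‖Y‖ ≤ D x → (x ∉ L → Y = 0) →
      ‖fderiv ℝ (dens p H x) (weakGrad Ω u x) Y‖
        ≤ L.indicator (fun x => c * (‖weakGrad Ω u x‖ + ‖D x‖) ^ p) x := by
    filter_upwards [hb] with x hx Y hY hY0
    by_cases hxL : x ∈ L
    · rw [indicator_of_mem hxL]
      refine ((hx hxL _ Y).2.2).trans (mul_le_mul_of_nonneg_left ?_ hc)
      refine Real.rpow_le_rpow (by positivity) ?_ (by linarith)
      gcongr
      exact hY.trans (Real.le_norm_self _)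
    · rw [indicator_of_notMem hxL, hY0 hxL, map_zero, norm_zero]
  have hGD : ∀ᵐ x, ‖G x‖ ≤ D x := by
    filter_upwards [hae] with x hx
    exact le_of_tendsto hx.1.norm (Eventually.of_forall hx.2)
  have mG : AEMeasurable G (volume.restrict Ω) := (hw.memLp.1.aemeasurable).restrict
  refine ⟨?_, ?_⟩
  · refine hbound.mono' (hH.aemeasurable_fderiv mu mG).aestronglyMeasurable
      (ae_restrict_of_ae ?_)
    filter_upwards [hdom, hGD] with x h1 h2
    exact h1 _ h2 fun hx => hw.grad_eq_zero x fun hx' => hx (hKL hx')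
  have htest : ∀ k, IsTest Ω (Fk k) := fun k =>
    ⟨hFs k, hL.of_isClosed_subset (isClosed_tsupport _) (hFt k), (hFt k).trans hLΩ⟩
  have heq := fun k => hu.2 (Fk k) (htest k)
  simp only [inner_flux] at heq
  have lim1 : Tendsto (fun k => ∫ x in Ω, fderiv ℝ (dens p H x) (weakGrad Ω u x)
      (gradient (Fk k) x)) atTop
      (𝓝 (∫ x in Ω, fderiv ℝ (dens p H x) (weakGrad Ω u x) (G x))) := by
    refine tendsto_integral_of_dominated_convergence _ (fun k => ?_) hbound (fun k => ?_) ?_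
    · exact (hH.aemeasurable_fderiv mu
        (continuous_gradient (hF1 k)).measurable.aemeasurable).aestronglyMeasurable
    · refine ae_restrict_of_ae ?_
      filter_upwards [hdom, hae] with x h1 h2
      exact h1 _ (h2.2 k) fun hx =>
        gradient_eq_zero_of_notMem_tsupport fun hx' => hx (hFt k hx')
    · refine ae_restrict_of_ae ?_
      filter_upwards [hae] with x hx
      exact ((fderiv ℝ (dens p H x) (weakGrad Ω u x)).continuous.tendsto _).comp hx.1
  have mV : AEStronglyMeasurable V (volume.restrict Ω) :=
    hV.aestronglyMeasurable
  have cu := continuousOn_rpow_mul huc hpos (p - 2)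
  have lim2 : Tendsto (fun k => ∫ x in Ω, V x * |u x| ^ (p - 2) * u x * Fk k x) atTop
      (𝓝 (∫ x in Ω, V x * |u x| ^ (p - 2) * u x * w x)) := by
    have e : ∀ x t, V x * |u x| ^ (p - 2) * u x * t = V x * (|u x| ^ (p - 2) * u x) * t :=
      fun x t => by ring
    simp only [e]
    refine tendsto_integral_of_dominated_convergence
      (L.indicator fun x => ‖V x * (|u x| ^ (p - 2) * u x)‖ * (|w x| + 1))
      (fun k => ?_) ?_ (fun k => ?_) ?_
    · exact (mV.mul (cu.aestronglyMeasurable hΩ.measurableSet)).mul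
        (hF1 k).continuous.aestronglyMeasurable
    · refine Integrable.integrableOn ?_
      rw [integrable_indicator_iff hL.measurableSet]
      have h1 : IntegrableOn V L := hV.integrableOn_compact_subset hLΩ hL
      have h2 := (h1.mul_continuousOn (cu.mono hLΩ) hL).norm
      exact IntegrableOn.mul_continuousOn h2 (hw.cont.abs.add continuous_const).continuousOn hL
    · refine Eventually.of_forall fun x => ?_
      by_cases hxL : x ∈ L
      · rw [indicator_of_mem hxL, norm_mul]
        refine mul_le_mul_of_nonneg_left ?_ (norm_nonneg _)
        have := hFd k x
        rw [Real.norm_eq_abs]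
        have h3 := abs_add_le (Fk k x - w x) (w x)
        rw [sub_add_cancel] at h3
        linarith
      · rw [indicator_of_notMem hxL,
          image_eq_zero_of_notMem_tsupport fun hx' => hxL (hFt k hx'), mul_zero, norm_zero]
    · exact Eventually.of_forall fun x => (hFl x).const_mul _
  exact tendsto_nhds_unique ((lim1.add lim2).congr heq) tendsto_const_nhds

end Equation

/-! ### The energy in terms of a positive solution -/

section Energy

variable {n : ℕ} {p C : ℝ} {Ω K : Set (E n)} {H : E n → E n → ℝ}

/-- A `C^1` function of a positive continuous `W^{1,p}_loc` function and a compactly supported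
Sobolev function. -/
theorem IsSob.comp_pos {u f : E n → ℝ} {G : E n → E n} (hp : 1 < p) (hΩ : IsOpen Ω)
    (huc : ContinuousOn u Ω) (hpos : ∀ x ∈ Ω, 0 < u x) (hu : MemW1pLoc p Ω u)
    (hK : IsCompact K) (hKΩ : K ⊆ Ω) (hf : IsSob p K f G) {Ψ : ℝ × ℝ → ℝ}
    (hΨ : ContDiffOn ℝ 1 Ψ {q | 0 < q.1}) (hΨ0 : ∀ t, Ψ (t, 0) = 0) :
    ∃ G', IsSob p K (fun x => Ψ (u x, f x)) G' ∧
      ∀ x ∈ K, G' x = fderiv ℝ Ψ (u x, f x) (1, 0) • weakGrad Ω u x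
        + fderiv ℝ Ψ (u x, f x) (0, 1) • G x := by
  obtain ⟨χ, hχ, hχ01, hχ1⟩ := exists_isTest_one_nhds hΩ hK hKΩ
  obtain ⟨hug, hup⟩ := hu.hasWeakGrad_weakGrad hΩ
  -- Here u is replaced by 1 + χ(u - 1) = (1 - χ) + χu, which equals u near K and is positive on the
  -- whole space, so that Ψ can be evaluated everywhere.
  have hv := isSob_cutoff_mul hΩ (p := p) (hug.sub_const 1) (huc.sub continuousOn_const) hup hχ
  have hU : IsOpen {q : ℝ × ℝ | -1 < q.1} := isOpen_lt continuous_const continuous_fst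
  have hΦ : ContDiffOn ℝ 1 (fun q => Ψ ((1, 0) + q)) {q : ℝ × ℝ | -1 < q.1} := by
    refine hΨ.comp (contDiff_const.add contDiff_id).contDiffOn fun q hq => ?_
    have : -1 < q.1 := hq
    show 0 < ((1, 0) + q : ℝ × ℝ).1
    simp only [Prod.fst_add]; linarith
  have hvU : ∀ x, (χ x * (u x - 1), f x) ∈ {q : ℝ × ℝ | -1 < q.1} := by
    intro x
    show -1 < χ x * (u x - 1)
    by_cases hx : x ∈ Ω
    · have h1 := hpos x hx
      obtain ⟨h2, h3⟩ := hχ01 x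
      rcases h2.eq_or_lt with h | h
      · rw [← h]; norm_num
      · nlinarith [mul_pos h h1]
    · rw [image_eq_zero_of_notMem_tsupport fun hx' => hx (hχ.2.2 hx'), zero_mul]; norm_num
  have key := hv.comp_pair hp hχ.2.1 hK hf hU hΦ hvU (by simp) (fun t _ => by
    simpa using hΨ0 (1 + t))
  have hK1 : ∀ x ∈ K, χ x = 1 := (Eventually.self_of_nhdsSet hχ1)
  have hK2 : ∀ x ∈ K, gradient χ x = 0 := fun x hx => by
    have h : χ =ᶠ[𝓝 x] fun _ => 1 := (Filter.Eventually.filter_mono (nhds_le_nhdsSet hx) hχ1)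
    rw [gradient, h.fderiv_eq]; simp
  have e : (fun x => Ψ ((1, 0) + (χ x * (u x - 1), f x))) = fun x => Ψ (u x, f x) := by
    ext x
    by_cases hx : x ∈ K
    · rw [hK1 x hx]; congr 1; ext <;> simp
    · rw [hf.eq_zero x hx, hΨ0]; simpa using hΨ0 _
  rw [e] at key
  refine ⟨_, key, fun x hx => ?_⟩
  have hq : ((1, 0) + (χ x * (u x - 1), f x) : ℝ × ℝ) = (u x, f x) := by
    rw [hK1 x hx]; ext <;> simp
  simp only [fderiv_comp_add_left, hq]
  simp only [hK1 x hx, hK2 x hx, one_smul, smul_zero, add_zero]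

/-- Regularity that makes the Picone test function |φ|^p u^(1-p) admissible. -/
theorem contDiffOn_abs_rpow_mul_rpow (hp : 1 < p) :
    ContDiffOn ℝ 1 (fun q : ℝ × ℝ => |q.2| ^ p * q.1 ^ (1 - p)) {q | 0 < q.1} := by
  intro q hq
  refine ContDiffAt.contDiffWithinAt (ContDiffAt.mul ?_ ?_)
  · have h : ContDiff ℝ 1 fun x : ℝ => ‖x‖ ^ p := contDiff_norm_rpow hp
    exact (h.comp contDiff_snd).contDiffAt
  · exact (Real.contDiffAt_rpow_const_of_ne (ne_of_gt hq)).comp q contDiff_fst.contDiffAt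

theorem fderiv_abs_rpow_mul_rpow (hp : 1 < p) {a : ℝ} (ha : 0 < a) (b s t : ℝ) :
    fderiv ℝ (fun q : ℝ × ℝ => |q.2| ^ p * q.1 ^ (1 - p)) (a, b) (s, t)
      = |b / a| ^ p * (1 - p) * s + p * (|b / a| ^ (p - 2) * (b / a)) * t := by
  have h1 : HasFDerivAt (fun q : ℝ × ℝ => |q.2| ^ p)
      ((p * |b| ^ (p - 2) * b) • ContinuousLinearMap.snd ℝ ℝ ℝ) (a, b) :=
    HasDerivAt.comp_hasFDerivAt (h₂ := fun t : ℝ => |t| ^ p) (f := Prod.snd) (a, b)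
      (hasDerivAt_abs_rpow b hp) hasFDerivAt_snd
  have h2 : HasFDerivAt (fun q : ℝ × ℝ => q.1 ^ (1 - p))
      (((1 - p) * a ^ (1 - p - 1)) • ContinuousLinearMap.fst ℝ ℝ ℝ) (a, b) :=
    HasDerivAt.comp_hasFDerivAt (h₂ := fun t : ℝ => t ^ (1 - p)) (f := Prod.fst) (a, b)
      (Real.hasDerivAt_rpow_const (Or.inl ha.ne')) hasFDerivAt_fst
  rw [HasFDerivAt.fderiv (f := fun q : ℝ × ℝ => |q.2| ^ p * q.1 ^ (1 - p)) (h1.mul h2)]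
  simp only [_root_.add_apply, _root_.smul_apply, ContinuousLinearMap.coe_fst',
    ContinuousLinearMap.coe_snd', smul_eq_mul]
  rw [abs_div, abs_of_pos ha, Real.div_rpow (abs_nonneg _) ha.le,
    Real.div_rpow (abs_nonneg _) ha.le]
  have e1 : a ^ (1 - p - 1) = (a ^ p)⁻¹ := by rw [← Real.rpow_neg ha.le]; ring_nf
  have e2 : a ^ (1 - p) = (a ^ (p - 2))⁻¹ * a⁻¹ := by
    rw [← Real.rpow_neg ha.le, ← Real.rpow_neg_one, ← Real.rpow_add ha]; ring_nf
  rw [e1, e2]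
  field_simp

/-- The density of the energy of `φ` with gradient `G` with respect to the solution `u`. -/
def energyDens (p : ℝ) (Ω : Set (E n)) (H : E n → E n → ℝ) (u φ : E n → ℝ) (G : E n → E n)
    (x : E n) : ℝ :=
  p * bregman (dens p H x) ((φ x / u x) • weakGrad Ω u x) (G x)

theorem dens_smul {x : E n} (h : ∀ (c : ℝ) (ξ : E n), H x (c • ξ) ^ p = |c| ^ p * H x ξ ^ p)
    (c : ℝ) (ξ : E n) : dens p H x (c • ξ) = |c| ^ p * dens p H x ξ := by
  rw [dens, dens, h]; ring

/-- Pointwise Picone identity: by Euler's relation and homogeneity the terms F(ψ∇u) and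
F'(ψ∇u)(ψ∇u), with ψ = φ/u, combine so that the vector to which F'(∇u) is applied is the gradient of
|φ|^p u^(1-p). -/
theorem energyDens_eq (hp : 1 < p) {x : E n} (hq : IsQuasiSymm C (dens p H x))
    (h : ∀ (c : ℝ) (ξ : E n), H x (c • ξ) ^ p = |c| ^ p * H x ξ ^ p) (u φ : E n → ℝ)
    (G : E n → E n) :
    energyDens p Ω H u φ G x = H x (G x) ^ p - fderiv ℝ (dens p H x) (weakGrad Ω u x)
      ((|φ x / u x| ^ p * (1 - p)) • weakGrad Ω u x
        + (p * (|φ x / u x| ^ (p - 2) * (φ x / u x))) • G x) := by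
  have hom := dens_smul h
  set ψ := φ x / u x
  have hF : H x (G x) ^ p = p * dens p H x (G x) := by rw [dens]; field_simp
  rw [energyDens, bregman, map_sub, fderiv_self_of_homogeneous hq.diff hp hom,
    fderiv_smul_of_homogeneous hq.diff hp hom, hom, map_add, map_smul, map_smul,
    fderiv_self_of_homogeneous hq.diff hp hom, hF]
  simp only [smul_eq_mul]
  ring

theorem IsSob.integrableOn_potential (hp : 1 < p) {φ V : E n → ℝ} {G : E n → E n}
    (hV : LocallyIntegrableOn V Ω) (hK : IsCompact K) (hKΩ : K ⊆ Ω) (hφ : IsSob p K φ G) :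
    Integrable (fun x => V x * |φ x| ^ p) := by
  have hp0 : 0 < p := by linarith
  have hc : Continuous fun x => |φ x| ^ p := hφ.cont.abs.rpow_const fun _ => Or.inr hp0.le
  have hz : ∀ x ∉ K, |φ x| ^ p = 0 := fun x hx => by
    rw [hφ.eq_zero x hx, abs_zero, Real.zero_rpow hp0.ne']
  have := integrable_mul_of_locallyIntegrableOn hc (HasCompactSupport.intro hK hz)
    ((closure_minimal (fun x hx => by by_contra h; exact hx (hz x h)) hK.isClosed).trans hKΩ) hV
  simpa only [mul_comm] using this

theorem IsDensity.integrableOn_rpow (hp : 1 < p) (hH : IsDensity p C Ω H) {φ : E n → ℝ}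
    {G : E n → E n} (hK : IsCompact K) (hKΩ : K ⊆ Ω) (hφ : IsSob p K φ G) :
    IntegrableOn (fun x => H x (G x) ^ p) Ω := by
  have hp0 : 0 < p := by linarith
  obtain ⟨c, hc, hb⟩ := hH.exists_bound hp hKΩ hK
  have h1 := hφ.memLp.integrable_norm_rpow (by simpa using hp0) ENNReal.ofReal_ne_top
  rw [ENNReal.toReal_ofReal hp0.le] at h1
  refine (h1.const_mul (p * c)).integrableOn.mono'
    (hH.aemeasurable G hφ.memLp.1.aemeasurable.restrict).aestronglyMeasurable ?_
  filter_upwards [ae_restrict_of_ae hb, hH.hom, hH.nonneg] with x hx hom hn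
  rw [Real.norm_of_nonneg (hn _)]
  have hF : H x (G x) ^ p = p * dens p H x (G x) := by rw [dens]; field_simp
  by_cases hxK : x ∈ K
  · rw [hF, mul_assoc]
    exact mul_le_mul_of_nonneg_left (hx hxK (G x) 0).2.1 hp0.le
  · rw [hφ.grad_eq_zero x hxK]
    have := hom 0 0
    rw [zero_smul, abs_zero, Real.zero_rpow hp0.ne', zero_mul] at this
    rw [this]; positivity

theorem energy_eq_add (hp : 1 < p) (hH : IsDensity p C Ω H) {V φ : E n → ℝ}
    {G : E n → E n} (hΩ : IsOpen Ω) (hV : LocallyIntegrableOn V Ω) (hK : IsCompact K)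
    (hKΩ : K ⊆ Ω) (hφ : IsSob p K φ G) :
    energy p Ω H V φ = (∫ x in Ω, H x (G x) ^ p) + ∫ x in Ω, V x * |φ x| ^ p := by
  rw [energy, ← integral_add (hH.integrableOn_rpow hp hK hKΩ hφ)
    (hφ.integrableOn_potential hp hV hK hKΩ).integrableOn]
  refine integral_congr_ae ?_
  filter_upwards [hφ.weakGrad_ae_eq hp hΩ hKΩ] with x hx
  rw [hx]

theorem energyDens_nonneg (hp : 1 < p) (hH : IsDensity p C Ω H) (u φ : E n → ℝ)
    (G : E n → E n) : ∀ᵐ x ∂(volume.restrict Ω), 0 ≤ energyDens p Ω H u φ G x := by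
  filter_upwards [hH.quasiSymm] with x hx
  exact mul_nonneg (by linarith) (hx.nonneg _ _)

/-- The energy as the integral of a nonnegative density. -/
theorem IsSolution.energy_eq (hp : 1 < p) (hΩ : IsOpen Ω) (hH : IsDensity p C Ω H)
    {V u : E n → ℝ} (hV : LocallyIntegrableOn V Ω) (huc : ContinuousOn u Ω)
    (hpos : ∀ x ∈ Ω, 0 < u x) (hu : IsSolution p Ω H V u)
    {φ : E n → ℝ} {G : E n → E n} (hK : IsCompact K) (hKΩ : K ⊆ Ω) (hφ : IsSob p K φ G) :
    IntegrableOn (energyDens p Ω H u φ G) Ω ∧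
      energy p Ω H V φ = ∫ x in Ω, energyDens p Ω H u φ G x := by
  have hp0 : 0 < p := by linarith
  -- The test function w = |φ|^p u^(1-p). The equation turns its flux integral into -∫ V |φ|^p,
  -- since u^(p-1) u^(1-p) = 1.
  obtain ⟨Gw, hw, hGw⟩ := hφ.comp_pos hp hΩ huc hpos hu.1 hK hKΩ
    (contDiffOn_abs_rpow_mul_rpow hp) (fun t => by simp [Real.zero_rpow hp0.ne'])
  obtain ⟨hi, h0⟩ := hu.integral_isSob_eq_zero hp hΩ hH hV huc hpos hK hKΩ hw
  have hiH := hH.integrableOn_rpow hp hK hKΩ hφ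
  have hae : energyDens p Ω H u φ G =ᵐ[volume.restrict Ω]
      fun x => H x (G x) ^ p - fderiv ℝ (dens p H x) (weakGrad Ω u x) (Gw x) := by
    filter_upwards [hH.quasiSymm, hH.hom, ae_restrict_mem hΩ.measurableSet] with x hq hom hxΩ
    rw [energyDens_eq hp hq hom]
    congr 2
    by_cases hx : x ∈ K
    · rw [hGw x hx, fderiv_abs_rpow_mul_rpow hp (hpos x hxΩ),
        fderiv_abs_rpow_mul_rpow hp (hpos x hxΩ)]
      simp
    · rw [hw.grad_eq_zero x hx, hφ.eq_zero x hx, hφ.grad_eq_zero x hx]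
      simp [Real.zero_rpow hp0.ne']
  refine ⟨(hiH.sub hi).congr hae.symm, ?_⟩
  rw [integral_congr_ae hae, integral_sub hiH hi, energy_eq_add hp hH hΩ hV hK hKΩ hφ]
  have e : ∫ x in Ω, V x * |u x| ^ (p - 2) * u x * (|φ x| ^ p * u x ^ (1 - p))
      = ∫ x in Ω, V x * |φ x| ^ p := by
    refine setIntegral_congr_fun hΩ.measurableSet fun x hx => ?_
    have hx0 := hpos x hx
    have : |u x| ^ (p - 2) * u x * u x ^ (1 - p) = 1 := by
      rw [abs_of_pos hx0, ← Real.rpow_add_one hx0.ne', ← Real.rpow_add hx0]; ring_nf; simp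
    calc _ = V x * |φ x| ^ p * (|u x| ^ (p - 2) * u x * u x ^ (1 - p)) := by ring
      _ = _ := by rw [this, mul_one]
  rw [e] at h0
  linarith

/-- The energy and weighted integrals of a Sobolev function are limits of those of test
functions. -/
theorem IsSob.exists_tendsto_energy (hp : 1 < p) (hΩ : IsOpen Ω) (hH : IsDensity p C Ω H)
    {V g : E n → ℝ} (hV : LocallyIntegrableOn V Ω) (hg : LocallyIntegrableOn g Ω)
    {φ : E n → ℝ} {G : E n → E n} (hK : IsCompact K) (hKΩ : K ⊆ Ω) (hφ : IsSob p K φ G) :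
    ∃ F : ℕ → E n → ℝ, (∀ k, IsTest Ω (F k)) ∧
      Tendsto (fun k => energy p Ω H V (F k)) atTop (𝓝 (energy p Ω H V φ)) ∧
      Tendsto (fun k => ∫ x in Ω, |g x| * |F k x| ^ p) atTop (𝓝 (∫ x in Ω, |g x| * |φ x| ^ p)) := by
  have hp0 : 0 < p := by linarith
  obtain ⟨L, F, D, hL, hLΩ, hKL, hFs, hFt, hFd, hFl, hD, hae⟩ :=
    hφ.exists_approx hp hK hΩ hKΩ one_pos
  have hF1 : ∀ k, ContDiff ℝ 1 (F k) := fun k => (hFs k).of_le (by exact_mod_cast le_top)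
  have htest : ∀ k, IsTest Ω (F k) := fun k =>
    ⟨hFs k, hL.of_isClosed_subset (isClosed_tsupport _) (hFt k), (hFt k).trans hLΩ⟩
  have hSob : ∀ k, IsSob p (tsupport (F k)) (F k) (gradient (F k)) := fun k =>
    isSob_of_contDiff (hF1 k) (htest k).2.1
  have hpot : ∀ {W : E n → ℝ}, LocallyIntegrableOn W Ω →
      Tendsto (fun k => ∫ x in Ω, W x * |F k x| ^ p) atTop (𝓝 (∫ x in Ω, W x * |φ x| ^ p)) := by
    intro W hW
    refine tendsto_integral_of_dominated_convergence
      (L.indicator fun x => ‖W x‖ * (|φ x| + 1) ^ p) (fun k => ?_) ?_ (fun k => ?_) ?_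
    · exact hW.aestronglyMeasurable.mul ((hF1 k).continuous.abs.rpow_const fun _ =>
        Or.inr hp0.le).aestronglyMeasurable
    · refine Integrable.integrableOn ?_
      rw [integrable_indicator_iff hL.measurableSet]
      exact IntegrableOn.mul_continuousOn (hW.integrableOn_compact_subset hLΩ hL).norm
        ((hφ.cont.abs.add continuous_const).rpow_const fun _ => Or.inr hp0.le).continuousOn hL
    · refine Eventually.of_forall fun x => ?_
      by_cases hxL : x ∈ L
      · rw [indicator_of_mem hxL, norm_mul,
          Real.norm_of_nonneg (Real.rpow_nonneg (abs_nonneg _) _)]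
        refine mul_le_mul_of_nonneg_left (Real.rpow_le_rpow (abs_nonneg _) ?_ hp0.le)
          (norm_nonneg _)
        have h3 := abs_add_le (F k x - φ x) (φ x)
        rw [sub_add_cancel] at h3
        linarith [hFd k x]
      · rw [indicator_of_notMem hxL,
          image_eq_zero_of_notMem_tsupport fun hx' => hxL (hFt k hx'), abs_zero,
          Real.zero_rpow hp0.ne', mul_zero, norm_zero]
    · refine Eventually.of_forall fun x => Tendsto.const_mul _ ?_
      exact (hFl x).abs.rpow_const (Or.inr hp0.le)
  refine ⟨F, htest, ?_, hpot hg.norm⟩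
  simp only [energy_eq_add hp hH hΩ hV hK hKΩ hφ,
    fun k => energy_eq_add hp hH hΩ hV (htest k).2.1 (htest k).2.2 (hSob k)]
  refine Tendsto.add ?_ (hpot hV)
  obtain ⟨c, hc, hb⟩ := hH.exists_bound hp hLΩ hL
  have h1 := hD.integrable_norm_rpow (by simpa using hp0) ENNReal.ofReal_ne_top
  rw [ENNReal.toReal_ofReal hp0.le] at h1
  have hF : ∀ x ξ, H x ξ ^ p = p * dens p H x ξ := fun x ξ => by rw [dens]; field_simp
  refine tendsto_integral_of_dominated_convergence (fun x => p * c * ‖D x‖ ^ p) (fun k => ?_)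
    (h1.const_mul (p * c)).integrableOn (fun k => ?_) ?_
  · exact (hH.aemeasurable _
      (continuous_gradient (hF1 k)).measurable.aemeasurable).aestronglyMeasurable
  · filter_upwards [ae_restrict_of_ae hb, ae_restrict_of_ae hae, hH.hom, hH.nonneg]
      with x hx hx1 hom hn
    rw [Real.norm_of_nonneg (hn _)]
    by_cases hxL : x ∈ L
    · rw [hF, mul_assoc]
      refine mul_le_mul_of_nonneg_left ((hx hxL _ 0).2.1.trans ?_) hp0.le
      refine mul_le_mul_of_nonneg_left (Real.rpow_le_rpow (norm_nonneg _) ?_ hp0.le) hc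
      exact (hx1.2 k).trans (Real.le_norm_self _)
    · rw [gradient_eq_zero_of_notMem_tsupport fun hx' => hxL (hFt k hx')]
      have := hom 0 0
      rw [zero_smul, abs_zero, Real.zero_rpow hp0.ne', zero_mul] at this
      rw [this]; positivity
  · filter_upwards [ae_restrict_of_ae hae, hH.quasiSymm] with x hx hq
    simp only [hF]
    exact ((hq.diff.continuous.tendsto _).comp hx.1).const_mul p

end Energy

/-! ### The capacitary inequality -/

section Truncation

variable {n : ℕ} {p C : ℝ} {Ω K : Set (E n)} {H : E n → E n → ℝ}

/-- The truncation u ρ(φ/(cu)) of φ is a C^1 function of the pair (u, φ). -/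
theorem contDiffOn_mul_comp_div {ρ : ℝ → ℝ} (hρ : ContDiff ℝ 1 ρ) {c : ℝ} (hc : 0 < c) :
    ContDiffOn ℝ 1 (fun q : ℝ × ℝ => q.1 * ρ (q.2 / (c * q.1))) {q | 0 < q.1} :=
  contDiff_fst.contDiffOn.mul (hρ.comp_contDiffOn (contDiff_snd.contDiffOn.div
    (contDiff_const.mul contDiff_fst).contDiffOn fun _ hq => (mul_pos hc hq).ne'))

theorem fderiv_mul_comp_div {ρ : ℝ → ℝ} (hρ : ContDiff ℝ 1 ρ) {c : ℝ} (hc : 0 < c) {a : ℝ}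
    (ha : 0 < a) (b s t : ℝ) :
    fderiv ℝ (fun q : ℝ × ℝ => q.1 * ρ (q.2 / (c * q.1))) (a, b) (s, t)
      = (ρ (b / a / c) - b / a / c * deriv ρ (b / a / c)) * s
        + c⁻¹ * deriv ρ (b / a / c) * t := by
  have hτ : b / (c * a) = b / a / c := by rw [div_div, mul_comm]
  have hca : c * a ≠ 0 := (mul_pos hc ha).ne'
  have hd := (((contDiffOn_mul_comp_div hρ hc).contDiffAt
    ((isOpen_lt continuous_const continuous_fst).mem_nhds ha : {q : ℝ × ℝ | 0 < q.1} ∈ 𝓝 (a, b)))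
      |>.differentiableAt one_ne_zero).hasFDerivAt
  have hl : HasDerivAt (fun r : ℝ => ((a, b) + r • (s, t) : ℝ × ℝ)) (s, t) 0 := by
    simpa using ((hasDerivAt_id (0 : ℝ)).smul_const ((s, t) : ℝ × ℝ)).const_add (a, b)
  have h1 := HasFDerivAt.comp_hasDerivAt (0 : ℝ) (f := fun r : ℝ => ((a, b) + r • (s, t) : ℝ × ℝ))
    (by simpa using hd) hl
  have hnum : HasDerivAt (fun r : ℝ => b + r * t) t 0 := by
    simpa using ((hasDerivAt_id (0 : ℝ)).mul_const t).const_add b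
  have hden : HasDerivAt (fun r : ℝ => a + r * s) s 0 := by
    simpa using ((hasDerivAt_id (0 : ℝ)).mul_const s).const_add a
  have hq := hnum.fun_div (hden.const_mul c) (by simpa using hca)
  have hr : HasDerivAt ρ (deriv ρ (b / a / c)) ((b + 0 * t) / (c * (a + 0 * s))) := by
    rw [zero_mul, zero_mul, add_zero, add_zero, hτ]
    exact (hρ.differentiable one_ne_zero _).hasDerivAt
  have h2 := hden.fun_mul (hr.comp 0 hq)
  have h3 := h1.unique (f := fun r : ℝ => (a + r * s) * ρ ((b + r * t) / (c * (a + r * s)))) h2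
  rw [h3]
  simp only [Function.comp, zero_mul, add_zero, hτ]
  field_simp
  ring

theorem isOpen_setOf_lt_abs_lt (hΩ : IsOpen Ω) {u φ : E n → ℝ} (hu : ContinuousOn u Ω)
    (hφ : Continuous φ) (c d : ℝ) : IsOpen {x ∈ Ω | c * u x < |φ x| ∧ |φ x| < d * u x} := by
  have h1 : ContinuousOn (fun x => |φ x| - c * u x) Ω :=
    hφ.abs.continuousOn.sub (continuousOn_const.mul hu)
  have h2 : ContinuousOn (fun x => d * u x - |φ x|) Ω :=
    (continuousOn_const.mul hu).sub hφ.abs.continuousOn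
  convert (h1.isOpen_inter_preimage hΩ (isOpen_Ioi (a := (0 : ℝ)))).inter
    (h2.isOpen_inter_preimage hΩ (isOpen_Ioi (a := (0 : ℝ)))) using 1
  ext x
  exact ⟨fun h => ⟨⟨h.1, sub_pos.2 h.2.1⟩, h.1, sub_pos.2 h.2.2⟩,
    fun h => ⟨h.1.1, sub_pos.1 h.1.2, sub_pos.1 h.2.2⟩⟩

/-- Truncating the quotient `φ / u` between the levels `c` and `2 c` localizes the energy. -/
theorem energyDens_cutoff_le (hp : 1 < p) {ρ : ℝ → ℝ} {M : ℝ} (hM : 1 ≤ M)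
    (hρ0 : ∀ t, |t| ≤ 1 → deriv ρ t = 0) (hρ1 : ∀ t, 2 ≤ |t| → deriv ρ t = 0)
    (hρ : ∀ t, 1 < |t| → 0 < ρ t ∧ 0 ≤ t * deriv ρ t ∧
      ∃ κ, 0 < κ ∧ κ ≤ 1 ∧ t * deriv ρ t ≤ M / κ * ρ t ∧ ρ t ^ p ≤ κ ^ (1 + C))
    {x : E n} (hq : IsQuasiSymm C (dens p H x))
    (hom : ∀ (c : ℝ) (ξ : E n), H x (c • ξ) ^ p = |c| ^ p * H x ξ ^ p) {c : ℝ} (hc : 0 < c)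
    {u φ φ' : E n → ℝ} {G G' : E n → E n} (hu : 0 < u x)
    (hφ' : φ' x = u x * ρ (φ x / u x / c))
    (hG' : G' x = (ρ (φ x / u x / c) - φ x / u x / c * deriv ρ (φ x / u x / c)) • weakGrad Ω u x
      + (c⁻¹ * deriv ρ (φ x / u x / c)) • G x) :
    c ^ p * energyDens p Ω H u φ' G' x
      ≤ {x | c * u x < |φ x| ∧ |φ x| < 2 * c * u x}.indicator
          (fun x => M ^ (1 + C) * energyDens p Ω H u φ G x) x := by
  set τ := φ x / u x / c with hτ
  have e0 : φ' x / u x = ρ τ := by rw [hφ', mul_div_cancel_left₀ _ hu.ne']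
  set X := weakGrad Ω u x with hX
  -- With Y = c⁻¹G - τX one has G' = ρ(τ)X + ρ'(τ)Y and τX + Y = c⁻¹G, the configuration of
  -- `IsQuasiSymm.bregman_cutoff_le`.
  have e1 : G' x = ρ τ • X + deriv ρ τ • (c⁻¹ • G x - τ • X) := by
    rw [hG']; module
  have habs : |τ| = |φ x| / (c * u x) := by
    rw [hτ, abs_div, abs_div, abs_of_pos hu, abs_of_pos hc, div_div, mul_comm]
  by_cases h : x ∈ {x | c * u x < |φ x| ∧ |φ x| < 2 * c * u x}
  · rw [indicator_of_mem h]
    have h1 : 1 < |τ| := by rw [habs, one_lt_div (mul_pos hc hu)]; exact h.1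
    obtain ⟨r0, r1, κ, k0, k1, k2, k3⟩ := hρ τ h1
    have hb := hq.bregman_cutoff_le hp (dens_smul hom) hM h1 r0 r1 k0 k1 k2 k3 X
      (c⁻¹ • G x - τ • X)
    have e2 : τ • X + (c⁻¹ • G x - τ • X) = c⁻¹ • G x := by module
    have e3 : τ • X = c⁻¹ • ((φ x / u x) • X) := by
      rw [smul_smul, hτ]; congr 1; field_simp
    rw [e2, ← e1] at hb
    rw [e3, bregman_smul_smul hq.diff hp (dens_smul hom), abs_inv, abs_of_pos hc,
      Real.inv_rpow hc.le] at hb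
    rw [energyDens, energyDens, e0]
    have hcp : 0 < c ^ p := Real.rpow_pos_of_pos hc p
    calc c ^ p * (p * bregman (dens p H x) (ρ τ • X) (G' x))
        ≤ c ^ p * (p * (M ^ (1 + C) * ((c ^ p)⁻¹ *
          bregman (dens p H x) ((φ x / u x) • X) (G x)))) := by gcongr
      _ = _ := by rw [← hX]; field_simp
  · rw [indicator_of_notMem h]
    -- Off the layer the derivative of the cutoff vanishes, so G' = (φ'/u)∇u and the Bregman
    -- distance is that of a point to itself.
    have hd : deriv ρ τ = 0 := by
      rcases le_or_gt |τ| 1 with h1 | h1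
      · exact hρ0 _ h1
      · refine hρ1 _ ?_
        rw [habs, one_lt_div (mul_pos hc hu)] at h1
        rw [habs, le_div_iff₀ (mul_pos hc hu), ← mul_assoc]
        exact not_lt.1 fun h2 => h ⟨h1, h2⟩
    rw [energyDens, e0, e1, hd, zero_smul, add_zero, bregman_self]
    simp

/-- Truncation of `φ / u` between the levels `c` and `2 c`, with a constant that depends only on
`p` and `C`. -/
theorem exists_energy_truncation_le (hp : 1 < p) (C : ℝ) : ∃ D : ℝ, 0 < D ∧
    ∀ {n : ℕ} {Ω K : Set (E n)} {H : E n → E n → ℝ} {V u φ : E n → ℝ} {G : E n → E n},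
      IsOpen Ω → IsDensity p C Ω H → LocallyIntegrableOn V Ω → ContinuousOn u Ω →
      (∀ x ∈ Ω, 0 < u x) → IsSolution p Ω H V u → IsCompact K → K ⊆ Ω → IsSob p K φ G →
      ∀ c : ℝ, 0 < c → ∃ φ', MemW1pCc p Ω φ' ∧ (∀ x ∈ K, 2 * c * u x ≤ |φ x| → φ' x = u x) ∧
        ENNReal.ofReal (c ^ p) * ENNReal.ofReal (energy p Ω H V φ') ≤
          ENNReal.ofReal D * ∫⁻ x in {x ∈ Ω | c * u x < |φ x| ∧ |φ x| < 2 * c * u x},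
            ENNReal.ofReal (energyDens p Ω H u φ G x) := by
  obtain ⟨ρ, M, hρs, hM, hρa, hρb, hρ0, hρ1, hρ⟩ := exists_cutoff (b := 1 + C) (zero_lt_one.trans hp)
  have hD : 0 < M ^ (1 + C) := Real.rpow_pos_of_pos (by linarith) _
  refine ⟨M ^ (1 + C), hD, ?_⟩
  intro n Ω K H V u φ G hΩ hH hV huc hpos hu hK hKΩ hφ c hc
  obtain ⟨G', hφ', hG'⟩ := hφ.comp_pos hp hΩ huc hpos hu.1 hK hKΩ
    (contDiffOn_mul_comp_div hρs hc) (fun t => by simp [hρa])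
  have hτ : ∀ x, φ x / (c * u x) = φ x / u x / c := fun x => by rw [div_div, mul_comm]
  refine ⟨_, hφ'.memW1pCc hp hK hKΩ, fun x hx h => ?_, ?_⟩
  · have h0 := mul_pos hc (hpos x (hKΩ hx))
    show u x * ρ _ = u x
    rw [hρb, mul_one]
    rw [abs_div, abs_of_pos h0, le_div_iff₀ h0, ← mul_assoc]
    exact h
  obtain ⟨hi', he'⟩ := hu.energy_eq hp hΩ hH hV huc hpos hK hKΩ hφ'
  have hS := (isOpen_setOf_lt_abs_lt hΩ huc hφ.cont c (2 * c)).measurableSet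
  rw [he', ofReal_integral_eq_lintegral_ofReal hi' (energyDens_nonneg hp hH _ _ _),
    ← lintegral_const_mul' _ _ ENNReal.ofReal_ne_top, ← lintegral_const_mul' _ _ ENNReal.ofReal_ne_top]
  have hSΩ : {x | x ∈ Ω ∧ c * u x < |φ x| ∧ |φ x| < 2 * c * u x} ⊆ Ω := fun x hx => hx.1
  rw [← Measure.restrict_restrict_of_subset hSΩ, ← lintegral_indicator hS]
  refine lintegral_mono_ae ?_
  filter_upwards [hH.quasiSymm, hH.hom, ae_restrict_mem hΩ.measurableSet] with x hq hom hxΩ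
  have key := energyDens_cutoff_le (Ω := Ω) (φ := φ) (G := G) hp hM hρ0 hρ1 hρ hq hom hc
    (φ' := fun x => u x * ρ (φ x / (c * u x))) (G' := G') (hpos x hxΩ) (by rw [hτ]) (by
      by_cases hx : x ∈ K
      · rw [hG' x hx, fderiv_mul_comp_div hρs hc (hpos x hxΩ),
          fderiv_mul_comp_div hρs hc (hpos x hxΩ)]
        simp
      · rw [hφ'.grad_eq_zero x hx, hφ.eq_zero x hx, hφ.grad_eq_zero x hx]
        simp [hρa])
  rw [← ENNReal.ofReal_mul (Real.rpow_nonneg hc.le _)]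
  refine (ENNReal.ofReal_le_ofReal key).trans ?_
  by_cases h : x ∈ {x | c * u x < |φ x| ∧ |φ x| < 2 * c * u x}
  · have h' : x ∈ {x | x ∈ Ω ∧ c * u x < |φ x| ∧ |φ x| < 2 * c * u x} := ⟨hxΩ, h⟩
    rw [indicator_of_mem h, indicator_of_mem h', ENNReal.ofReal_mul hD.le]
  · rw [indicator_of_notMem h]; simp

theorem exists_zpow_two_mem_Ico {t : ℝ} (ht : 0 < t) :
    ∃ j : ℤ, 2 * 2 ^ j ≤ t ∧ t < 4 * (2 : ℝ) ^ j := by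
  obtain ⟨j, h1, h2⟩ := exists_mem_Ico_zpow ht one_lt_two
  refine ⟨j - 1, ?_, ?_⟩
  · rw [zpow_sub_one₀ two_ne_zero]; linarith
  · rw [zpow_add_one₀ two_ne_zero] at h2
    rw [zpow_sub_one₀ two_ne_zero]; linarith

/-- The capacitary inequality of Mazya. -/
theorem exists_wInt_le_energy (hp : 1 < p) (C : ℝ) : ∃ D : ℝ≥0, 0 < D ∧
    ∀ {n : ℕ} {Ω : Set (E n)} {H : E n → E n → ℝ} {V u g : E n → ℝ} {L : ℝ≥0},
      IsOpen Ω → IsDensity p C Ω H → LocallyIntegrableOn V Ω → ContinuousOn u Ω →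
      (∀ x ∈ Ω, 0 < u x) → IsSolution p Ω H V u →
      (∀ K ⊆ Ω, IsCompact K → wInt p K g u ≤ L * capacity p Ω H V u K) →
      ∀ φ, MemW1pCc p Ω φ → wInt p Ω g φ ≤ D * L * ENNReal.ofReal (energy p Ω H V φ) := by
  obtain ⟨D, hD, hT⟩ := exists_energy_truncation_le hp C
  have hp0 : 0 < p := by linarith
  refine ⟨((4 : ℝ) ^ p * D).toNNReal, by simpa using by positivity, ?_⟩
  intro n Ω H V u g L hΩ hH hV huc hpos hu hL φ hφ
  obtain ⟨K, G, hK, hKΩ, hφ⟩ := hφ.exists_isSob hΩ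
  -- S j carries the energy of the truncation at level 2^j, N j is the compact set where |φ/u| ≥ 2 ·
  -- 2^j and the truncation equals u, and T j is the part of N j below the next dyadic level. The S
  -- j are disjoint, and the T j cover the set where φ ≠ 0.
  set S : ℤ → Set (E n) := fun j =>
    {x ∈ Ω | 2 ^ j * u x < |φ x| ∧ |φ x| < 2 * 2 ^ j * u x} with hS
  set T : ℤ → Set (E n) := fun j =>
    {x ∈ K | 2 * 2 ^ j * u x ≤ |φ x| ∧ |φ x| < 4 * 2 ^ j * u x} with hTdef
  set N : ℤ → Set (E n) := fun j => {x ∈ K | 2 * 2 ^ j * u x ≤ |φ x|} with hN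
  have hNc : ∀ j, IsCompact (N j) := by
    intro j
    have h1 : ContinuousOn (fun x => |φ x| - 2 * 2 ^ j * u x) K :=
      hφ.cont.abs.continuousOn.sub (continuousOn_const.mul (huc.mono hKΩ))
    refine hK.of_isClosed_subset ?_ (fun x hx => hx.1)
    convert h1.preimage_isClosed_of_isClosed hK.isClosed (isClosed_Ici (a := (0 : ℝ))) using 1
    ext x; simp [hN]
  have hSm : ∀ j, MeasurableSet (S j) := fun j =>
    (isOpen_setOf_lt_abs_lt hΩ huc hφ.cont _ _).measurableSet
  have hSd : Pairwise (Function.onFun Disjoint S) := by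
    have aux : ∀ i j : ℤ, i < j → Disjoint (S i) (S j) := by
      intro i j hij
      refine Set.disjoint_left.2 fun x hi hj => ?_
      have hu0 := hpos x hi.1
      have h1 : (2 : ℝ) ^ (i + 1) ≤ 2 ^ j := zpow_le_zpow_right₀ one_le_two hij
      rw [zpow_add_one₀ two_ne_zero] at h1
      have h2 := mul_le_mul_of_nonneg_right h1 hu0.le
      have h3 := hi.2.2
      have h4 := hj.2.1
      linarith
    intro i j hij
    rcases lt_or_gt_of_ne hij with h | h
    · exact aux i j h
    · exact (aux j i h).symm
  obtain ⟨hi, he⟩ := hu.energy_eq hp hΩ hH hV huc hpos hK hKΩ hφ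
  -- On T j, |φ| < 4 · 2^j u, so the weighted integral is at most (4 · 2^j)^p L cap(N j, u). The
  -- factor (2^j)^p is absorbed by the truncation estimate, and 4^p remains.
  have hstep : ∀ j : ℤ, wInt p (T j) g φ ≤ ENNReal.ofReal (4 ^ p * D) * L *
      ∫⁻ x in S j, ENNReal.ofReal (energyDens p Ω H u φ G x) := by
    intro j
    have hc : (0 : ℝ) < 2 ^ j := by positivity
    obtain ⟨φ', hφ', h1, h2⟩ := hT hΩ hH hV huc hpos hu hK hKΩ hφ (2 ^ j) hc
    have hcap : capacity p Ω H V u (N j) ≤ ENNReal.ofReal (energy p Ω H V φ') :=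
      iInf_le_of_le φ' <| iInf_le_of_le hφ' <| iInf_le _ fun x hx => (h1 x hx.1 hx.2).ge
    have h3 : wInt p (T j) g φ ≤ ENNReal.ofReal ((4 * 2 ^ j) ^ p) * wInt p (N j) g u := by
      rw [wInt, wInt, ← lintegral_const_mul' _ _ ENNReal.ofReal_ne_top]
      refine (setLIntegral_mono' ?_ fun x hx => ?_).trans
        (lintegral_mono_set (s := T j) fun x hx => ⟨hx.1, hx.2.1⟩)
      · have h1 : ContinuousOn (fun x => 4 * 2 ^ j * u x - |φ x|) Ω :=
          (continuousOn_const.mul huc).sub hφ.cont.abs.continuousOn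
        have h2 := (hNc j).measurableSet.inter
          (h1.isOpen_inter_preimage hΩ (isOpen_Ioi (a := (0 : ℝ)))).measurableSet
        have h3 : T j = N j ∩ (Ω ∩ (fun x => 4 * 2 ^ j * u x - |φ x|) ⁻¹' Ioi 0) := by
          ext x
          exact ⟨fun h => ⟨⟨h.1, h.2.1⟩, hKΩ h.1, sub_pos.2 h.2.2⟩,
            fun h => ⟨h.1.1, h.1.2, sub_pos.1 h.2.2⟩⟩
        rwa [h3]
      · rw [← ENNReal.ofReal_mul (by positivity)]
        refine ENNReal.ofReal_le_ofReal ?_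
        have h5 : |φ x| ^ p ≤ (4 * 2 ^ j * |u x|) ^ p :=
          Real.rpow_le_rpow (abs_nonneg _) (hx.2.2.le.trans
            (mul_le_mul_of_nonneg_left (le_abs_self _) (by positivity))) hp0.le
        rw [Real.mul_rpow (by positivity) (abs_nonneg _)] at h5
        calc |g x| * |φ x| ^ p ≤ |g x| * ((4 * 2 ^ j) ^ p * |u x| ^ p) := by gcongr
          _ = _ := by ring
    calc wInt p (T j) g φ ≤ ENNReal.ofReal ((4 * 2 ^ j) ^ p) * wInt p (N j) g u := h3
      _ ≤ ENNReal.ofReal ((4 * 2 ^ j) ^ p) * (L * ENNReal.ofReal (energy p Ω H V φ')) := by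
          gcongr
          exact (hL _ (fun x hx => hKΩ hx.1) (hNc j)).trans (by gcongr)
      _ = ENNReal.ofReal (4 ^ p) * L *
          (ENNReal.ofReal ((2 ^ j) ^ p) * ENNReal.ofReal (energy p Ω H V φ')) := by
          rw [Real.mul_rpow (by positivity) (by positivity), ENNReal.ofReal_mul (by positivity)]
          ring
      _ ≤ ENNReal.ofReal (4 ^ p) * L * (ENNReal.ofReal D *
          ∫⁻ x in S j, ENNReal.ofReal (energyDens p Ω H u φ G x)) := by gcongr
      _ = _ := by rw [ENNReal.ofReal_mul (by positivity)]; ring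
  have hcover : wInt p Ω g φ ≤ ∑' j, wInt p (T j) g φ := by
    refine le_trans ?_ (lintegral_iUnion_le T _)
    rw [wInt]
    have hsub : Function.support (fun x => ENNReal.ofReal (|g x| * |φ x| ^ p)) ⊆ ⋃ j, T j := by
      intro x hx
      have hx0 : φ x ≠ 0 := fun h => hx (by simp [h, Real.zero_rpow hp0.ne'])
      have hxK : x ∈ K := by by_contra h; exact hx0 (hφ.eq_zero x h)
      have hu0 := hpos x (hKΩ hxK)
      obtain ⟨j, h1, h2⟩ := exists_zpow_two_mem_Ico (div_pos (abs_pos.2 hx0) hu0)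
      rw [le_div_iff₀ hu0] at h1
      rw [div_lt_iff₀ hu0] at h2
      exact mem_iUnion.2 ⟨j, hxK, h1, h2⟩
    calc _ ≤ ∫⁻ x, ENNReal.ofReal (|g x| * |φ x| ^ p) := setLIntegral_le_lintegral _ _
      _ = _ := (setLIntegral_eq_of_support_subset hsub).symm
  calc wInt p Ω g φ ≤ ∑' j, wInt p (T j) g φ := hcover
    _ ≤ ∑' j, ENNReal.ofReal (4 ^ p * D) * L *
      ∫⁻ x in S j, ENNReal.ofReal (energyDens p Ω H u φ G x) := ENNReal.tsum_le_tsum hstep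
    _ = ENNReal.ofReal (4 ^ p * D) * L *
      ∫⁻ x in ⋃ j, S j, ENNReal.ofReal (energyDens p Ω H u φ G x) := by
        rw [ENNReal.tsum_mul_left, lintegral_iUnion hSm hSd]
    _ ≤ ENNReal.ofReal (4 ^ p * D) * L *
      ∫⁻ x in Ω, ENNReal.ofReal (energyDens p Ω H u φ G x) := by
        gcongr
        exact iUnion_subset fun j x hx => hx.1
    _ = _ := by
        rw [he, ofReal_integral_eq_lintegral_ofReal hi (energyDens_nonneg hp hH _ _ _)]
        rfl

end Truncation

/-! ### Weighted integrals and the capacitary norm -/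

section CapNorm

variable {n : ℕ} {p C : ℝ} {Ω K : Set (E n)} {H : E n → E n → ℝ} {V u : E n → ℝ}

theorem ae_restrict_of_forall_isCompact (hΩ : IsOpen Ω) {P : E n → Prop}
    (h : ∀ K ⊆ Ω, IsCompact K → ∀ᵐ x ∂(volume.restrict K), P x) :
    ∀ᵐ x ∂(volume.restrict Ω), P x := by
  rw [ae_restrict_iff' hΩ.measurableSet, ae_iff]
  refine measure_null_of_locally_null _ fun x hx => ?_
  simp only [Classical.not_imp] at hx
  obtain ⟨K, hK, hxK, hKΩ⟩ := exists_compact_subset hΩ hx.1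
  have hn := h K hKΩ hK
  rw [ae_restrict_iff' hK.measurableSet, ae_iff] at hn
  refine ⟨_, inter_mem_nhdsWithin _ (mem_interior_iff_mem_nhds.1 hxK),
    measure_mono_null (fun y hy => ?_) hn⟩
  exact fun h' => hy.1 fun _ => h' hy.2

theorem aemeasurable_weight (hΩ : IsOpen Ω) (huc : ContinuousOn u Ω) (hK : K ⊆ Ω) {g : E n → ℝ}
    (hg : AEStronglyMeasurable g (volume.restrict Ω)) :
    AEMeasurable (fun x => ENNReal.ofReal (|g x| * |u x| ^ p)) (volume.restrict K) := by
  have hu := (huc.aemeasurable hΩ.measurableSet (μ := volume)).norm.pow_const p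
  exact (hg.aemeasurable.norm.mul hu).ennreal_ofReal.mono_measure (Measure.restrict_mono hK le_rfl)

theorem wInt_mono (hK : K ⊆ Ω) {g h φ : E n → ℝ}
    (hgh : ∀ᵐ x ∂(volume.restrict Ω), |g x| ≤ |h x|) : wInt p K g φ ≤ wInt p K h φ := by
  refine lintegral_mono_ae ?_
  filter_upwards [ae_restrict_of_ae_restrict_of_subset hK hgh] with x hx
  exact ENNReal.ofReal_le_ofReal
    (mul_le_mul_of_nonneg_right hx (Real.rpow_nonneg (abs_nonneg _) _))

theorem wInt_const_mul (c : ℝ) (g φ : E n → ℝ) :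
    wInt p K (fun x => c * g x) φ = ENNReal.ofReal |c| * wInt p K g φ := by
  rw [wInt, wInt, ← lintegral_const_mul' _ _ ENNReal.ofReal_ne_top]
  refine lintegral_congr fun x => ?_
  rw [← ENNReal.ofReal_mul (abs_nonneg _), abs_mul, mul_assoc]

theorem wInt_add_le (hΩ : IsOpen Ω) (huc : ContinuousOn u Ω) (hK : K ⊆ Ω) {g h : E n → ℝ}
    (hg : AEStronglyMeasurable g (volume.restrict Ω)) :
    wInt p K (fun x => g x + h x) u ≤ wInt p K g u + wInt p K h u := by
  rw [wInt, wInt, wInt, ← lintegral_add_left' (aemeasurable_weight hΩ huc hK hg)]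
  refine lintegral_mono fun x => ?_
  have h0 : 0 ≤ |u x| ^ p := Real.rpow_nonneg (abs_nonneg _) _
  rw [← ENNReal.ofReal_add (by positivity) (by positivity), ← add_mul]
  exact ENNReal.ofReal_le_ofReal (mul_le_mul_of_nonneg_right (abs_add_le _ _) h0)

theorem IsSob.wInt_eq (hp : 1 < p) {φ g : E n → ℝ} {G : E n → E n}
    (hg : LocallyIntegrableOn g Ω) (hK : IsCompact K) (hKΩ : K ⊆ Ω) (hφ : IsSob p K φ G) :
    wInt p Ω g φ = ENNReal.ofReal (∫ x in Ω, |g x| * |φ x| ^ p) :=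
  (ofReal_integral_eq_lintegral_ofReal
    (hφ.integrableOn_potential hp hg.norm hK hKΩ).integrableOn
    (Eventually.of_forall fun _ => mul_nonneg (abs_nonneg _)
      (Real.rpow_nonneg (abs_nonneg _) _))).symm

theorem IsTest.memW1pCc (hp : 1 < p) {φ : E n → ℝ} (hφ : IsTest Ω φ) : MemW1pCc p Ω φ :=
  (isSob_of_contDiff (hφ.1.of_le (by exact_mod_cast le_top)) hφ.2.1).memW1pCc hp hφ.2.1 hφ.2.2

theorem exists_memW1pCc_ge (hp : 1 < p) (hΩ : IsOpen Ω) (huc : ContinuousOn u Ω)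
    (hK : IsCompact K) (hKΩ : K ⊆ Ω) : ∃ φ, MemW1pCc p Ω φ ∧ ∀ x ∈ K, u x ≤ φ x := by
  obtain ⟨χ, hχ, -, hχ1⟩ := exists_isTest_one_nhds hΩ hK hKΩ
  obtain ⟨M, hM⟩ := hK.exists_bound_of_continuousOn (huc.mono hKΩ)
  refine ⟨fun x => M * χ x, IsTest.memW1pCc hp ⟨contDiff_const.mul hχ.1, hχ.2.1.mul_left,
    (closure_mono (Function.support_mul_subset_right _ _)).trans hχ.2.2⟩, fun x hx => ?_⟩
  simp only [Eventually.self_of_nhdsSet hχ1 x hx, mul_one]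
  exact (le_abs_self _).trans (hM x hx)

theorem capacity_lt_top (hp : 1 < p) (hΩ : IsOpen Ω) (huc : ContinuousOn u Ω)
    (hK : IsCompact K) (hKΩ : K ⊆ Ω) : capacity p Ω H V u K < ⊤ := by
  obtain ⟨φ, h1, h2⟩ := exists_memW1pCc_ge hp hΩ huc hK hKΩ
  exact lt_of_le_of_lt (iInf_le_of_le φ <| iInf_le_of_le h1 <| iInf_le _ h2)
    ENNReal.ofReal_lt_top

theorem capNorm_le {g : E n → ℝ} {L : ℝ≥0∞}
    (h : ∀ K ⊆ Ω, IsCompact K → wInt p K g u ≤ L * capacity p Ω H V u K) :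
    capNorm p Ω H V u g ≤ L := by
  induction L with
  | top => exact le_top
  | coe L => exact iInf₂_le L h

/-- The infimum defining the capacitary norm is attained. Positive capacities are finite and can be
divided out; at capacity zero any admissible L already forces the integral to vanish. -/
theorem wInt_le_capNorm_mul (hp : 1 < p) (hΩ : IsOpen Ω) (huc : ContinuousOn u Ω) {g : E n → ℝ}
    (hg : capNorm p Ω H V u g < ⊤) (hKΩ : K ⊆ Ω) (hK : IsCompact K) :
    wInt p K g u ≤ capNorm p Ω H V u g * capacity p Ω H V u K := by
  by_cases h0 : capacity p Ω H V u K = 0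
  · simp only [capNorm, iInf_lt_iff] at hg
    obtain ⟨L, hL, -⟩ := hg
    have := hL K hKΩ hK
    rw [h0, mul_zero] at this ⊢
    exact this
  · rw [← ENNReal.div_le_iff h0 (capacity_lt_top hp hΩ huc hK hKΩ).ne]
    refine le_iInf₂ fun L hL => ?_
    rw [ENNReal.div_le_iff h0 (capacity_lt_top hp hΩ huc hK hKΩ).ne]
    exact hL K hKΩ hK

theorem capNorm_mono (hp : 1 < p) (hΩ : IsOpen Ω) (huc : ContinuousOn u Ω) {g h : E n → ℝ}
    (hgh : ∀ᵐ x ∂(volume.restrict Ω), |g x| ≤ |h x|) :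
    capNorm p Ω H V u g ≤ capNorm p Ω H V u h := by
  by_cases hh : capNorm p Ω H V u h < ⊤
  · exact capNorm_le fun K hKΩ hK =>
      (wInt_mono hKΩ hgh).trans (wInt_le_capNorm_mul hp hΩ huc hh hKΩ hK)
  · rw [not_lt_top_iff.1 hh]; exact le_top

theorem capNorm_congr (hp : 1 < p) (hΩ : IsOpen Ω) (huc : ContinuousOn u Ω) {g h : E n → ℝ}
    (hgh : g =ᵐ[volume.restrict Ω] h) : capNorm p Ω H V u g = capNorm p Ω H V u h :=
  le_antisymm (capNorm_mono hp hΩ huc (hgh.mono fun x hx => by rw [hx]))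
    (capNorm_mono hp hΩ huc (hgh.mono fun x hx => by rw [hx]))

theorem capNorm_add_le (hp : 1 < p) (hΩ : IsOpen Ω) (huc : ContinuousOn u Ω) {g h : E n → ℝ}
    (hg : AEStronglyMeasurable g (volume.restrict Ω)) :
    capNorm p Ω H V u (fun x => g x + h x) ≤ capNorm p Ω H V u g + capNorm p Ω H V u h := by
  by_cases h1 : capNorm p Ω H V u g < ⊤
  · by_cases h2 : capNorm p Ω H V u h < ⊤
    · refine capNorm_le fun K hKΩ hK => (wInt_add_le hΩ huc hKΩ hg).trans ?_
      rw [add_mul]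
      exact add_le_add (wInt_le_capNorm_mul hp hΩ huc h1 hKΩ hK)
        (wInt_le_capNorm_mul hp hΩ huc h2 hKΩ hK)
    · simp [not_lt_top_iff.1 h2]
  · simp [not_lt_top_iff.1 h1]

theorem capNorm_zero : capNorm p Ω H V u (fun _ => 0) = 0 :=
  le_antisymm (capNorm_le fun K _ _ => by simp [wInt]) zero_le

theorem capNorm_const_mul_le (hp : 1 < p) (hΩ : IsOpen Ω) (huc : ContinuousOn u Ω) {c : ℝ}
    (hc : c ≠ 0) (g : E n → ℝ) :
    capNorm p Ω H V u (fun x => c * g x) ≤ ENNReal.ofReal |c| * capNorm p Ω H V u g := by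
  by_cases h1 : capNorm p Ω H V u g < ⊤
  · refine capNorm_le fun K hKΩ hK => ?_
    rw [wInt_const_mul, mul_assoc]
    gcongr
    exact wInt_le_capNorm_mul hp hΩ huc h1 hKΩ hK
  · rw [not_lt_top_iff.1 h1, ENNReal.mul_top (by simpa using hc)]; exact le_top

theorem capNorm_const_mul (hp : 1 < p) (hΩ : IsOpen Ω) (huc : ContinuousOn u Ω) (c : ℝ)
    (g : E n → ℝ) :
    capNorm p Ω H V u (fun x => c * g x) = ENNReal.ofReal |c| * capNorm p Ω H V u g := by
  by_cases hc : c = 0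
  · simp [hc, capNorm_zero]
  refine le_antisymm (capNorm_const_mul_le hp hΩ huc hc g) ?_
  have h1 := capNorm_const_mul_le (H := H) (V := V) hp hΩ huc (inv_ne_zero hc) (fun x => c * g x)
  simp only [inv_mul_cancel_left₀ hc] at h1
  calc _ ≤ ENNReal.ofReal |c| * (ENNReal.ofReal |c⁻¹| * capNorm p Ω H V u fun x => c * g x) := by
        gcongr
    _ = _ := by
        rw [← mul_assoc, ← ENNReal.ofReal_mul (abs_nonneg _), ← abs_mul, mul_inv_cancel₀ hc]
        simp

theorem ae_eq_zero_of_capNorm_eq_zero (hp : 1 < p) (hΩ : IsOpen Ω) (huc : ContinuousOn u Ω)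
    (hpos : ∀ x ∈ Ω, 0 < u x) {g : E n → ℝ} (hg : AEStronglyMeasurable g (volume.restrict Ω))
    (h : capNorm p Ω H V u g = 0) : g =ᵐ[volume.restrict Ω] 0 := by
  refine ae_restrict_of_forall_isCompact hΩ fun K hKΩ hK => ?_
  have h0 := wInt_le_capNorm_mul hp hΩ huc (h ▸ ENNReal.zero_lt_top) hKΩ hK
  rw [h, zero_mul, nonpos_iff_eq_zero, wInt,
    lintegral_eq_zero_iff' (aemeasurable_weight hΩ huc hKΩ hg)] at h0
  filter_upwards [h0, ae_restrict_mem hK.measurableSet] with x hx hxK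
  have hu : 0 < |u x| ^ p := Real.rpow_pos_of_pos (abs_pos.2 (hpos x (hKΩ hxK)).ne') _
  have h1 : |g x| * |u x| ^ p ≤ 0 := ENNReal.ofReal_eq_zero.1 hx
  exact abs_nonpos_iff.1 (nonpos_of_mul_nonpos_left h1 hu)

/-- On a compact set the capacity is finite and |u|^p is bounded away from zero. This identifies the
Hardy-weights with all measurable classes of finite capacitary norm, so limits need no separate
check of integrability. -/
theorem locallyIntegrableOn_of_capNorm_lt_top (hp : 1 < p) (hΩ : IsOpen Ω)
    (huc : ContinuousOn u Ω) (hpos : ∀ x ∈ Ω, 0 < u x) {g : E n → ℝ}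
    (hg : AEStronglyMeasurable g (volume.restrict Ω)) (h : capNorm p Ω H V u g < ⊤) :
    LocallyIntegrableOn g Ω := by
  rw [locallyIntegrableOn_iff hΩ.isLocallyClosed]
  intro K hKΩ hK
  have h0 : wInt p K g u < ⊤ := (wInt_le_capNorm_mul hp hΩ huc h hKΩ hK).trans_lt
    (ENNReal.mul_lt_top h (capacity_lt_top hp hΩ huc hK hKΩ))
  have hcont : ContinuousOn (fun x => (|u x| ^ p)⁻¹) K := by
    refine ContinuousOn.inv₀ (ContinuousOn.rpow_const (huc.mono hKΩ).abs fun x _ =>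
      Or.inr (by linarith)) fun x hx => ?_
    exact (Real.rpow_pos_of_pos (abs_pos.2 (hpos x (hKΩ hx)).ne') _).ne'
  have hgu : IntegrableOn (fun x => |g x| * |u x| ^ p) K := by
    refine ⟨?_, ?_⟩
    · have hu := (huc.aemeasurable hΩ.measurableSet (μ := volume)).norm.pow_const p
      exact ((hg.aemeasurable.norm.mul hu).mono_measure
        (Measure.restrict_mono hKΩ le_rfl)).aestronglyMeasurable
    · rw [hasFiniteIntegral_iff_norm]
      refine lt_of_eq_of_lt (lintegral_congr fun x => ?_) h0
      rw [Real.norm_of_nonneg (mul_nonneg (abs_nonneg _) (Real.rpow_nonneg (abs_nonneg _) _))]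
  have h1 := hgu.mul_continuousOn hcont hK
  refine Integrable.mono h1 (hg.mono_measure (Measure.restrict_mono hKΩ le_rfl)) ?_
  filter_upwards [ae_restrict_mem hK.measurableSet] with x hx
  have hu : 0 < |u x| ^ p := Real.rpow_pos_of_pos (abs_pos.2 (hpos x (hKΩ hx)).ne') _
  rw [mul_assoc, mul_inv_cancel₀ hu.ne', mul_one, Real.norm_eq_abs, Real.norm_eq_abs, abs_abs]

/-- Fatou's lemma for the capacitary norm. -/
theorem capNorm_le_of_tendsto_ae (hp : 1 < p) (hΩ : IsOpen Ω) (huc : ContinuousOn u Ω)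
    {F : ℕ → E n → ℝ} {g : E n → ℝ} {L : ℝ≥0∞} (hL : L < ⊤)
    (hF : ∀ k, AEStronglyMeasurable (F k) (volume.restrict Ω))
    (hlim : ∀ᵐ x ∂(volume.restrict Ω), Tendsto (fun k => F k x) atTop (𝓝 (g x)))
    (hle : ∀ᶠ k in atTop, capNorm p Ω H V u (F k) ≤ L) : capNorm p Ω H V u g ≤ L := by
  refine capNorm_le fun K hKΩ hK => ?_
  have h1 : wInt p K g u ≤ ∫⁻ x in K,
      liminf (fun k => ENNReal.ofReal (|F k x| * |u x| ^ p)) atTop := by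
    refine lintegral_mono_ae ?_
    filter_upwards [ae_restrict_of_ae_restrict_of_subset hKΩ hlim] with x hx
    exact (ENNReal.tendsto_ofReal (hx.abs.mul_const _)).liminf_eq.ge
  refine h1.trans ((lintegral_liminf_le' fun k => aemeasurable_weight hΩ huc hKΩ (hF k)).trans ?_)
  refine liminf_le_of_frequently_le' (Eventually.frequently ?_)
  filter_upwards [hle] with k hk
  exact (wInt_le_capNorm_mul hp hΩ huc (hk.trans_lt hL) hKΩ hK).trans (by gcongr)

/-- A sequence with summable increments in the capacitary norm converges almost everywhere. -/
theorem exists_tendsto_ae_of_capNorm_sub_le (hp : 1 < p) (hΩ : IsOpen Ω)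
    (huc : ContinuousOn u Ω) (hpos : ∀ x ∈ Ω, 0 < u x) {F : ℕ → E n → ℝ} {ε : ℕ → ℝ≥0∞}
    (hε : ∑' k, ε k < ⊤) (hF : ∀ k, AEStronglyMeasurable (F k) (volume.restrict Ω))
    (hle : ∀ k, capNorm p Ω H V u (fun x => F k x - F (k + 1) x) ≤ ε k) :
    ∃ g, StronglyMeasurable g ∧
      ∀ᵐ x ∂(volume.restrict Ω), Tendsto (fun k => F k x) atTop (𝓝 (g x)) := by
  refine exists_stronglyMeasurable_limit_of_tendsto_ae hF ?_
  refine ae_restrict_of_forall_isCompact hΩ fun K hKΩ hK => ?_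
  have hm : ∀ k, AEMeasurable (fun x => ENNReal.ofReal (|F k x - F (k + 1) x| * |u x| ^ p))
      (volume.restrict K) := fun k => aemeasurable_weight hΩ huc hKΩ ((hF k).sub (hF (k + 1)))
  -- The weighted increments have total integral at most (∑ ε k) cap(K, u). As u > 0, the increments
  -- are absolutely summable at almost every point of K.
  have hfin : ∫⁻ x in K, ∑' k, ENNReal.ofReal (|F k x - F (k + 1) x| * |u x| ^ p) < ⊤ := by
    rw [lintegral_tsum hm]
    refine lt_of_le_of_lt (ENNReal.tsum_le_tsum fun k => ?_)
      (lt_of_eq_of_lt (ENNReal.tsum_mul_right (f := ε) (a := capacity p Ω H V u K))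
        (ENNReal.mul_lt_top hε (capacity_lt_top hp hΩ huc hK hKΩ)))
    have hk : ε k < ⊤ := (ENNReal.le_tsum k).trans_lt hε
    exact (wInt_le_capNorm_mul hp hΩ huc ((hle k).trans_lt hk) hKΩ hK).trans
      (by gcongr; exact hle k)
  filter_upwards [ae_lt_top' (AEMeasurable.tsum hm) hfin.ne,
    ae_restrict_mem hK.measurableSet] with x hx hxK
  have hu : 0 < |u x| ^ p := Real.rpow_pos_of_pos (abs_pos.2 (hpos x (hKΩ hxK)).ne') _
  simp only [ENNReal.ofReal_mul (abs_nonneg _), ENNReal.tsum_mul_right] at hx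
  have hx' : ∑' k, ENNReal.ofReal |F k x - F (k + 1) x| ≠ ⊤ := fun h => by
    rw [h, ENNReal.top_mul (by simpa using hu)] at hx
    exact lt_irrefl _ hx
  refine cauchySeq_tendsto_of_complete
    (cauchySeq_of_edist_le_of_tsum_ne_top _ (fun k => ?_) hx')
  rw [edist_dist, Real.dist_eq]

end CapNorm

/-! ### Hardy weights -/

section Hardy

variable {n : ℕ} {p C : ℝ} {Ω K : Set (E n)} {H : E n → E n → ℝ} {V u : E n → ℝ}

theorem IsSolution.energy_nonneg (hp : 1 < p) (hΩ : IsOpen Ω) (hH : IsDensity p C Ω H)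
    (hV : LocallyIntegrableOn V Ω) (huc : ContinuousOn u Ω) (hpos : ∀ x ∈ Ω, 0 < u x)
    (hu : IsSolution p Ω H V u) {φ : E n → ℝ} (hφ : MemW1pCc p Ω φ) :
    0 ≤ energy p Ω H V φ := by
  obtain ⟨K, G, hK, hKΩ, hφ⟩ := hφ.exists_isSob hΩ
  rw [(hu.energy_eq hp hΩ hH hV huc hpos hK hKΩ hφ).2]
  exact integral_nonneg_of_ae (energyDens_nonneg hp hH _ _ _)

theorem hardyNorm_le {g : E n → ℝ} {L : ℝ≥0∞} (hL : L ≠ ⊤)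
    (h : ∀ φ, MemW1pCc p Ω φ → wInt p Ω g φ ≤ L * ENNReal.ofReal (energy p Ω H V φ)) :
    hardyNorm p Ω H V g ≤ L := by
  rw [hardyNorm, ENNReal.inv_le_iff_inv_le]
  refine le_iInf fun φ => le_iInf₂ fun hφ hw => ?_
  have h1 := h φ hφ
  have hL0 : L ≠ 0 := fun h0 => by
    rw [h0, zero_mul] at h1
    exact hw.not_ge h1
  rw [ENNReal.le_div_iff_mul_le (Or.inl hw.ne') (Or.inr ENNReal.ofReal_ne_top)]
  calc _ ≤ L⁻¹ * (L * ENNReal.ofReal (energy p Ω H V φ)) := by gcongr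
    _ = _ := by rw [← mul_assoc, ENNReal.inv_mul_cancel hL0 hL, one_mul]

/-- The infimum inverts into an inequality for each φ with positive weighted integral. Such a φ
excludes an infinite Hardy constant, so the inversion is legitimate. -/
theorem wInt_le_hardyNorm_mul {g φ : E n → ℝ} (hg : hardyNorm p Ω H V g < ⊤)
    (hφ : MemW1pCc p Ω φ) :
    wInt p Ω g φ ≤ hardyNorm p Ω H V g * ENNReal.ofReal (energy p Ω H V φ) := by
  rcases eq_or_ne (wInt p Ω g φ) 0 with hw | hw
  · rw [hw]; exact zero_le
  have h1 : hardyConst p Ω H V g ≤ ENNReal.ofReal (energy p Ω H V φ) / wInt p Ω g φ :=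
    iInf_le_of_le φ <| iInf_le_of_le hφ <| iInf_le _ (pos_iff_ne_zero.2 hw)
  have h2 := ENNReal.mul_le_of_le_div h1
  have h0 : hardyConst p Ω H V g ≠ 0 := ENNReal.inv_lt_top.1 hg |>.ne'
  have ht : hardyConst p Ω H V g ≠ ⊤ := fun h => by
    rw [h, ENNReal.top_mul hw] at h2
    exact ENNReal.ofReal_ne_top (top_le_iff.1 h2)
  calc wInt p Ω g φ = hardyNorm p Ω H V g * (hardyConst p Ω H V g * wInt p Ω g φ) := by
        rw [← mul_assoc, hardyNorm, ENNReal.inv_mul_cancel h0 ht, one_mul]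
    _ ≤ _ := by gcongr

/-- For a competitor φ ≥ u > 0 on K, the integral of |g| u^p over K is at most that of |g| |φ|^p
over Ω, hence at most ‖g‖_ℋ Q[φ]; the infimum over φ yields the capacity. -/
theorem capNorm_le_hardyNorm (hp : 1 < p) (hΩ : IsOpen Ω) (huc : ContinuousOn u Ω)
    (hpos : ∀ x ∈ Ω, 0 < u x) (g : E n → ℝ) :
    capNorm p Ω H V u g ≤ hardyNorm p Ω H V g := by
  by_cases hg : hardyNorm p Ω H V g < ⊤
  swap
  · rw [not_lt_top_iff.1 hg]; exact le_top
  refine capNorm_le fun K hKΩ hK => ?_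
  have key : ∀ φ, MemW1pCc p Ω φ → (∀ x ∈ K, u x ≤ φ x) →
      wInt p K g u ≤ hardyNorm p Ω H V g * ENNReal.ofReal (energy p Ω H V φ) := by
    intro φ hφ hφK
    refine le_trans ?_ (wInt_le_hardyNorm_mul hg hφ)
    refine (setLIntegral_mono' hK.measurableSet fun x hx => ?_).trans (lintegral_mono_set hKΩ)
    refine ENNReal.ofReal_le_ofReal (mul_le_mul_of_nonneg_left ?_ (abs_nonneg _))
    exact Real.rpow_le_rpow (abs_nonneg _)
      (abs_le_abs_of_nonneg (hpos x (hKΩ hx)).le (hφK x hx)) (by linarith)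
  rcases eq_or_ne (hardyNorm p Ω H V g) 0 with h0 | h0
  · obtain ⟨φ, hφ, hφK⟩ := exists_memW1pCc_ge hp hΩ huc hK hKΩ
    have := key φ hφ hφK
    rw [h0, zero_mul] at this ⊢
    exact this
  · rw [mul_comm, ← ENNReal.div_le_iff h0 hg.ne]
    refine le_iInf fun φ => le_iInf₂ fun hφ hφK => ?_
    rw [ENNReal.div_le_iff h0 hg.ne, mul_comm]
    exact key φ hφ hφK

/-- Hardy-weights are defined by test functions, the norm by W^{1,p} ∩ C_c. Mollification carries
the inequality from the former to the latter. -/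
theorem IsHardyWeight.hardyNorm_lt_top (hp : 1 < p) (hΩ : IsOpen Ω) (hH : IsDensity p C Ω H)
    (hV : LocallyIntegrableOn V Ω) {g : E n → ℝ} (hg : IsHardyWeight p Ω H V g) :
    hardyNorm p Ω H V g < ⊤ := by
  obtain ⟨hgi, c, hc, h⟩ := hg
  refine lt_of_le_of_lt (hardyNorm_le (L := ENNReal.ofReal c⁻¹) ENNReal.ofReal_ne_top
    fun φ hφ => ?_) ENNReal.ofReal_lt_top
  obtain ⟨K, G, hK, hKΩ, hφ⟩ := hφ.exists_isSob hΩ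
  obtain ⟨F, hF, hE, hI⟩ := hφ.exists_tendsto_energy hp hΩ hH hV hgi hK hKΩ
  have h1 := le_of_tendsto_of_tendsto' (hI.const_mul c) hE fun k => h _ (hF k)
  rw [hφ.wInt_eq hp hgi hK hKΩ, ← ENNReal.ofReal_mul (by positivity)]
  refine ENNReal.ofReal_le_ofReal ?_
  rw [inv_mul_eq_div, le_div_iff₀ hc, mul_comm]
  exact h1

theorem isHardyWeight_of_wInt_le (hp : 1 < p) {g : E n → ℝ} (hg : LocallyIntegrableOn g Ω)
    (hE : ∀ φ, MemW1pCc p Ω φ → 0 ≤ energy p Ω H V φ) {L : ℝ≥0}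
    (h : ∀ φ, MemW1pCc p Ω φ → wInt p Ω g φ ≤ L * ENNReal.ofReal (energy p Ω H V φ)) :
    IsHardyWeight p Ω H V g := by
  -- L may be zero, while the Hardy inequality asks for a positive finite constant; L + 1 serves in
  -- all cases.
  have hL : (0 : ℝ) < L + 1 := by positivity
  refine ⟨hg, (L + 1 : ℝ)⁻¹, by positivity, fun φ hφ => ?_⟩
  have h1 := h φ (hφ.memW1pCc hp)
  have h0 := hE φ (hφ.memW1pCc hp)
  rw [(isSob_of_contDiff (hφ.1.of_le (by exact_mod_cast le_top)) hφ.2.1).wInt_eq hp hg hφ.2.1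
    hφ.2.2, ← ENNReal.ofReal_coe_nnreal, ← ENNReal.ofReal_mul L.coe_nonneg,
    ENNReal.ofReal_le_ofReal_iff (mul_nonneg L.coe_nonneg h0)] at h1
  rw [inv_mul_le_iff₀ hL]
  linarith

/-- The space of all weights with finite capacitary norm is complete. -/
theorem isBanachSpace_capNorm (hp : 1 < p) (hΩ : IsOpen Ω) (huc : ContinuousOn u Ω)
    (hpos : ∀ x ∈ Ω, 0 < u x) :
    IsBanachSpace {f : E n →ₘ[volume.restrict Ω] ℝ | capNorm p Ω H V u f < ⊤}
      (fun f => capNorm p Ω H V u f) := by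
  have hcongr : ∀ {g h : E n → ℝ}, g =ᵐ[volume.restrict Ω] h →
      capNorm p Ω H V u g = capNorm p Ω H V u h := fun h => capNorm_congr hp hΩ huc h
  have hzero : capNorm p Ω H V u (0 : E n →ₘ[volume.restrict Ω] ℝ) = 0 :=
    (hcongr AEEqFun.coeFn_zero).trans capNorm_zero
  have hadd : ∀ f g : E n →ₘ[volume.restrict Ω] ℝ,
      capNorm p Ω H V u ↑(f + g) ≤ capNorm p Ω H V u f + capNorm p Ω H V u g := fun f g =>
    (hcongr (AEEqFun.coeFn_add f g)).trans_le (capNorm_add_le hp hΩ huc f.aestronglyMeasurable)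
  have hsmul : ∀ (c : ℝ) (f : E n →ₘ[volume.restrict Ω] ℝ),
      capNorm p Ω H V u ↑(c • f) = ENNReal.ofReal |c| * capNorm p Ω H V u f := fun c f =>
    (hcongr (AEEqFun.coeFn_smul c f)).trans (capNorm_const_mul hp hΩ huc c f)
  refine ⟨by simp [hzero], fun f hf g hg => (hadd f g).trans_lt (ENNReal.add_lt_top.2 ⟨hf, hg⟩),
    fun c f hf => ?_, fun f hf => hf, fun f _ => ⟨fun h => ?_, fun h => h ▸ hzero⟩,
    fun c f _ => hsmul c f, fun f _ g _ => hadd f g, fun F hF hC => ?_⟩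
  · show capNorm p Ω H V u _ < ⊤
    rw [hsmul c f]
    exact ENNReal.mul_lt_top ENNReal.ofReal_lt_top hf
  · exact AEEqFun.ext ((ae_eq_zero_of_capNorm_eq_zero hp hΩ huc hpos f.aestronglyMeasurable
      h).trans AEEqFun.coeFn_zero.symm)
  have hε : ∀ m : ℕ, (0 : ℝ≥0∞) < 2⁻¹ ^ m := fun m => ENNReal.pow_pos (by simp) m
  choose N hN using fun m : ℕ => hC (2⁻¹ ^ m) (hε m)
  -- Partial sums of the N i are monotone and dominate N m, so the increments along κ are at most
  -- 2^(-m).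
  set κ : ℕ → ℕ := fun m => ∑ i ∈ Finset.range (m + 1), N i with hκ
  have hκm : Monotone κ := monotone_nat_of_le_succ fun m => by
    rw [hκ]; simp only [Finset.sum_range_succ _ (m + 1)]; omega
  have hκN : ∀ m, N m ≤ κ m := fun m => by
    rw [hκ]; simp only [Finset.sum_range_succ]; omega
  have hF' : ∀ k, AEStronglyMeasurable (F k) (volume.restrict Ω) := fun k =>
    (F k).aestronglyMeasurable
  obtain ⟨g, hg, hlim⟩ := exists_tendsto_ae_of_capNorm_sub_le (H := H) (V := V) hp hΩ huc hpos
    (F := fun k => F (κ k)) (ε := fun m => 2⁻¹ ^ m)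
    (by rw [ENNReal.tsum_geometric]; simp) (fun k => hF' _) (fun k => by
      refine (hcongr (AEEqFun.coeFn_sub _ _)).symm.trans_le (hN k _ (hκN k) _ ?_).le
      exact (hκN k).trans (hκm k.le_succ))
  set f : E n →ₘ[volume.restrict Ω] ℝ := AEEqFun.mk g hg.aestronglyMeasurable with hf
  have hfg : f =ᵐ[volume.restrict Ω] g := AEEqFun.coeFn_mk _ _
  -- Fatou's lemma for F j - F (κ k) as k → ∞ turns a.e. convergence of the subsequence into norm
  -- convergence of the whole sequence.
  have hconv : ∀ m, ∀ j ≥ N m, capNorm p Ω H V u ↑(F j - f) ≤ 2⁻¹ ^ m := by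
    intro m j hj
    refine capNorm_le_of_tendsto_ae hp hΩ huc (F := fun k => ↑(F j - F (κ k)))
      (ENNReal.pow_lt_top (by simp)) (fun k => AEEqFun.aestronglyMeasurable _) ?_ ?_
    · have hsub := ae_all_iff.2 fun k => AEEqFun.coeFn_sub (F j) (F (κ k))
      filter_upwards [hlim, hfg, hsub, AEEqFun.coeFn_sub (F j) f] with x h1 h2 h3 h4
      simp only [h3, h4, Pi.sub_apply, h2]
      exact h1.const_sub _
    · filter_upwards [eventually_ge_atTop m] with k hk
      exact (hN m j hj _ ((hκN m).trans (hκm hk))).le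
  refine ⟨f, ?_, ?_⟩
  · have h1 := hadd (F (N 0)) (f - F (N 0))
    have h2 := hsmul (-1) (F (N 0) - f)
    rw [neg_one_smul, neg_sub, abs_neg, abs_one, ENNReal.ofReal_one, one_mul] at h2
    rw [add_sub_cancel, h2] at h1
    exact h1.trans_lt (ENNReal.add_lt_top.2 ⟨hF _, (hconv 0 _ le_rfl).trans_lt (by simp)⟩)
  · rw [ENNReal.tendsto_nhds_zero]
    intro δ hδ
    obtain ⟨m, hm⟩ := ENNReal.exists_inv_two_pow_lt hδ.ne'
    filter_upwards [eventually_ge_atTop (N m)] with j hj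
    exact (hconv m j hj).trans hm.le

/-- The characterization of the Hardy weights by the capacitary norm. -/
theorem hardy_weights_capNorm (hp : 1 < p) (C : ℝ) : ∃ D : ℝ≥0, 0 < D ∧
    ∀ {n : ℕ} {Ω : Set (E n)} {H : E n → E n → ℝ} {V u : E n → ℝ},
      IsOpen Ω → IsDensity p C Ω H → LocallyIntegrableOn V Ω → ContinuousOn u Ω →
      (∀ x ∈ Ω, 0 < u x) → IsSolution p Ω H V u →
      (∀ g, LocallyIntegrableOn g Ω →
        (IsHardyWeight p Ω H V g ↔ capNorm p Ω H V u g < ⊤)) ∧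
      (∀ g, IsHardyWeight p Ω H V g → capNorm p Ω H V u g ≤ hardyNorm p Ω H V g ∧
        hardyNorm p Ω H V g ≤ D * capNorm p Ω H V u g) ∧
      IsBanachSpace {f : E n →ₘ[volume.restrict Ω] ℝ | IsHardyWeight p Ω H V f}
        (fun f => capNorm p Ω H V u f) := by
  obtain ⟨D, hD, hmaz⟩ := exists_wInt_le_energy hp C
  refine ⟨D, hD, ?_⟩
  intro n Ω H V u hΩ hH hV huc hpos hu
  have hweight : ∀ g, capNorm p Ω H V u g < ⊤ → ∀ φ, MemW1pCc p Ω φ → wInt p Ω g φ ≤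
      (D * (capNorm p Ω H V u g).toNNReal : ℝ≥0) * ENNReal.ofReal (energy p Ω H V φ) := by
    intro g hg φ hφ
    rw [ENNReal.coe_mul]
    refine hmaz hΩ hH hV huc hpos hu (fun K hKΩ hK => ?_) φ hφ
    rw [ENNReal.coe_toNNReal hg.ne]
    exact wInt_le_capNorm_mul hp hΩ huc hg hKΩ hK
  have hlt : ∀ g, IsHardyWeight p Ω H V g → capNorm p Ω H V u g < ⊤ := fun g hg =>
    (capNorm_le_hardyNorm hp hΩ huc hpos g).trans_lt (hg.hardyNorm_lt_top hp hΩ hH hV)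
  have hiff : ∀ g, LocallyIntegrableOn g Ω →
      (IsHardyWeight p Ω H V g ↔ capNorm p Ω H V u g < ⊤) := fun g hg =>
    ⟨hlt g, fun h => isHardyWeight_of_wInt_le hp hg
      (fun φ hφ => hu.energy_nonneg hp hΩ hH hV huc hpos hφ) (hweight g h)⟩
  refine ⟨hiff, fun g hg => ⟨capNorm_le_hardyNorm hp hΩ huc hpos g, ?_⟩, ?_⟩
  · refine (hardyNorm_le ENNReal.coe_ne_top (hweight g (hlt g hg))).trans_eq ?_
    rw [ENNReal.coe_mul, ENNReal.coe_toNNReal (hlt g hg).ne]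
  · have e : {f : E n →ₘ[volume.restrict Ω] ℝ | IsHardyWeight p Ω H V f}
        = {f : E n →ₘ[volume.restrict Ω] ℝ | capNorm p Ω H V u f < ⊤} := by
      ext f
      exact ⟨hlt _, fun h => (hiff _ (locallyIntegrableOn_of_capNorm_lt_top hp hΩ huc hpos
        f.aestronglyMeasurable h)).2 h⟩
    rw [e]
    exact isBanachSpace_capNorm hp hΩ huc hpos

end Hardy

end FinslerHardy

end

/-! ### The main theorem. -/

theorem theorem3p14 (p s : ℝ) (hp : 1 < p) (hs : 1 < s) :
    -- the constant depends only on `p, s, n`, and only on `p, s` if `p ≤ s`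
    ∃ C : ℕ → ℝ≥0, (∀ n, 0 < C n) ∧ (p ≤ s → ∀ m n, C m = C n) ∧
      ∀ (n : ℕ), 2 ≤ n → ∀ (Ω : Set (E n)), IsDom Ω →
      ∀ (a : E n → Fin n → ℝ), IsWeight Ω a →
      ∀ (A : E n → Matrix (Fin n) (Fin n) ℝ), IsEllipticMatrix Ω A →
      ∀ (q : ℝ) (V : E n → ℝ), MemMorreyLoc p q Ω V →
      ∀ (u : E n → ℝ), ContinuousOn u Ω → (∀ x ∈ Ω, 0 < u x) →
        IsSolution p Ω (mixedNorm p s a A) V u →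
        (∀ g : E n → ℝ, LocallyIntegrableOn g Ω →
          (IsHardyWeight p Ω (mixedNorm p s a A) V g ↔
            capNorm p Ω (mixedNorm p s a A) V u g < ⊤)) ∧
        (∀ g : E n → ℝ, IsHardyWeight p Ω (mixedNorm p s a A) V g →
          capNorm p Ω (mixedNorm p s a A) V u g ≤ hardyNorm p Ω (mixedNorm p s a A) V g ∧
          hardyNorm p Ω (mixedNorm p s a A) V g ≤
            C n * capNorm p Ω (mixedNorm p s a A) V u g) ∧
        -- Hardy-weights, modulo equality a.e. in `Ω`, form a Banach space
        IsBanachSpace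
          {f : E n →ₘ[volume.restrict Ω] ℝ | IsHardyWeight p Ω (mixedNorm p s a A) V f}
          (fun f => capNorm p Ω (mixedNorm p s a A) V u f) := by
  obtain ⟨C, -, hC⟩ := exists_isDensity_mixedNorm hp hs
  obtain ⟨D, hD, h⟩ := hardy_weights_capNorm hp C
  -- The quasi-symmetry constant is the same in all dimensions, so one D serves for every n, whether
  -- or not p ≤ s.
  refine ⟨fun _ => D, fun _ => hD, fun _ _ _ => rfl, ?_⟩
  intro n _ Ω hΩ a ha A hA q V hV u huc hpos hu
  exact h hΩ.1 (hC n Ω a A hΩ.1 ha hA) (hV.locallyIntegrableOn hΩ.1) huc hpos hu
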